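/- Let $\mathbb K$ be an algebraically closed field of characteristic zero. For a $\mathbb Z$-graded vector space $V=\bigoplus_i V^i$ over $\mathbb K$, let $V[1]$ be the shifted space with $V[1]^i=V^{i+1}$, let $\bigodot^n V[1]$ be its graded symmetric powers, and consider $\bigoplus_{n\ge 1}\bigodot^n V[1]$ as the reduced symmetric graded coalgebra. An $L_\infty$-algebra $(V,q_1,q_2,\ldots)$ is a $\mathbb Z$-graded vector space $V$ with linear maps $q_k\colon \bigodot^k V[1]\to V[1]$ of degree $1$, $k\ge 1$, such that the map $Q$ on $\bigoplus_{n\ge1}\bigodot^nV[1]$ given by $$Q(v_1\odot\cdots\odot v_n)=\sum_{k=1}^n\ \sum_{\sigma\in S(k,n-k)}\epsilon(\sigma)\, q_k(v_{\sigma(1)}\odot\cdots\odot v_{\sigma(k)})\odot v_{\sigma(k+1)}\odot\cdots\odot v_{\sigma(n)}$$ satisfies $QQ=0$; here $S(k,n-k)$ is the set of unshuffles and $\epsilon(\sigma)$ the Koszul sign. In particular $(V[1],q_1)$ is a complex. The $L_\infty$-algebra is abelian if $q_k=0$ for all $k\ge 2$. An $L_\infty$-morphism $f_\infty\colon (V,q_1,q_2,\ldots)\to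 (W,r_1,r_2,\ldots)$ is a sequence of linear maps $f_n\colon\bigodot^nV[1]\to W[1]$ of degree $0$, $n\ge1$, such that the unique morphism of graded coalgebras $\bigoplus_{n\ge1}\bigodot^nV[1]\to\bigoplus_{n\ge1}\bigodot^nW[1]$ lifting $\sum_n f_n$ commutes with the codifferentials $Q$ of $V$ and $W$. Its linear part $f_1\colon (V[1],q_1)\to(W[1],r_1)$ is then a morphism of complexes; $f_\infty$ is a quasi-isomorphism if $f_1$ induces an isomorphism in cohomology. Two $L_\infty$-algebras are quasi-isomorphic if they are equivalent under the equivalence relation generated by: $V\sim W$ if there is a quasi-isomorphism $V\to W$. An $L_\infty$-algebra is quasi-abelian if it is quasi-isomorphic to an abelian $L_\infty$-algebra. **Lemma.** Let $(V,q_1,q_2,\ldots)$ and $(W,r_1,r_2,\ldots)$ be $L_\infty$-algebras over $\mathbb K$ with $W$ quasi-abelian, and let $f_\infty\colon V\to W$ be an $L_\infty$-morphism. If the linear part $f_1$ is injective in cohomology, that is, the induced map $H^*(V[1],q_1)\to H^*(W[1],r_1)$ is injective, then $V$ is quasi-abelian. -/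

import Mathlib

open scoped TensorProduct DirectSum

universe w u

noncomputable section

namespace LInf

/-! ### The graded symmetric algebra -/

section GradedSymmetric

variable {K : Type w} [Field K] {U : Type u} [AddCommGroup U] [Module K U]

/-- The relations `a ⊗ b = (-1)^(ij) b ⊗ a`, for `a` of degree `i` and `b` of degree `j`. -/
inductive SymRel (𝒰 : ℤ → Submodule K U) : TensorAlgebra K U → TensorAlgebra K U → Prop
  | comm (i j : ℤ) (a b : U) (ha : a ∈ 𝒰 i) (hb : b ∈ 𝒰 j) :
      SymRel 𝒰 (TensorAlgebra.ι K a * TensorAlgebra.ι K b)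
        ((-1 : ℤˣ) ^ (i * j) • (TensorAlgebra.ι K b * TensorAlgebra.ι K a))

/-- The graded symmetric algebra `⨁_{n ≥ 0} ⨀ⁿ U` of a graded vector space `U = ⨁ 𝒰 i`; its
product is written `⊙` in the comments. -/
def Sym (𝒰 : ℤ → Submodule K U) : Type (max w u) := RingQuot (SymRel 𝒰)

instance (𝒰 : ℤ → Submodule K U) : Ring (Sym 𝒰) := inferInstanceAs (Ring (RingQuot (SymRel 𝒰)))

instance (𝒰 : ℤ → Submodule K U) : Algebra K (Sym 𝒰) :=
  inferInstanceAs (Algebra K (RingQuot (SymRel 𝒰)))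

namespace Sym

variable (𝒰 : ℤ → Submodule K U)

/-- The quotient map from the tensor algebra. -/
def mk : TensorAlgebra K U →ₐ[K] Sym 𝒰 := RingQuot.mkAlgHom K (SymRel 𝒰)

/-- The inclusion of `U = ⨀¹ U`. -/
def ι : U →ₗ[K] Sym 𝒰 := (mk 𝒰).toLinearMap ∘ₗ TensorAlgebra.ι K

theorem ι_comm {i j : ℤ} {a b : U} (ha : a ∈ 𝒰 i) (hb : b ∈ 𝒰 j) :
    ι 𝒰 a * ι 𝒰 b = (-1 : ℤˣ) ^ (i * j) • (ι 𝒰 b * ι 𝒰 a) := by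
  have h : mk 𝒰 _ = mk 𝒰 _ := RingQuot.mkAlgHom_rel K (SymRel.comm (𝒰 := 𝒰) i j a b ha hb)
  rw [Units.smul_def, map_zsmul, map_mul, map_mul] at h
  rw [Units.smul_def]
  exact h

variable {A : Type*} [Ring A] [Algebra K A]

/-- The universal property of the graded symmetric algebra. -/
def lift (f : U →ₗ[K] A)
    (hf : ∀ (i j : ℤ) (a b : U), a ∈ 𝒰 i → b ∈ 𝒰 j →
      f a * f b = (-1 : ℤˣ) ^ (i * j) • (f b * f a)) : Sym 𝒰 →ₐ[K] A :=
  RingQuot.liftAlgHom K ⟨TensorAlgebra.lift K f, by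
    rintro _ _ ⟨i, j, a, b, ha, hb⟩
    rw [Units.smul_def, map_zsmul, map_mul, map_mul, TensorAlgebra.lift_ι_apply,
      TensorAlgebra.lift_ι_apply, hf i j a b ha hb, Units.smul_def]⟩

@[simp]
theorem lift_ι (f : U →ₗ[K] A)
    (hf : ∀ (i j : ℤ) (a b : U), a ∈ 𝒰 i → b ∈ 𝒰 j →
      f a * f b = (-1 : ℤˣ) ^ (i * j) • (f b * f a)) (a : U) :
    lift 𝒰 f hf (ι 𝒰 a) = f a := by
  have h : lift 𝒰 f hf (mk 𝒰 (TensorAlgebra.ι K a)) = TensorAlgebra.lift K f _ :=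
    RingQuot.liftAlgHom_mkAlgHom_apply K _ _ _
  rw [TensorAlgebra.lift_ι_apply] at h
  exact h

theorem algHom_ext {f g : Sym 𝒰 →ₐ[K] A} (h : ∀ a, f (ι 𝒰 a) = g (ι 𝒰 a)) : f = g := by
  apply RingQuot.ringQuot_ext'
  apply TensorAlgebra.hom_ext
  ext a
  exact h a

theorem induction {P : Sym 𝒰 → Prop} (h0 : ∀ r : K, P (algebraMap K _ r))
    (h1 : ∀ a, P (ι 𝒰 a)) (hm : ∀ x y, P x → P y → P (x * y))
    (ha : ∀ x y, P x → P y → P (x + y)) (x : Sym 𝒰) : P x := by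
  obtain ⟨x, rfl⟩ : ∃ y, mk 𝒰 y = x := RingQuot.mkAlgHom_surjective K (SymRel 𝒰) x
  induction x using TensorAlgebra.induction with
  | algebraMap r => rw [AlgHom.commutes]; exact h0 r
  | ι a => exact h1 a
  | mul x y hx hy => rw [map_mul]; exact hm _ _ hx hy
  | add x y hx hy => rw [map_add]; exact ha _ _ hx hy

/-- The `n`-th graded symmetric power `⨀ⁿ U`. -/
def power (n : ℕ) : Submodule K (Sym 𝒰) := LinearMap.range (ι 𝒰) ^ n

/-- The elements of degree `d` of the graded symmetric algebra: the span of the products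
`v₁ ⊙ ⋯ ⊙ vₙ` of homogeneous elements whose degrees add up to `d`. -/
def deg (d : ℤ) : Submodule K (Sym 𝒰) :=
  Submodule.span K {x | ∃ l : List (Σ i, 𝒰 i),
    (l.map Sigma.fst).sum = d ∧ (l.map fun v => ι 𝒰 (v.2 : U)).prod = x}

theorem ι_mem_deg {i : ℤ} {a : U} (ha : a ∈ 𝒰 i) : ι 𝒰 a ∈ deg 𝒰 i :=
  Submodule.subset_span ⟨[⟨i, a, ha⟩], by simp, by simp⟩

instance deg.gradedMonoid : SetLike.GradedMonoid (deg 𝒰) where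
  one_mem := Submodule.subset_span ⟨[], by simp, by simp⟩
  mul_mem i j x y hx hy := by
    have h : deg 𝒰 i * deg 𝒰 j ≤ deg 𝒰 (i + j) := by
      unfold deg
      rw [Submodule.span_mul_span]
      apply Submodule.span_mono
      rintro _ ⟨_, ⟨l, hl, rfl⟩, _, ⟨m, hm, rfl⟩, rfl⟩
      exact ⟨l ++ m, by simp [hl, hm], by simp⟩
    exact h (Submodule.mul_mem_mul hx hy)

/-- The augmentation, with kernel `⨁_{n ≥ 1} ⨀ⁿ U`. -/
def counit : Sym 𝒰 →ₐ[K] K := lift 𝒰 (0 : U →ₗ[K] K) (by simp)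

@[simp]
theorem counit_ι (a : U) : counit 𝒰 (ι 𝒰 a) = 0 := by simp [counit]

/-- The projection of the graded symmetric algebra onto `⨀¹ U = U`, along the sum of the other
symmetric powers. It is the linear part of the algebra morphism to the square zero extension
`K ⊕ U` that sends `a : U` to `(0, a)`. -/
def proj : Sym 𝒰 →ₗ[K] U :=
  letI : Module Kᵐᵒᵖ U := Module.compHom _ ((RingHom.id K).fromOpposite mul_comm)
  haveI : IsCentralScalar K U := ⟨fun _ _ => rfl⟩
  (TrivSqZeroExt.sndHom K U).comp
    (lift 𝒰 (A := TrivSqZeroExt K U) (TrivSqZeroExt.inrHom K U) (by simp)).toLinearMap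

@[simp]
theorem proj_ι (a : U) : proj 𝒰 (ι 𝒰 a) = a := by simp [proj]

theorem proj_algebraMap (r : K) : proj 𝒰 (algebraMap K _ r) = 0 := by
  simp only [proj, LinearMap.comp_apply, AlgHom.toLinearMap_apply, AlgHom.commutes]
  rfl

theorem proj_mul (x y : Sym 𝒰) :
    proj 𝒰 (x * y) = counit 𝒰 x • proj 𝒰 y + counit 𝒰 y • proj 𝒰 x := by
  let _ : Module Kᵐᵒᵖ U := Module.compHom _ ((RingHom.id K).fromOpposite mul_comm)
  have _ : IsCentralScalar K U := ⟨fun _ _ => rfl⟩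
  have h : ∀ x, (lift 𝒰 (A := TrivSqZeroExt K U) (TrivSqZeroExt.inrHom K U) (by simp) x).fst
      = counit 𝒰 x := by
    intro x
    have : (TrivSqZeroExt.fstHom K K U).comp
        (lift 𝒰 (A := TrivSqZeroExt K U) (TrivSqZeroExt.inrHom K U) (by simp)) = counit 𝒰 := by
      apply algHom_ext
      intro a
      simp
    exact DFunLike.congr_fun this x
  simp only [proj, LinearMap.comp_apply, AlgHom.toLinearMap_apply, map_mul,
    TrivSqZeroExt.sndHom_apply, TrivSqZeroExt.snd_mul, h]
  rfl

/-- The reduced symmetric space `⨁_{n ≥ 1} ⨀ⁿ U`. -/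
def Red : Submodule K (Sym 𝒰) := LinearMap.ker (counit 𝒰).toLinearMap

/-- The projection onto `⨁_{n ≥ 1} ⨀ⁿ U` along the scalars `⨀⁰ U = K`. -/
def toRed : Sym 𝒰 →ₗ[K] Red 𝒰 :=
  (LinearMap.id - Algebra.linearMap K (Sym 𝒰) ∘ₗ (counit 𝒰).toLinearMap).codRestrict _ (by
    intro x
    simp [Red])

theorem coe_toRed (x : Sym 𝒰) : (toRed 𝒰 x : Sym 𝒰) = x - algebraMap K _ (counit 𝒰 x) := rfl

@[simp]
theorem toRed_coe (x : Red 𝒰) : toRed 𝒰 (x : Sym 𝒰) = x := by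
  have h : counit 𝒰 (x : Sym 𝒰) = 0 := x.2
  ext
  simp [coe_toRed, h]

@[simp]
theorem toRed_one : toRed 𝒰 1 = 0 := by
  ext
  simp [coe_toRed]

/-- The inclusion of `U = ⨀¹ U` into the reduced symmetric space. -/
def ιRed : U →ₗ[K] Red 𝒰 := (ι 𝒰).codRestrict _ (fun a => counit_ι 𝒰 a)

@[simp]
theorem coe_ιRed (a : U) : (ιRed 𝒰 a : Sym 𝒰) = ι 𝒰 a := rfl

/-- The projection of the reduced symmetric space onto `⨀¹ U = U`. -/
def projRed : Red 𝒰 →ₗ[K] U := proj 𝒰 ∘ₗ (Red 𝒰).subtype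

theorem proj_one : proj 𝒰 1 = 0 := by
  have h := proj_algebraMap 𝒰 1
  rwa [map_one] at h

theorem counit_eq_zero {j : ℤ} (hj : j ≠ 0) {a : Sym 𝒰} (ha : a ∈ deg 𝒰 j) : counit 𝒰 a = 0 := by
  induction ha using Submodule.span_induction with
  | mem x hx =>
    obtain ⟨l, hl, rfl⟩ := hx
    cases l with
    | nil => exact absurd hl.symm hj
    | cons v l => simp
  | zero => simp
  | add x y _ _ hx hy => rw [map_add, hx, hy, add_zero]
  | smul r x _ hx => rw [map_smul, hx, smul_zero]

theorem proj_mem {j : ℤ} {a : Sym 𝒰} (ha : a ∈ deg 𝒰 j) : proj 𝒰 a ∈ 𝒰 j := by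
  induction ha using Submodule.span_induction with
  | mem x hx =>
    obtain ⟨l, hl, rfl⟩ := hx
    match l, hl with
    | [], _ =>
      simp [proj_one]
    | [v], hl =>
      subst hl
      simp
    | v :: w :: l, _ => simp [proj_mul]
  | zero => simp
  | add x y _ _ hx hy => rw [map_add]; exact add_mem hx hy
  | smul r x _ hx => rw [map_smul]; exact Submodule.smul_mem _ _ hx

theorem projRed_ιRed (a : U) : projRed 𝒰 (ιRed 𝒰 a) = a := proj_ι 𝒰 a

variable [DirectSum.Decomposition 𝒰]

/-- Auxiliary: the inclusion of `U` into the direct sum of the homogeneous parts. -/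
def gradedι : U →ₗ[K] ⨁ i, deg 𝒰 i :=
  DirectSum.toModule K ℤ _ (fun i => DirectSum.lof K ℤ (fun i => deg 𝒰 i) i ∘ₗ
    (ι 𝒰 ∘ₗ (𝒰 i).subtype).codRestrict (deg 𝒰 i) (fun a => ι_mem_deg 𝒰 a.2)) ∘ₗ
    (DirectSum.decomposeLinearEquiv 𝒰).toLinearMap

theorem gradedι_apply {i : ℤ} {a : U} (ha : a ∈ 𝒰 i) :
    gradedι 𝒰 a = DirectSum.of (fun i => deg 𝒰 i) i ⟨ι 𝒰 a, ι_mem_deg 𝒰 ha⟩ := by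
  simp only [gradedι, LinearMap.comp_apply, LinearEquiv.coe_coe,
    DirectSum.decomposeLinearEquiv_apply]
  rw [DirectSum.decompose_of_mem 𝒰 ha, ← DirectSum.lof_eq_of K, DirectSum.toModule_lof]
  rfl

/-- Auxiliary: the decomposition of the graded symmetric algebra by degree. -/
def toDeg : Sym 𝒰 →ₐ[K] ⨁ i, deg 𝒰 i :=
  lift 𝒰 (A := ⨁ i, deg 𝒰 i) (gradedι 𝒰) (by
    intro i j a b ha hb
    rw [gradedι_apply 𝒰 ha, gradedι_apply 𝒰 hb, DirectSum.of_mul_of, DirectSum.of_mul_of,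
      Units.smul_def, ← map_zsmul (DirectSum.of (fun i => deg 𝒰 i) (j + i))]
    refine DirectSum.of_eq_of_gradedMonoid_eq (Sigma.subtype_ext (add_comm _ _) ?_)
    exact ι_comm 𝒰 ha hb)

theorem linearMap_ext_homogeneous {M : Type*} [AddCommGroup M] [Module K M] {f g : U →ₗ[K] M}
    (h : ∀ i, ∀ a ∈ 𝒰 i, f a = g a) : f = g := by
  ext a
  induction a using DirectSum.Decomposition.inductionOn 𝒰 with
  | zero => simp
  | homogeneous a => exact h _ _ a.2
  | add a b ha hb => rw [map_add, map_add, ha, hb]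

instance deg.gradedAlgebra : GradedAlgebra (deg 𝒰) :=
  GradedAlgebra.ofAlgHom (deg 𝒰) (toDeg 𝒰)
    (by
      apply algHom_ext
      intro a
      have h : ((DirectSum.coeAlgHom (deg 𝒰)).comp (toDeg 𝒰)).toLinearMap ∘ₗ ι 𝒰 = ι 𝒰 := by
        apply linearMap_ext_homogeneous 𝒰
        intro i a ha
        simp only [LinearMap.comp_apply, AlgHom.toLinearMap_apply, AlgHom.comp_apply, toDeg, lift_ι]
        rw [gradedι_apply 𝒰 ha, DirectSum.coeAlgHom_of]
      exact LinearMap.congr_fun h a)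
    (by
      rintro d ⟨x, hx⟩
      dsimp only
      induction hx using Submodule.span_induction with
      | mem x hx =>
        obtain ⟨l, hl, rfl⟩ := hx
        induction l generalizing d with
        | nil =>
          subst hl
          simp only [List.map_nil, List.prod_nil, map_one]
          rfl
        | cons v l ih =>
          subst hl
          simp only [List.map_cons, List.prod_cons, map_mul]
          rw [ih _ rfl, toDeg, lift_ι, gradedι_apply 𝒰 v.2.2, DirectSum.of_mul_of]
          refine DirectSum.of_eq_of_gradedMonoid_eq (Sigma.subtype_ext ?_ rfl)
          exact List.sum_cons.symm
      | zero => rw [map_zero]; exact (map_zero _).symm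
      | add x y hx hy ihx ihy => rw [map_add, ihx, ihy, ← map_add]; rfl
      | smul r x hx ih =>
        rw [map_smul, ih, ← DirectSum.lof_eq_of K, ← map_smul]; rfl)

/-! ### The coalgebra structure -/

theorem right_mul_left {i j : ℤ} {a b : U} (ha : a ∈ 𝒰 i) (hb : b ∈ 𝒰 j) :
    GradedTensorProduct.includeRight (deg 𝒰) (deg 𝒰) (ι 𝒰 a) *
        GradedTensorProduct.includeLeft (deg 𝒰) (deg 𝒰) (ι 𝒰 b) =
      (-1 : ℤˣ) ^ (i * j) •
        (GradedTensorProduct.includeLeft (deg 𝒰) (deg 𝒰) (ι 𝒰 b) *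
          GradedTensorProduct.includeRight (deg 𝒰) (deg 𝒰) (ι 𝒰 a)) := by
  have h := GradedTensorProduct.tmul_coe_mul_coe_tmul (R := K) (deg 𝒰) (deg 𝒰) 1
    (⟨ι 𝒰 a, ι_mem_deg 𝒰 ha⟩ : deg 𝒰 i) (⟨ι 𝒰 b, ι_mem_deg 𝒰 hb⟩ : deg 𝒰 j) 1
  have h' := GradedTensorProduct.tmul_one_mul_one_tmul (R := K) (deg 𝒰) (deg 𝒰) (ι 𝒰 b) (ι 𝒰 a)
  simp only [one_mul, mul_one] at h
  simp only [GradedTensorProduct.includeRight_apply, GradedTensorProduct.includeLeft_apply]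
  rw [h, h']

/-- The coproduct of the graded symmetric coalgebra, as a morphism of algebras into the graded
tensor product, whose product is `(x ⊗ y) (x' ⊗ y') = (-1)^(|y| |x'|) xx' ⊗ yy'`: the one with
`Δ a = a ⊗ 1 + 1 ⊗ a` for `a : U`. Therefore
`Δ (v₁ ⊙ ⋯ ⊙ vₙ) = ∑_{k = 0}^n ∑_{σ ∈ S(k, n - k)}
  ε(σ) (v_{σ(1)} ⊙ ⋯ ⊙ v_{σ(k)}) ⊗ (v_{σ(k+1)} ⊙ ⋯ ⊙ v_{σ(n)})`. -/
def comulAlgHom : Sym 𝒰 →ₐ[K] (deg 𝒰) ᵍ⊗[K] (deg 𝒰) :=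
  lift 𝒰 ((GradedTensorProduct.includeLeft (deg 𝒰) (deg 𝒰)).toLinearMap ∘ₗ ι 𝒰 +
      (GradedTensorProduct.includeRight (deg 𝒰) (deg 𝒰)).toLinearMap ∘ₗ ι 𝒰) (by
    intro i j a b ha hb
    simp only [LinearMap.add_apply, LinearMap.comp_apply, AlgHom.toLinearMap_apply, mul_add,
      add_mul, smul_add]
    have hL := congrArg (GradedTensorProduct.includeLeft (deg 𝒰) (deg 𝒰)) (ι_comm 𝒰 ha hb)
    have hR := congrArg (GradedTensorProduct.includeRight (deg 𝒰) (deg 𝒰)) (ι_comm 𝒰 ha hb)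
    rw [Units.smul_def, map_zsmul, map_mul, map_mul, ← Units.smul_def] at hL hR
    rw [hL, hR, right_mul_left 𝒰 ha hb, right_mul_left 𝒰 hb ha, mul_comm j i, smul_smul,
      Int.units_mul_self, one_smul]
    abel)

/-- The coproduct `Δ` of the graded symmetric coalgebra `⨁_{n ≥ 0} ⨀ⁿ U`. -/
def comul : Sym 𝒰 →ₗ[K] Sym 𝒰 ⊗[K] Sym 𝒰 :=
  (GradedTensorProduct.of K (deg 𝒰) (deg 𝒰)).symm.toLinearMap ∘ₗ (comulAlgHom 𝒰).toLinearMap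

/-- The coproduct of the reduced graded symmetric coalgebra `⨁_{n ≥ 1} ⨀ⁿ U`:
`v₁ ⊙ ⋯ ⊙ vₙ ↦ ∑_{k = 1}^{n - 1} ∑_{σ ∈ S(k, n - k)}
  ε(σ) (v_{σ(1)} ⊙ ⋯ ⊙ v_{σ(k)}) ⊗ (v_{σ(k+1)} ⊙ ⋯ ⊙ v_{σ(n)})`. -/
def comulRed : Red 𝒰 →ₗ[K] Red 𝒰 ⊗[K] Red 𝒰 :=
  TensorProduct.map (toRed 𝒰) (toRed 𝒰) ∘ₗ comul 𝒰 ∘ₗ (Red 𝒰).subtype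

/-- For `q = ∑_k q_k : ⨁_{k ≥ 1} ⨀ᵏ U → U`, the map `Q` with
`Q (v₁ ⊙ ⋯ ⊙ vₙ) = ∑_{k = 1}^n ∑_{σ ∈ S(k, n - k)}
  ε(σ) q_k (v_{σ(1)} ⊙ ⋯ ⊙ v_{σ(k)}) ⊙ v_{σ(k+1)} ⊙ ⋯ ⊙ v_{σ(n)}`. -/
def coder (q : Red 𝒰 →ₗ[K] U) : Red 𝒰 →ₗ[K] Red 𝒰 :=
  (LinearMap.mul' K (Sym 𝒰) ∘ₗ TensorProduct.map (ι 𝒰 ∘ₗ q ∘ₗ toRed 𝒰) LinearMap.id ∘ₗ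
    comul 𝒰 ∘ₗ (Red 𝒰).subtype).codRestrict _ (by
    intro x
    have h : (counit 𝒰).toLinearMap ∘ₗ LinearMap.mul' K (Sym 𝒰) ∘ₗ
        TensorProduct.map (ι 𝒰 ∘ₗ q ∘ₗ toRed 𝒰) LinearMap.id = 0 := by
      ext a b
      simp
    exact LinearMap.congr_fun h _)

theorem coe_coder (q : Red 𝒰 →ₗ[K] U) (x : Red 𝒰) :
    (coder 𝒰 q x : Sym 𝒰) = LinearMap.mul' K (Sym 𝒰)
      (TensorProduct.map (ι 𝒰 ∘ₗ q ∘ₗ toRed 𝒰) LinearMap.id (comul 𝒰 x)) := rfl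

theorem comul_ι (a : U) : comul 𝒰 (ι 𝒰 a) = ι 𝒰 a ⊗ₜ 1 + 1 ⊗ₜ ι 𝒰 a := by
  simp [comul, comulAlgHom]

theorem coder_ι (q : Red 𝒰 →ₗ[K] U) (a : U) : coder 𝒰 q (ιRed 𝒰 a) = ιRed 𝒰 (q (ιRed 𝒰 a)) := by
  ext
  have h : toRed 𝒰 (ι 𝒰 a) = ιRed 𝒰 a := toRed_coe 𝒰 (ιRed 𝒰 a)
  simp [coe_coder, comul_ι, h]

/-! ### Primitive elements of the reduced symmetric coalgebra -/

theorem induction_left {P : Sym 𝒰 → Prop} (h1 : P 1) (h0 : P 0)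
    (hm : ∀ i, ∀ a ∈ 𝒰 i, ∀ x, P x → P (ι 𝒰 a * x)) (ha : ∀ x y, P x → P y → P (x + y))
    (hs : ∀ (r : K) x, P x → P (r • x)) (x : Sym 𝒰) : P x := by
  induction x using DirectSum.Decomposition.inductionOn (deg 𝒰) with
  | zero => exact h0
  | add x y hx hy => exact ha _ _ hx hy
  | homogeneous x =>
    obtain ⟨x, hx⟩ := x
    dsimp only
    induction hx using Submodule.span_induction with
    | mem x hx =>
      obtain ⟨l, -, rfl⟩ := hx
      induction l with
      | nil => exact h1
      | cons v l ih =>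
        rw [List.map_cons, List.prod_cons]
        exact hm _ _ v.2.2 _ ih
    | zero => exact h0
    | add x y _ _ hx hy => exact ha _ _ hx hy
    | smul r x _ hx => exact hs _ _ hx

theorem comul_one : comul 𝒰 1 = 1 ⊗ₜ 1 := by
  simp only [comul, LinearMap.comp_apply, AlgHom.toLinearMap_apply, map_one]
  rfl

theorem comul_ι_mul {M : Type*} [AddCommGroup M] [Module K M] (G H : Sym 𝒰 ⊗[K] Sym 𝒰 →ₗ[K] M)
    {i : ℤ} {u : U} (hu : u ∈ 𝒰 i)
    (h : ∀ j, ∀ a ∈ deg 𝒰 j, ∀ b,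
      G ((ι 𝒰 u * a) ⊗ₜ b) + (-1 : ℤˣ) ^ (i * j) • G (a ⊗ₜ (ι 𝒰 u * b)) = H (a ⊗ₜ b))
    (x : Sym 𝒰) : G (comul 𝒰 (ι 𝒰 u * x)) = H (comul 𝒰 x) := by
  have key : ∀ z : Sym 𝒰 ⊗[K] Sym 𝒰,
      G ((GradedTensorProduct.of K (deg 𝒰) (deg 𝒰)).symm
        (comulAlgHom 𝒰 (ι 𝒰 u) * GradedTensorProduct.of K (deg 𝒰) (deg 𝒰) z)) = H z := by
    intro z
    induction z using TensorProduct.induction_on with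
    | zero => simp
    | add y z hy hz => rw [map_add, mul_add, map_add, map_add, hy, hz, map_add]
    | tmul a b =>
      induction a using DirectSum.Decomposition.inductionOn (deg 𝒰) with
      | zero => simp
      | add y z hy hz =>
        rw [TensorProduct.add_tmul, map_add, mul_add, map_add, map_add, hy, hz, map_add]
      | @homogeneous j a =>
        rw [← h j a a.2 b]
        simp only [comulAlgHom, lift_ι, LinearMap.add_apply, LinearMap.comp_apply,
          AlgHom.toLinearMap_apply, GradedTensorProduct.includeRight_apply,
          GradedTensorProduct.includeLeft_apply, add_mul]
        have h1 := GradedTensorProduct.tmul_one_mul_coe_tmul (R := K) (deg 𝒰) (deg 𝒰) (ι 𝒰 u) a b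
        have h2 := GradedTensorProduct.tmul_coe_mul_coe_tmul (R := K) (deg 𝒰) (deg 𝒰) 1
          (⟨ι 𝒰 u, ι_mem_deg 𝒰 hu⟩ : deg 𝒰 i) a b
        simp only [one_mul] at h2
        rw [h1, h2, Units.smul_def, map_add, map_add, map_zsmul, map_zsmul, Units.smul_def]
        rfl
  have := key (comul 𝒰 x)
  rw [← this]
  simp [comul]

/-- The first counit identity. -/
theorem counit_comul (x : Sym 𝒰) :
    LinearMap.mul' K (Sym 𝒰) (TensorProduct.map
      (Algebra.linearMap K (Sym 𝒰) ∘ₗ (counit 𝒰).toLinearMap) LinearMap.id (comul 𝒰 x)) = x := by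
  induction x using induction_left 𝒰 with
  | h1 => simp [comul_one]
  | h0 => simp
  | ha x y hx hy => rw [map_add, map_add, map_add, hx, hy]
  | hs r x hx => rw [map_smul, map_smul, map_smul, hx]
  | hm i u hu x hx =>
    have := comul_ι_mul 𝒰 (LinearMap.mul' K (Sym 𝒰) ∘ₗ TensorProduct.map
      (Algebra.linearMap K (Sym 𝒰) ∘ₗ (counit 𝒰).toLinearMap) LinearMap.id)
      (LinearMap.mulLeft K (ι 𝒰 u) ∘ₗ LinearMap.mul' K (Sym 𝒰) ∘ₗ TensorProduct.map
      (Algebra.linearMap K (Sym 𝒰) ∘ₗ (counit 𝒰).toLinearMap) LinearMap.id) hu (by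
      intro j a ha b
      by_cases hj : j = 0
      · subst hj
        simp [← Algebra.smul_def]
      · simp [counit_eq_zero 𝒰 hj ha]) x
    simp only [LinearMap.comp_apply, LinearMap.mulLeft_apply] at this
    rw [this, hx]

/-- The second counit identity. -/
theorem comul_counit (x : Sym 𝒰) :
    LinearMap.mul' K (Sym 𝒰) (TensorProduct.map LinearMap.id
      (Algebra.linearMap K (Sym 𝒰) ∘ₗ (counit 𝒰).toLinearMap) (comul 𝒰 x)) = x := by
  induction x using induction_left 𝒰 with
  | h1 => simp [comul_one]
  | h0 => simp
  | ha x y hx hy => rw [map_add, map_add, map_add, hx, hy]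
  | hs r x hx => rw [map_smul, map_smul, map_smul, hx]
  | hm i u hu x hx =>
    have := comul_ι_mul 𝒰 (LinearMap.mul' K (Sym 𝒰) ∘ₗ TensorProduct.map LinearMap.id
      (Algebra.linearMap K (Sym 𝒰) ∘ₗ (counit 𝒰).toLinearMap))
      (LinearMap.mulLeft K (ι 𝒰 u) ∘ₗ LinearMap.mul' K (Sym 𝒰) ∘ₗ TensorProduct.map LinearMap.id
      (Algebra.linearMap K (Sym 𝒰) ∘ₗ (counit 𝒰).toLinearMap)) hu (by
      intro j a ha b
      simp [mul_assoc]) x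
    simp only [LinearMap.comp_apply, LinearMap.mulLeft_apply] at this
    rw [this, hx]

/-- The operator that multiplies `⨀ⁿ U` by `n`. -/
def euler : Module.End K (Sym 𝒰) :=
  LinearMap.mul' K (Sym 𝒰) ∘ₗ TensorProduct.map (ι 𝒰 ∘ₗ proj 𝒰) LinearMap.id ∘ₗ comul 𝒰

theorem euler_ι (a : U) : euler 𝒰 (ι 𝒰 a) = ι 𝒰 a := by
  simp [euler, comul_ι, proj_one]

theorem euler_one : euler 𝒰 1 = 0 := by
  simp [euler, comul_one, proj_one]

theorem euler_ι_mul {i : ℤ} {u : U} (hu : u ∈ 𝒰 i) (x : Sym 𝒰) :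
    euler 𝒰 (ι 𝒰 u * x) = ι 𝒰 u * x + ι 𝒰 u * euler 𝒰 x := by
  have := comul_ι_mul 𝒰
    (LinearMap.mul' K (Sym 𝒰) ∘ₗ TensorProduct.map (ι 𝒰 ∘ₗ proj 𝒰) LinearMap.id)
    (LinearMap.mulLeft K (ι 𝒰 u) ∘ₗ (LinearMap.mul' K (Sym 𝒰) ∘ₗ TensorProduct.map
      (Algebra.linearMap K (Sym 𝒰) ∘ₗ (counit 𝒰).toLinearMap) LinearMap.id +
      LinearMap.mul' K (Sym 𝒰) ∘ₗ TensorProduct.map (ι 𝒰 ∘ₗ proj 𝒰) LinearMap.id)) hu (by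
    intro j a ha b
    simp only [LinearMap.comp_apply, LinearMap.add_apply, TensorProduct.map_tmul,
      LinearMap.mul'_apply, LinearMap.id_apply, proj_mul, counit_ι, proj_ι, zero_smul, zero_add,
      LinearMap.mulLeft_apply, AlgHom.toLinearMap_apply, Algebra.linearMap_apply, mul_add,
      map_smul]
    rw [← mul_assoc, ← mul_assoc, ← mul_assoc, ι_comm 𝒰 hu (proj_mem 𝒰 ha),
      ← Algebra.commutes, Algebra.smul_def, smul_mul_assoc]) x
  simp only [LinearMap.comp_apply, LinearMap.mulLeft_apply, LinearMap.add_apply,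
    counit_comul] at this
  rw [euler, LinearMap.comp_apply, LinearMap.comp_apply, this, mul_add]
  rfl

theorem euler_prod (l : List (Σ i, 𝒰 i)) :
    euler 𝒰 (l.map fun v => ι 𝒰 (v.2 : U)).prod =
      (l.length : K) • (l.map fun v => ι 𝒰 (v.2 : U)).prod := by
  induction l with
  | nil => simp [euler_one]
  | cons v l ih =>
    rw [List.map_cons, List.prod_cons, euler_ι_mul 𝒰 v.2.2, ih]
    simp [add_smul, add_comm]

theorem red_mem [CharZero K] (x : Red 𝒰) :
    (x : Sym 𝒰) ∈ ⨆ (c : K) (_ : c ≠ 0), (euler 𝒰).eigenspace c := by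
  rw [← toRed_coe 𝒰 x]
  generalize (x : Sym 𝒰) = y
  induction y using DirectSum.Decomposition.inductionOn (deg 𝒰) with
  | zero => simp
  | add x y hx hy => rw [map_add]; exact add_mem hx hy
  | homogeneous y =>
    obtain ⟨y, hy⟩ := y
    dsimp only
    induction hy using Submodule.span_induction with
    | mem x hx =>
      obtain ⟨l, -, rfl⟩ := hx
      cases l with
      | nil => simp
      | cons v l =>
        have h : counit 𝒰 ((v :: l).map fun v => ι 𝒰 (v.2 : U)).prod = 0 := by simp
        rw [coe_toRed, h, map_zero, sub_zero]
        refine Submodule.mem_iSup_of_mem (((v :: l).length : ℕ) : K)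
          (Submodule.mem_iSup_of_mem (by simp [Nat.cast_add_one_ne_zero]) ?_)
        rw [Module.End.mem_eigenspace_iff]
        exact euler_prod 𝒰 (v :: l)
    | zero => simp
    | add x y _ _ hx hy => rw [map_add]; exact add_mem hx hy
    | smul r x _ hx => rw [map_smul]; exact Submodule.smul_mem _ _ hx

/-- The primitive elements of the reduced symmetric coalgebra are the elements of `⨀¹ U`. -/
theorem eq_ιRed_of_comulRed_eq_zero [CharZero K] (x : Red 𝒰) (hx : comulRed 𝒰 x = 0) :
    x = ιRed 𝒰 (projRed 𝒰 x) := by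
  have hE : euler 𝒰 (x : Sym 𝒰) = ι 𝒰 (proj 𝒰 x) := by
    have h1 : LinearMap.mul' K (Sym 𝒰) ∘ₗ TensorProduct.map (ι 𝒰 ∘ₗ proj 𝒰) LinearMap.id =
        LinearMap.mul' K (Sym 𝒰) ∘ₗ TensorProduct.map (ι 𝒰 ∘ₗ projRed 𝒰) (Red 𝒰).subtype ∘ₗ
          TensorProduct.map (toRed 𝒰) (toRed 𝒰) +
        (ι 𝒰 ∘ₗ proj 𝒰) ∘ₗ LinearMap.mul' K (Sym 𝒰) ∘ₗ TensorProduct.map LinearMap.id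
          (Algebra.linearMap K (Sym 𝒰) ∘ₗ (counit 𝒰).toLinearMap) := by
      ext a b
      simp [projRed, coe_toRed, proj_algebraMap, proj_mul, mul_sub, ← Algebra.commutes,
        Algebra.smul_def]
    have h2 := LinearMap.congr_fun h1 (comul 𝒰 (x : Sym 𝒰))
    have h3 : TensorProduct.map (toRed 𝒰) (toRed 𝒰) (comul 𝒰 (x : Sym 𝒰)) = 0 := hx
    simp only [LinearMap.comp_apply, LinearMap.add_apply, h3, map_zero, zero_add,
      comul_counit] at h2
    exact h2
  have h0 : ((x - ιRed 𝒰 (projRed 𝒰 x) : Red 𝒰) : Sym 𝒰) ∈ (euler 𝒰).eigenspace 0 := by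
    rw [Module.End.mem_eigenspace_iff, zero_smul]
    simp [hE, euler_ι, projRed]
  have h := (Module.End.eigenspaces_iSupIndep (euler 𝒰) 0).le_bot
    ⟨h0, red_mem 𝒰 (x - ιRed 𝒰 (projRed 𝒰 x))⟩
  rw [Submodule.mem_bot, ZeroMemClass.coe_eq_zero, sub_eq_zero] at h
  exact h

theorem comulRed_ιRed (a : U) : comulRed 𝒰 (ιRed 𝒰 a) = 0 := by
  simp [comulRed, comul_ι]

end Sym
end GradedSymmetric

/-! ### Cohomology of a complex -/

section Cohomology

variable {K : Type w} [Field K] {U U' : Type u} [AddCommGroup U] [Module K U]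
  [AddCommGroup U'] [Module K U']

/-- The cohomology `ker d / im d`, i.e. the direct sum of the cohomology spaces in all degrees
when `d` is the differential of a differential graded vector space. -/
abbrev Cohomology (d : U →ₗ[K] U) : Type u :=
  LinearMap.ker d ⧸ (LinearMap.range d).submoduleOf (LinearMap.ker d)

/-- The map induced in cohomology by a morphism of complexes. -/
def Cohomology.map (d : U →ₗ[K] U) (d' : U' →ₗ[K] U') (f : U →ₗ[K] U')
    (h : f ∘ₗ d = d' ∘ₗ f) : Cohomology d →ₗ[K] Cohomology d' :=
  Submodule.mapQ _ _
    (f.restrict (p := LinearMap.ker d) (q := LinearMap.ker d') (fun x hx => by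
      have h' : f (d x) = d' (f x) := LinearMap.congr_fun h x
      rw [LinearMap.mem_ker.1 hx, map_zero] at h'
      exact h'.symm))
    (by
      rintro ⟨x, hx⟩ ⟨y, hy⟩
      exact ⟨f y, (LinearMap.congr_fun h y).symm.trans (congrArg f hy)⟩)

end Cohomology

/-! ### L∞-algebras -/

section LInfinity

/-- The shift `V[n]` of a graded vector space `V`, with `V[n]^i = V^(n + i)`. -/
def shift {K : Type w} [Field K] {V : Type u} [AddCommGroup V] [Module K V]
    (𝒱 : ℤ → Submodule K V) (n : ℤ) : ℤ → Submodule K V := fun i => 𝒱 (n + i)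

instance shift.decomposition {K : Type w} [Field K] {V : Type u} [AddCommGroup V] [Module K V]
    (𝒱 : ℤ → Submodule K V) [DirectSum.Decomposition 𝒱] (n : ℤ) :
    DirectSum.Decomposition (shift 𝒱 n) :=
  DirectSum.IsInternal.chooseDecomposition _ (by
    have h := DirectSum.Decomposition.isInternal 𝒱
    rw [DirectSum.isInternal_submodule_iff_iSupIndep_and_iSup_eq_top] at h ⊢
    exact ⟨h.1.comp (add_right_injective n), ((Equiv.addLeft n).iSup_comp (g := 𝒱)).trans h.2⟩)

/-- An `L∞`-algebra `(V, q₁, q₂, …)` over `K`: a graded vector space `V = ⨁ V^i` and linear maps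
`q_k : ⨀ᵏ V[1] → V[1]` of degree one, `k ≥ 1`, such that the induced map `Q` satisfies `Q Q = 0`.
The sequence of the `q_k` is given as the linear map `q` on `⨁_{k ≥ 1} ⨀ᵏ V[1]` whose restriction
to `⨀ᵏ V[1]` is `q_k`. -/
structure LInftyAlgebra (K : Type w) [Field K] : Type (max w (u + 1)) where
  /-- The underlying vector space `V`. -/
  carrier : Type u
  [addCommGroup : AddCommGroup carrier]
  [module : Module K carrier]
  /-- The homogeneous parts `V^i`. -/
  grading : ℤ → Submodule K carrier
  [decomposition : DirectSum.Decomposition grading]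
  /-- The map `∑_k q_k`. -/
  q : Sym.Red (shift grading 1) →ₗ[K] carrier
  q_mem : ∀ (d : ℤ) (x : Sym.Red (shift grading 1)),
    (x : Sym (shift grading 1)) ∈ Sym.deg (shift grading 1) d → q x ∈ shift grading 1 (d + 1)
  Q_comp_Q : Sym.coder (shift grading 1) q ∘ₗ Sym.coder (shift grading 1) q = 0

attribute [instance] LInftyAlgebra.addCommGroup LInftyAlgebra.module LInftyAlgebra.decomposition

variable {K : Type w} [Field K]

namespace LInftyAlgebra

variable (V : LInftyAlgebra.{w, u} K)

/-- The grading of `V[1]`. -/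
abbrev grading₁ : ℤ → Submodule K V.carrier := shift V.grading 1

/-- The reduced symmetric graded coalgebra `⨁_{n ≥ 1} ⨀ⁿ V[1]`. -/
abbrev Coalg : Type (max w u) := Sym.Red V.grading₁

/-- The codifferential `Q`. -/
def Q : V.Coalg →ₗ[K] V.Coalg := Sym.coder V.grading₁ V.q

/-- The differential `q₁` of `V[1]`. -/
def q₁ : V.carrier →ₗ[K] V.carrier := V.q ∘ₗ Sym.ιRed V.grading₁

/-- `V` is abelian if `q_i = 0` for every `i ≥ 2`. -/
def IsAbelian : Prop :=
  ∀ i : ℕ, 2 ≤ i → ∀ x : V.Coalg, (x : Sym V.grading₁) ∈ Sym.power V.grading₁ i → V.q x = 0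

end LInftyAlgebra

/-- An `L∞`-morphism, given by the morphism `F` of reduced symmetric graded coalgebras; the maps
`f_n : ⨀ⁿ V[1] → W[1]` that it lifts are the restrictions of `LInftyHom.f` below. -/
structure LInftyHom (V W : LInftyAlgebra.{w, u} K) where
  /-- The morphism of graded coalgebras. -/
  F : V.Coalg →ₗ[K] W.Coalg
  F_mem : ∀ (d : ℤ) (x : V.Coalg), (x : Sym V.grading₁) ∈ Sym.deg V.grading₁ d →
    (F x : Sym W.grading₁) ∈ Sym.deg W.grading₁ d
  F_comul : Sym.comulRed W.grading₁ ∘ₗ F = TensorProduct.map F F ∘ₗ Sym.comulRed V.grading₁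
  F_comp_Q : F ∘ₗ V.Q = W.Q ∘ₗ F

namespace LInftyHom

variable {V W : LInftyAlgebra.{w, u} K} (φ : LInftyHom V W)

/-- The map `∑_n f_n : ⨁_{n ≥ 1} ⨀ⁿ V[1] → W[1]`. -/
def f : V.Coalg →ₗ[K] W.carrier := Sym.projRed W.grading₁ ∘ₗ φ.F

/-- The linear part `f₁ : V[1] → W[1]`. -/
def f₁ : V.carrier →ₗ[K] W.carrier := φ.f ∘ₗ Sym.ιRed V.grading₁

variable [CharZero K]

theorem F_ιRed (v : V.carrier) :
    φ.F (Sym.ιRed V.grading₁ v) = Sym.ιRed W.grading₁ (φ.f₁ v) := by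
  apply Sym.eq_ιRed_of_comulRed_eq_zero
  have h := LinearMap.congr_fun φ.F_comul (Sym.ιRed V.grading₁ v)
  simpa [Sym.comulRed_ιRed] using h

/-- The linear part is a morphism of complexes. -/
theorem f₁_comp_q₁ : φ.f₁ ∘ₗ V.q₁ = W.q₁ ∘ₗ φ.f₁ := by
  ext v
  have h := LinearMap.congr_fun φ.F_comp_Q (Sym.ιRed V.grading₁ v)
  simp only [LinearMap.comp_apply, LInftyAlgebra.Q, Sym.coder_ι, F_ιRed] at h
  have h' := congrArg (Sym.projRed W.grading₁) h
  rw [Sym.projRed_ιRed, Sym.projRed_ιRed] at h'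
  exact h'

/-- The map `H(V[1], q₁) → H(W[1], q₁)` induced by the linear part. -/
def cohomologyMap : Cohomology V.q₁ →ₗ[K] Cohomology W.q₁ :=
  Cohomology.map V.q₁ W.q₁ φ.f₁ φ.f₁_comp_q₁

/-- The `L∞`-morphism is a quasi-isomorphism. -/
def IsQuasiIso : Prop := Function.Bijective φ.cohomologyMap

end LInftyHom

variable [CharZero K]

/-- `L∞`-algebras are quasi-isomorphic if they are equivalent under the equivalence relation
generated by the existence of a quasi-isomorphism from the first to the second. -/
def QuasiIsomorphic : LInftyAlgebra.{w, u} K → LInftyAlgebra.{w, u} K → Prop :=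
  Relation.EqvGen fun V W => ∃ φ : LInftyHom V W, φ.IsQuasiIso

/-- An `L∞`-algebra is quasi-abelian if it is quasi-isomorphic to an abelian one. -/
def LInftyAlgebra.IsQuasiAbelian (V : LInftyAlgebra.{w, u} K) : Prop :=
  ∃ A : LInftyAlgebra.{w, u} K, A.IsAbelian ∧ QuasiIsomorphic V A

end LInfinity

end LInf

end

/-!
The proof rests on a criterion. Let `S` be the symmetric coalgebra on `V[1]` with its codifferential
`Q`. The inclusion `(V[1], q₁) → (S, Q)` is a morphism of complexes, and `V` is quasi-abelian if and
only if this inclusion is injective in cohomology (`LInftyAlgebra.InclusionInjective`).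
The theorem follows at once: an `L∞`-morphism whose linear part is injective in cohomology
pulls the criterion back from its target to its source (`InclusionInjective.of_injective`), because
it maps `ι v` to `ι (f₁ v)`. Three facts establish the criterion.

* An abelian `L∞`-algebra satisfies it: the projection `S → V[1]` is then a morphism of complexes
  (`IsAbelian.inclusionInjective`).

* It is invariant under quasi-isomorphisms (`QuasiIsomorphic.inclusionInjective_iff`). To go from
  the source to the target of a quasi-isomorphism one needs that the morphism of symmetric
  coalgebras is injective in cohomology (`Sym.IsCoalgHom.mem_range_coderiv`). By induction on the
  length filtration, this reduces to the associated graded pieces, where the codifferential is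
  the derivation extending `q₁` and the morphism is the algebra morphism extending `f₁`. There, a
  homotopy inverse of `f₁`, which exists over a field, induces an inverse in cohomology on every
  symmetric power: in characteristic zero, a projector homotopic to the identity acts as the
  identity on the cohomology of the symmetric algebra (`Sym.exists_der_eq_of_map_eq_der`).

* If it holds, there is a map of complexes `g : (S, Q) → (V[1], q₁)` with `q₁ ∘ g = 0` and
  `g ∘ Q = 0` that induces a left inverse of the inclusion in cohomology (`exists_retraction`). Its
  exponential in the convolution algebra is the morphism of coalgebras with Taylor coefficients `g`
  (`Sym.isCoalgHom_exp`), and it is an `L∞`-quasi-isomorphism from `V` to the complex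
  `(V[1], q₁)`, viewed as an abelian `L∞`-algebra (`InclusionInjective.exists_isQuasiIso`).
-/

noncomputable section

namespace LInf

/-! ### Signs and homogeneous maps -/

section Graded

variable {K : Type w} [Field K]

variable (K) in
/-- The Koszul sign `(-1)^(ij)`, as an element of the field. -/
def koszul (i j : ℤ) : K := (((-1 : ℤˣ) ^ (i * j) : ℤˣ) : ℤ)

theorem units_smul_eq_koszul {M : Type*} [AddCommGroup M] [Module K M] (i j : ℤ) (x : M) :
    (-1 : ℤˣ) ^ (i * j) • x = koszul K i j • x := by
  rw [Units.smul_def, koszul, Int.cast_smul_eq_zsmul]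

theorem koszul_comm (i j : ℤ) : koszul K i j = koszul K j i := by
  rw [koszul, mul_comm, koszul]

theorem koszul_add_right (i j k : ℤ) : koszul K i (j + k) = koszul K i j * koszul K i k := by
  simp only [koszul, mul_add, zpow_add, Units.val_mul, Int.cast_mul]

theorem koszul_add_left (i j k : ℤ) : koszul K (i + j) k = koszul K i k * koszul K j k := by
  simp only [koszul, add_mul, zpow_add, Units.val_mul, Int.cast_mul]

@[simp]
theorem koszul_zero_left (i : ℤ) : koszul K 0 i = 1 := by simp [koszul]

@[simp]
theorem koszul_zero_right (i : ℤ) : koszul K i 0 = 1 := by simp [koszul]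

@[simp]
theorem koszul_mul_self (i j : ℤ) : koszul K i j * koszul K i j = 1 := by
  rw [koszul, ← Int.cast_mul, ← Units.val_mul, Int.units_mul_self]
  simp

theorem koszul_one_one : koszul K 1 1 = -1 := by simp [koszul]

theorem koszul_neg_left (i j : ℤ) : koszul K (-i) j = koszul K i j := by
  simp only [koszul, neg_mul, zpow_neg, Int.units_inv_eq_self]

variable {M N : Type*} [AddCommGroup M] [Module K M] [AddCommGroup N] [Module K N]

/-- The map `f` sends elements of degree `d` to elements of degree `d + e`. -/
def HasDegree (𝓜 : ℤ → Submodule K M) (𝓝 : ℤ → Submodule K N) (e : ℤ) (f : M →ₗ[K] N) : Prop :=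
  ∀ d, ∀ a ∈ 𝓜 d, f a ∈ 𝓝 (d + e)

theorem HasDegree.comp {L : Type*} [AddCommGroup L] [Module K L] {𝓜 : ℤ → Submodule K M}
    {𝓝 : ℤ → Submodule K N} {𝓛 : ℤ → Submodule K L} {e e' e'' : ℤ} {f : N →ₗ[K] L}
    {g : M →ₗ[K] N} (hf : HasDegree 𝓝 𝓛 e f) (hg : HasDegree 𝓜 𝓝 e' g) (h : e' + e = e'') :
    HasDegree 𝓜 𝓛 e'' (f ∘ₗ g) := by
  intro d a ha
  rw [← h, ← add_assoc]
  exact hf _ _ (hg _ _ ha)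

theorem HasDegree.add {𝓜 : ℤ → Submodule K M} {𝓝 : ℤ → Submodule K N} {e : ℤ}
    {f g : M →ₗ[K] N} (hf : HasDegree 𝓜 𝓝 e f) (hg : HasDegree 𝓜 𝓝 e g) :
    HasDegree 𝓜 𝓝 e (f + g) :=
  fun d a ha => add_mem (hf d a ha) (hg d a ha)

theorem HasDegree.sub {𝓜 : ℤ → Submodule K M} {𝓝 : ℤ → Submodule K N} {e : ℤ}
    {f g : M →ₗ[K] N} (hf : HasDegree 𝓜 𝓝 e f) (hg : HasDegree 𝓜 𝓝 e g) :
    HasDegree 𝓜 𝓝 e (f - g) :=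
  fun d a ha => sub_mem (hf d a ha) (hg d a ha)

theorem HasDegree.zero {𝓜 : ℤ → Submodule K M} {𝓝 : ℤ → Submodule K N} {e : ℤ} :
    HasDegree 𝓜 𝓝 e 0 :=
  fun _ _ _ => Submodule.zero_mem _

theorem HasDegree.id {𝓜 : ℤ → Submodule K M} : HasDegree 𝓜 𝓜 0 LinearMap.id := by
  intro d a ha
  rwa [add_zero]

theorem HasDegree.mem {𝓜 : ℤ → Submodule K M} {𝓝 : ℤ → Submodule K N} {f : M →ₗ[K] N}
    (hf : HasDegree 𝓜 𝓝 0 f) {d : ℤ} {a : M} (ha : a ∈ 𝓜 d) : f a ∈ 𝓝 d := by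
  simpa using hf d a ha

variable (𝓜 : ℤ → Submodule K M) [DirectSum.Decomposition 𝓜]

/-- The linear map that agrees with `φ d` on the elements of degree `d`. -/
def glue (φ : ℤ → M →ₗ[K] N) : M →ₗ[K] N :=
  DirectSum.toModule K ℤ N (fun d => φ d ∘ₗ (𝓜 d).subtype) ∘ₗ
    (DirectSum.decomposeLinearEquiv 𝓜).toLinearMap

theorem glue_apply (φ : ℤ → M →ₗ[K] N) {d : ℤ} {a : M} (ha : a ∈ 𝓜 d) :
    glue 𝓜 φ a = φ d a := by
  simp only [glue, LinearMap.comp_apply, LinearEquiv.coe_coe,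
    DirectSum.decomposeLinearEquiv_apply]
  rw [DirectSum.decompose_of_mem 𝓜 ha, ← DirectSum.lof_eq_of K, DirectSum.toModule_lof]
  rfl

/-- The projection onto the part of degree `d`. -/
def component (d : ℤ) : M →ₗ[K] M :=
  glue 𝓜 (fun j => if j = d then LinearMap.id else 0)

theorem component_mem (d : ℤ) (x : M) : component 𝓜 d x ∈ 𝓜 d := by
  induction x using DirectSum.Decomposition.inductionOn 𝓜 with
  | zero => simp
  | @homogeneous j a =>
    rw [component, glue_apply 𝓜 _ a.2]
    split_ifs with h
    · subst h
      exact a.2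
    · simp
  | add a b ha hb => rw [map_add]; exact add_mem ha hb

theorem component_of_mem {d : ℤ} {a : M} (ha : a ∈ 𝓜 d) : component 𝓜 d a = a := by
  simp [component, glue_apply 𝓜 _ ha]

theorem component_of_mem_ne {d j : ℤ} (h : j ≠ d) {a : M} (ha : a ∈ 𝓜 j) :
    component 𝓜 d a = 0 := by
  simp [component, glue_apply 𝓜 _ ha, h]

theorem component_comp_of_hasDegree {𝓝 : ℤ → Submodule K N} [DirectSum.Decomposition 𝓝] {e : ℤ}
    {f : M →ₗ[K] N} (hf : HasDegree 𝓜 𝓝 e f) (d : ℤ) (x : M) :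
    component 𝓝 (d + e) (f x) = f (component 𝓜 d x) := by
  induction x using DirectSum.Decomposition.inductionOn 𝓜 with
  | zero => simp
  | @homogeneous j a =>
    by_cases h : j = d
    · subst h
      rw [component_of_mem 𝓜 a.2, component_of_mem 𝓝 (hf _ _ a.2)]
    · rw [component_of_mem_ne 𝓜 h a.2, map_zero,
        component_of_mem_ne 𝓝 (fun h' => h (add_right_cancel h')) (hf _ _ a.2)]
  | add a b ha hb => simp only [map_add, ha, hb]

/-- The part of degree `e` of a linear map `f`: on an element of degree `d`, it is the component
of degree `d + e` of the value of `f`. -/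
def degreePart (𝓝 : ℤ → Submodule K N) [DirectSum.Decomposition 𝓝] (e : ℤ) (f : M →ₗ[K] N) :
    M →ₗ[K] N :=
  glue 𝓜 (fun d => component 𝓝 (d + e) ∘ₗ f)

theorem degreePart_apply (𝓝 : ℤ → Submodule K N) [DirectSum.Decomposition 𝓝] (e : ℤ)
    (f : M →ₗ[K] N) {d : ℤ} {a : M} (ha : a ∈ 𝓜 d) :
    degreePart 𝓜 𝓝 e f a = component 𝓝 (d + e) (f a) :=
  glue_apply 𝓜 _ ha

theorem hasDegree_degreePart (𝓝 : ℤ → Submodule K N) [DirectSum.Decomposition 𝓝] (e : ℤ)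
    (f : M →ₗ[K] N) : HasDegree 𝓜 𝓝 e (degreePart 𝓜 𝓝 e f) := by
  intro d a ha
  rw [degreePart_apply 𝓜 𝓝 e f ha]
  exact component_mem 𝓝 _ _

/-- The operator that multiplies elements of degree `j` by `(-1)^(ij)`. -/
def twist (i : ℤ) : M →ₗ[K] M := glue 𝓜 (fun j => koszul K i j • LinearMap.id)

theorem twist_apply (i : ℤ) {j : ℤ} {a : M} (ha : a ∈ 𝓜 j) :
    twist 𝓜 i a = koszul K i j • a := glue_apply 𝓜 _ ha

theorem twist_comp_of_hasDegree {𝓝 : ℤ → Submodule K N} [DirectSum.Decomposition 𝓝] {e : ℤ}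
    {f : M →ₗ[K] N} (hf : HasDegree 𝓜 𝓝 e f) (i : ℤ) :
    twist 𝓝 i ∘ₗ f = koszul K i e • f ∘ₗ twist 𝓜 i := by
  apply Sym.linearMap_ext_homogeneous 𝓜
  intro j a ha
  simp only [LinearMap.comp_apply, LinearMap.smul_apply]
  rw [twist_apply 𝓜 i ha, twist_apply 𝓝 i (hf _ _ ha), koszul_add_right, map_smul, smul_smul,
    mul_comm]

theorem twist_comp_twist (i j : ℤ) : twist 𝓜 i ∘ₗ twist 𝓜 j = twist 𝓜 (i + j) := by
  apply Sym.linearMap_ext_homogeneous 𝓜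
  intro k a ha
  rw [LinearMap.comp_apply, twist_apply 𝓜 j ha, map_smul, twist_apply 𝓜 i ha,
    twist_apply 𝓜 _ ha, smul_smul, koszul_add_left, mul_comm]

theorem tensor_ext_homogeneous {P L : Type*} [AddCommGroup P] [Module K P] [AddCommGroup L]
    [Module K L] {f g : M ⊗[K] L →ₗ[K] P}
    (h : ∀ j, ∀ a ∈ 𝓜 j, ∀ b, f (a ⊗ₜ b) = g (a ⊗ₜ b)) : f = g := by
  apply TensorProduct.ext
  apply Sym.linearMap_ext_homogeneous 𝓜
  intro j a ha
  ext b
  exact h j a ha b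

end Graded

namespace Sym

variable {K : Type w} [Field K] {U : Type u} [AddCommGroup U] [Module K U]

/-! ### Words -/

section Word

variable (𝒰 : ℤ → Submodule K U)

/-- `IsWord 𝒰 n d x` says that `x` is a product of `n` homogeneous elements of `U` whose degrees
add up to `d`. -/
inductive IsWord : ℕ → ℤ → Sym 𝒰 → Prop
  | one : IsWord 0 0 1
  | ι_mul {n : ℕ} {d i : ℤ} {a : U} {x : Sym 𝒰} (ha : a ∈ 𝒰 i) (hx : IsWord n d x) :
      IsWord (n + 1) (i + d) (ι 𝒰 a * x)

variable {𝒰}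

theorem IsWord.mem_deg {n : ℕ} {d : ℤ} {x : Sym 𝒰} (hx : IsWord 𝒰 n d x) : x ∈ deg 𝒰 d := by
  induction hx with
  | one => exact SetLike.GradedOne.one_mem
  | ι_mul ha _ ih => exact SetLike.GradedMul.mul_mem (ι_mem_deg 𝒰 ha) ih

theorem IsWord.mem_power {n : ℕ} {d : ℤ} {x : Sym 𝒰} (hx : IsWord 𝒰 n d x) :
    x ∈ power 𝒰 n := by
  induction hx with
  | one => rw [power, pow_zero]; exact Submodule.one_le.1 le_rfl
  | ι_mul ha _ ih =>
    rw [power, pow_succ']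
    exact Submodule.mul_mem_mul (LinearMap.mem_range_self _ _) ih

theorem IsWord.eq_one {d : ℤ} {x : Sym 𝒰} (hx : IsWord 𝒰 0 d x) : x = 1 := by
  cases hx
  rfl

theorem IsWord.counit_eq_zero {n : ℕ} {d : ℤ} {x : Sym 𝒰} (hx : IsWord 𝒰 n d x) (hn : n ≠ 0) :
    counit 𝒰 x = 0 := by
  cases hx with
  | one => exact absurd rfl hn
  | ι_mul ha _ => simp

theorem IsWord.proj_eq_zero {n : ℕ} {d : ℤ} {x : Sym 𝒰} (hx : IsWord 𝒰 n d x) (hn : n ≠ 1) :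
    proj 𝒰 x = 0 := by
  cases hx with
  | one => exact proj_one 𝒰
  | ι_mul ha hx => simp [proj_mul, hx.counit_eq_zero (fun h => hn (by rw [h]))]

theorem IsWord.exists_eq_ι {d : ℤ} {x : Sym 𝒰} (hx : IsWord 𝒰 1 d x) : ∃ a, x = ι 𝒰 a := by
  cases hx with
  | @ι_mul n d i a x ha hx => exact ⟨a, by rw [hx.eq_one, mul_one]⟩

theorem deg_le_span_isWord (d : ℤ) :
    deg 𝒰 d ≤ Submodule.span K {x | ∃ n, IsWord 𝒰 n d x} := by
  apply Submodule.span_mono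
  rintro _ ⟨l, rfl, rfl⟩
  induction l with
  | nil => exact ⟨0, .one⟩
  | cons v l ih =>
    obtain ⟨n, hn⟩ := ih
    exact ⟨n + 1, by simpa using IsWord.ι_mul v.2.2 hn⟩

theorem hasDegree_of_isWord {M : Type*} [AddCommGroup M] [Module K M] {𝓜 : ℤ → Submodule K M}
    {e : ℤ} {f : Sym 𝒰 →ₗ[K] M} (h : ∀ n d x, IsWord 𝒰 n d x → f x ∈ 𝓜 (d + e)) :
    HasDegree (deg 𝒰) 𝓜 e f := by
  intro d x hx
  replace hx := deg_le_span_isWord _ hx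
  induction hx using Submodule.span_induction with
  | mem x hx =>
    obtain ⟨n, hn⟩ := hx
    exact h _ _ _ hn
  | zero => simp
  | add x y _ _ hx hy => rw [map_add]; exact add_mem hx hy
  | smul r x _ hx => rw [map_smul]; exact Submodule.smul_mem _ _ hx

variable [DirectSum.Decomposition 𝒰]

theorem word_induction {P : Sym 𝒰 → Prop} (hw : ∀ n d x, IsWord 𝒰 n d x → P x) (h0 : P 0)
    (ha : ∀ x y, P x → P y → P (x + y)) (hs : ∀ (r : K) x, P x → P (r • x)) (x : Sym 𝒰) :
    P x := by
  induction x using DirectSum.Decomposition.inductionOn (deg 𝒰) with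
  | zero => exact h0
  | add x y hx hy => exact ha _ _ hx hy
  | homogeneous x =>
    obtain ⟨x, hx⟩ := x
    dsimp only
    replace hx := deg_le_span_isWord _ hx
    induction hx using Submodule.span_induction with
    | mem x hx =>
      obtain ⟨n, hn⟩ := hx
      exact hw _ _ _ hn
    | zero => exact h0
    | add x y _ _ hx hy => exact ha _ _ hx hy
    | smul r x _ hx => exact hs _ _ hx

theorem ext_word {M : Type*} [AddCommGroup M] [Module K M] {f g : Sym 𝒰 →ₗ[K] M}
    (h : ∀ n d x, IsWord 𝒰 n d x → f x = g x) : f = g := by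
  ext x
  induction x using word_induction with
  | hw n d x hx => exact h n d x hx
  | h0 => simp
  | ha x y hx hy => simp [hx, hy]
  | hs r x hx => simp [hx]

end Word

/-! ### The coproduct of words -/

section Comul

variable (𝒰 : ℤ → Submodule K U) [DirectSum.Decomposition 𝒰]

/-- The coproduct of a product `ι a * x` is `(a ⊗ 1 + 1 ⊗ a) Δ x`; the sign of the second term is
carried by `twist`. -/
theorem comul_ι_mul_eq {i : ℤ} {a : U} (ha : a ∈ 𝒰 i) (x : Sym 𝒰) :
    comul 𝒰 (ι 𝒰 a * x) =
      TensorProduct.map (LinearMap.mulLeft K (ι 𝒰 a)) LinearMap.id (comul 𝒰 x) +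
      TensorProduct.map (twist (deg 𝒰) i) (LinearMap.mulLeft K (ι 𝒰 a)) (comul 𝒰 x) := by
  refine comul_ι_mul 𝒰 LinearMap.id
    (TensorProduct.map (LinearMap.mulLeft K (ι 𝒰 a)) LinearMap.id +
      TensorProduct.map (twist (deg 𝒰) i) (LinearMap.mulLeft K (ι 𝒰 a))) ha ?_ x
  intro j b hb c
  simp [twist_apply _ i hb, units_smul_eq_koszul (K := K), TensorProduct.smul_tmul']

/-- The coproduct preserves the length and the degree of words. -/
theorem comul_isWord {n : ℕ} {d : ℤ} {x : Sym 𝒰} (hx : IsWord 𝒰 n d x) :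
    comul 𝒰 x ∈ Submodule.span K {z : Sym 𝒰 ⊗[K] Sym 𝒰 | ∃ n₁ n₂ d₁ d₂ a b, n₁ + n₂ = n ∧
      d₁ + d₂ = d ∧ IsWord 𝒰 n₁ d₁ a ∧ IsWord 𝒰 n₂ d₂ b ∧ z = a ⊗ₜ b} := by
  induction hx with
  | one =>
    rw [comul_one]
    exact Submodule.subset_span ⟨0, 0, 0, 0, 1, 1, rfl, rfl, .one, .one, rfl⟩
  | @ι_mul n d i u x hu hx ih =>
    rw [comul_ι_mul_eq 𝒰 hu, ← LinearMap.add_apply]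
    generalize comul 𝒰 x = y at ih
    induction ih using Submodule.span_induction with
    | zero => simp
    | add y z _ _ hy hz => rw [map_add]; exact add_mem hy hz
    | smul r y _ hy => rw [map_smul]; exact Submodule.smul_mem _ _ hy
    | mem z hz =>
      obtain ⟨n₁, n₂, d₁, d₂, a, b, hn, hd, ha, hb, rfl⟩ := hz
      simp only [LinearMap.add_apply, TensorProduct.map_tmul, LinearMap.mulLeft_apply,
        LinearMap.id_apply, twist_apply _ i ha.mem_deg, ← TensorProduct.smul_tmul']
      refine add_mem (Submodule.subset_span ?_) (Submodule.smul_mem _ _ (Submodule.subset_span ?_))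
      · exact ⟨n₁ + 1, n₂, i + d₁, d₂, _, _, by omega, by omega, ha.ι_mul hu, hb, rfl⟩
      · exact ⟨n₁, n₂ + 1, d₁, i + d₂, _, _, by omega, by omega, ha, hb.ι_mul hu, rfl⟩

/-- To show that a linear function of `Δ x` lies in a submodule, for a word `x`, it suffices to
look at the tensor products of words with the right total length and degree. -/
theorem map_comul_mem {M : Type*} [AddCommGroup M] [Module K M] (T : Sym 𝒰 ⊗[K] Sym 𝒰 →ₗ[K] M)
    (N : Submodule K M) {n : ℕ} {d : ℤ} {x : Sym 𝒰} (hx : IsWord 𝒰 n d x)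
    (h : ∀ n₁ n₂ d₁ d₂ a b, n₁ + n₂ = n → d₁ + d₂ = d → IsWord 𝒰 n₁ d₁ a → IsWord 𝒰 n₂ d₂ b →
      T (a ⊗ₜ b) ∈ N) : T (comul 𝒰 x) ∈ N := by
  have key := comul_isWord 𝒰 hx
  rw [← Submodule.mem_comap]
  refine Submodule.span_le.2 ?_ key
  rintro _ ⟨n₁, n₂, d₁, d₂, a, b, hn, hd, ha, hb, rfl⟩
  exact h n₁ n₂ d₁ d₂ a b hn hd ha hb

theorem map_comul_congr {M : Type*} [AddCommGroup M] [Module K M]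
    {T T' : Sym 𝒰 ⊗[K] Sym 𝒰 →ₗ[K] M} {n : ℕ} {d : ℤ} {x : Sym 𝒰} (hx : IsWord 𝒰 n d x)
    (h : ∀ n₁ n₂ d₁ d₂ a b, n₁ + n₂ = n → d₁ + d₂ = d → IsWord 𝒰 n₁ d₁ a → IsWord 𝒰 n₂ d₂ b →
      T (a ⊗ₜ b) = T' (a ⊗ₜ b)) : T (comul 𝒰 x) = T' (comul 𝒰 x) := by
  have := map_comul_mem 𝒰 (T - T') ⊥ hx (by
    intro n₁ n₂ d₁ d₂ a b hn hd ha hb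
    simp [h n₁ n₂ d₁ d₂ a b hn hd ha hb])
  simpa [sub_eq_zero] using this

/-- The map `(q ⊗ 1) Δ` followed by the product. It is a coderivation; `coder` is its restriction
to the reduced symmetric space. -/
def coderiv (q : Sym 𝒰 →ₗ[K] U) : Sym 𝒰 →ₗ[K] Sym 𝒰 :=
  LinearMap.mul' K (Sym 𝒰) ∘ₗ TensorProduct.map (ι 𝒰 ∘ₗ q) LinearMap.id ∘ₗ comul 𝒰

theorem coe_coder_eq (q : Red 𝒰 →ₗ[K] U) (x : Red 𝒰) :
    (coder 𝒰 q x : Sym 𝒰) = coderiv 𝒰 (q ∘ₗ toRed 𝒰) x := rfl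

theorem coderiv_one (q : Sym 𝒰 →ₗ[K] U) : coderiv 𝒰 q 1 = ι 𝒰 (q 1) := by
  simp [coderiv, comul_one]

theorem coderiv_add (q q' : Sym 𝒰 →ₗ[K] U) :
    coderiv 𝒰 (q + q') = coderiv 𝒰 q + coderiv 𝒰 q' := by
  simp only [coderiv, LinearMap.comp_add, TensorProduct.map_add_left, LinearMap.add_comp]

theorem coderiv_sub (q q' : Sym 𝒰 →ₗ[K] U) :
    coderiv 𝒰 (q - q') = coderiv 𝒰 q - coderiv 𝒰 q' := by
  rw [eq_sub_iff_add_eq, ← coderiv_add, sub_add_cancel]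

theorem counit_coderiv (q : Sym 𝒰 →ₗ[K] U) (x : Sym 𝒰) : counit 𝒰 (coderiv 𝒰 q x) = 0 := by
  have h : (counit 𝒰).toLinearMap ∘ₗ LinearMap.mul' K (Sym 𝒰) ∘ₗ
      TensorProduct.map (ι 𝒰 ∘ₗ q) LinearMap.id = 0 := by
    ext a b
    simp
  exact LinearMap.congr_fun h _

theorem proj_coderiv (q : Sym 𝒰 →ₗ[K] U) (x : Sym 𝒰) : proj 𝒰 (coderiv 𝒰 q x) = q x := by
  have h : proj 𝒰 ∘ₗ LinearMap.mul' K (Sym 𝒰) ∘ₗ TensorProduct.map (ι 𝒰 ∘ₗ q) LinearMap.id =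
      q ∘ₗ LinearMap.mul' K (Sym 𝒰) ∘ₗ TensorProduct.map LinearMap.id
        (Algebra.linearMap K (Sym 𝒰) ∘ₗ (counit 𝒰).toLinearMap) := by
    ext a b
    simp [proj_mul, ← Algebra.commutes, ← Algebra.smul_def]
  have h' := LinearMap.congr_fun h (comul 𝒰 x)
  simp only [LinearMap.comp_apply, comul_counit] at h'
  exact h'

/-- A coderivation is determined on `ι a * x` by its values on `x` and those of the coderivation
obtained by inserting `a`. -/
theorem coderiv_ι_mul {e : ℤ} {q : Sym 𝒰 →ₗ[K] U} (hq : HasDegree (deg 𝒰) 𝒰 e q) {i : ℤ} {a : U}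
    (ha : a ∈ 𝒰 i) (x : Sym 𝒰) :
    coderiv 𝒰 q (ι 𝒰 a * x) = coderiv 𝒰 (q ∘ₗ LinearMap.mulLeft K (ι 𝒰 a)) x +
      koszul K e i • (ι 𝒰 a * coderiv 𝒰 q x) := by
  simp only [coderiv, LinearMap.comp_apply, comul_ι_mul_eq 𝒰 ha, map_add]
  congr 1
  · rw [← LinearMap.comp_apply (TensorProduct.map _ _), ← TensorProduct.map_comp]
    rfl
  · have h : LinearMap.mul' K (Sym 𝒰) ∘ₗ TensorProduct.map (ι 𝒰 ∘ₗ q) LinearMap.id ∘ₗ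
        TensorProduct.map (twist (deg 𝒰) i) (LinearMap.mulLeft K (ι 𝒰 a)) =
        koszul K e i • LinearMap.mulLeft K (ι 𝒰 a) ∘ₗ LinearMap.mul' K (Sym 𝒰) ∘ₗ
          TensorProduct.map (ι 𝒰 ∘ₗ q) LinearMap.id := by
      apply tensor_ext_homogeneous (deg 𝒰)
      intro j b hb c
      simp only [LinearMap.comp_apply, TensorProduct.map_tmul, twist_apply _ i hb, map_smul,
        LinearMap.mulLeft_apply, LinearMap.id_apply, LinearMap.mul'_apply, LinearMap.smul_apply,
        smul_mul_assoc]
      rw [← mul_assoc, ι_comm 𝒰 (hq _ _ hb) ha, units_smul_eq_koszul (K := K), smul_mul_assoc,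
        smul_smul, koszul_add_left, ← mul_assoc, koszul_comm i j, koszul_mul_self, one_mul,
        mul_assoc]
    exact LinearMap.congr_fun h (comul 𝒰 x)

theorem hasDegree_coderiv {e : ℤ} {q : Sym 𝒰 →ₗ[K] U} (hq : HasDegree (deg 𝒰) 𝒰 e q) :
    HasDegree (deg 𝒰) (deg 𝒰) e (coderiv 𝒰 q) := by
  apply hasDegree_of_isWord
  intro n d x hx
  refine map_comul_mem 𝒰 (LinearMap.mul' K (Sym 𝒰) ∘ₗ
    TensorProduct.map (ι 𝒰 ∘ₗ q) LinearMap.id) _ hx ?_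
  intro n₁ n₂ d₁ d₂ a b hn hd ha hb
  have h := SetLike.GradedMul.mul_mem (ι_mem_deg 𝒰 (hq _ _ ha.mem_deg)) hb.mem_deg
  rw [show d₁ + e + d₂ = d + e by omega] at h
  exact h

end Comul

/-! ### Derivations and morphisms extending linear maps -/

section Map

variable (𝒰 : ℤ → Submodule K U) {U' : Type u} [AddCommGroup U'] [Module K U']
  (𝒰' : ℤ → Submodule K U')

theorem hasDegree_proj : HasDegree (deg 𝒰) 𝒰 0 (proj 𝒰) := by
  intro d x hx
  rw [add_zero]
  exact proj_mem 𝒰 hx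

/-- The morphism of algebras extending a linear map `f : U → U'` of degree zero. -/
def map (f : U →ₗ[K] U') (hf : HasDegree 𝒰 𝒰' 0 f) : Sym 𝒰 →ₐ[K] Sym 𝒰' :=
  lift 𝒰 (ι 𝒰' ∘ₗ f) (fun _ _ _ _ ha hb => ι_comm 𝒰' (hf.mem ha) (hf.mem hb))

@[simp]
theorem map_ι (f : U →ₗ[K] U') (hf : HasDegree 𝒰 𝒰' 0 f) (a : U) :
    map 𝒰 𝒰' f hf (ι 𝒰 a) = ι 𝒰' (f a) := by
  simp [map]

theorem map_isWord {f : U →ₗ[K] U'} (hf : HasDegree 𝒰 𝒰' 0 f) {n : ℕ} {d : ℤ} {x : Sym 𝒰}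
    (hx : IsWord 𝒰 n d x) : IsWord 𝒰' n d (map 𝒰 𝒰' f hf x) := by
  induction hx with
  | one => rw [map_one]; exact .one
  | ι_mul ha _ ih => rw [map_mul, map_ι]; exact .ι_mul (hf.mem ha) ih

theorem hasDegree_map {f : U →ₗ[K] U'} (hf : HasDegree 𝒰 𝒰' 0 f) :
    HasDegree (deg 𝒰) (deg 𝒰') 0 (map 𝒰 𝒰' f hf).toLinearMap := by
  apply hasDegree_of_isWord
  intro n d x hx
  rw [add_zero]
  exact (map_isWord 𝒰 𝒰' hf hx).mem_deg

end Map

section Derivation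

variable (𝒰 : ℤ → Submodule K U) [DirectSum.Decomposition 𝒰]

/-- The extension of a linear map `U → U` to a derivation of the graded symmetric algebra. -/
def der (f : U →ₗ[K] U) : Sym 𝒰 →ₗ[K] Sym 𝒰 := coderiv 𝒰 (f ∘ₗ proj 𝒰)

theorem der_one (f : U →ₗ[K] U) : der 𝒰 f 1 = 0 := by
  simp [der, coderiv_one, proj_one]

theorem der_zero : der 𝒰 (0 : U →ₗ[K] U) = 0 := by
  simp [der, coderiv]

theorem der_ι_mul {e : ℤ} {f : U →ₗ[K] U} (hf : HasDegree 𝒰 𝒰 e f) {i : ℤ} {a : U}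
    (ha : a ∈ 𝒰 i) (x : Sym 𝒰) :
    der 𝒰 f (ι 𝒰 a * x) = ι 𝒰 (f a) * x + koszul K e i • (ι 𝒰 a * der 𝒰 f x) := by
  rw [der, coderiv_ι_mul 𝒰 (hf.comp (hasDegree_proj 𝒰) (zero_add e)) ha]
  congr 1
  have h : LinearMap.mul' K (Sym 𝒰) ∘ₗ TensorProduct.map
      (ι 𝒰 ∘ₗ (f ∘ₗ proj 𝒰) ∘ₗ LinearMap.mulLeft K (ι 𝒰 a)) LinearMap.id =
      LinearMap.mulLeft K (ι 𝒰 (f a)) ∘ₗ LinearMap.mul' K (Sym 𝒰) ∘ₗ TensorProduct.map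
        (Algebra.linearMap K (Sym 𝒰) ∘ₗ (counit 𝒰).toLinearMap) LinearMap.id := by
    ext b c
    simp [proj_mul, ← Algebra.smul_def]
  have h' := LinearMap.congr_fun h (comul 𝒰 x)
  simp only [LinearMap.comp_apply, counit_comul, LinearMap.mulLeft_apply] at h'
  exact h'

/-- The graded commutator of derivations of degree `1` and `-1`. -/
theorem der_comp_der_add {d h : U →ₗ[K] U} (hd : HasDegree 𝒰 𝒰 1 d) (hh : HasDegree 𝒰 𝒰 (-1) h) :
    der 𝒰 d ∘ₗ der 𝒰 h + der 𝒰 h ∘ₗ der 𝒰 d = der 𝒰 (d ∘ₗ h + h ∘ₗ d) := by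
  have hdh : HasDegree 𝒰 𝒰 0 (d ∘ₗ h + h ∘ₗ d) := (hd.comp hh (by norm_num)).add
    (hh.comp hd (by norm_num))
  ext x
  induction x using induction_left with
  | h1 => simp [der_one]
  | h0 => simp
  | ha x y hx hy => rw [map_add, hx, hy, map_add]
  | hs r x hx => rw [map_smul, hx, map_smul]
  | hm i a ha x hx =>
    rw [der_ι_mul 𝒰 hdh ha, ← hx]
    have h1 : koszul K 1 (i + -1) = - koszul K 1 i := by
      rw [koszul_add_right, koszul_comm 1 (-1), koszul_neg_left, koszul_one_one, mul_neg_one]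
    have h2 : koszul K 1 (i + 1) = - koszul K 1 i := by
      rw [koszul_add_right, koszul_one_one, mul_neg_one]
    simp only [LinearMap.add_apply, LinearMap.comp_apply, der_ι_mul 𝒰 hd ha,
      der_ι_mul 𝒰 hh ha, map_add, map_smul, der_ι_mul 𝒰 hd (hh _ _ ha),
      der_ι_mul 𝒰 hh (hd _ _ ha), koszul_neg_left, h1, h2, koszul_zero_left, one_smul, smul_add,
      smul_smul, koszul_mul_self, neg_smul, mul_add, add_mul]
    abel

theorem der_comp_self {d : U →ₗ[K] U} (hd : HasDegree 𝒰 𝒰 1 d) (hdd : d ∘ₗ d = 0) :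
    der 𝒰 d ∘ₗ der 𝒰 d = 0 := by
  ext x
  induction x using induction_left with
  | h1 => simp [der_one]
  | h0 => simp
  | ha x y hx hy => rw [map_add, hx, hy, map_add]
  | hs r x hx => rw [map_smul, hx, map_smul]
  | hm i a ha x hx =>
    have h2 : koszul K 1 (i + 1) = - koszul K 1 i := by
      rw [koszul_add_right, koszul_one_one, mul_neg_one]
    have h3 : d (d a) = 0 := LinearMap.congr_fun hdd a
    simp only [LinearMap.comp_apply, LinearMap.zero_apply] at hx ⊢
    simp [der_ι_mul 𝒰 hd ha, der_ι_mul 𝒰 hd (hd _ _ ha), h2, h3, hx]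

variable {U' : Type u} [AddCommGroup U'] [Module K U'] (𝒰' : ℤ → Submodule K U')
  [DirectSum.Decomposition 𝒰']

theorem map_comp_der {e : ℤ} {f : U →ₗ[K] U'} (hf : HasDegree 𝒰 𝒰' 0 f) {d : U →ₗ[K] U}
    {d' : U' →ₗ[K] U'} (hd : HasDegree 𝒰 𝒰 e d) (hd' : HasDegree 𝒰' 𝒰' e d')
    (h : f ∘ₗ d = d' ∘ₗ f) (x : Sym 𝒰) :
    map 𝒰 𝒰' f hf (der 𝒰 d x) = der 𝒰' d' (map 𝒰 𝒰' f hf x) := by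
  induction x using induction_left with
  | h1 => simp [der_one]
  | h0 => simp
  | ha x y hx hy => rw [map_add, map_add, hx, hy, map_add, map_add]
  | hs r x hx => rw [map_smul, map_smul, hx, map_smul, map_smul]
  | hm i a ha x hx =>
    have h' : f (d a) = d' (f a) := LinearMap.congr_fun h a
    rw [der_ι_mul 𝒰 hd ha, map_mul, map_ι, der_ι_mul 𝒰' hd' (hf.mem ha), map_add, map_smul,
      map_mul, map_mul, map_ι, map_ι, hx, h']

end Derivation

end Sym

end LInf

end

noncomputable section

namespace LInf

/-! ### Linear algebra of graded complexes -/

section Complex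

variable {K : Type w} [Field K]

/-- Every linear map over a field has a generalized inverse. -/
theorem exists_comp_comp_eq {M N : Type*} [AddCommGroup M] [Module K M] [AddCommGroup N]
    [Module K N] (f : M →ₗ[K] N) : ∃ g : N →ₗ[K] M, f ∘ₗ g ∘ₗ f = f := by
  obtain ⟨s, hs⟩ := f.rangeRestrict.exists_rightInverse_of_surjective f.range_rangeRestrict
  obtain ⟨g, hg⟩ := s.exists_extend
  refine ⟨g, ?_⟩
  ext x
  have h1 : g (f x) = s (f.rangeRestrict x) := LinearMap.congr_fun hg (f.rangeRestrict x)
  have h2 : f.rangeRestrict (s (f.rangeRestrict x)) = f.rangeRestrict x :=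
    LinearMap.congr_fun hs (f.rangeRestrict x)
  rw [LinearMap.comp_apply, LinearMap.comp_apply, h1]
  exact congrArg Subtype.val h2

variable {U M : Type*} [AddCommGroup U] [Module K U] [AddCommGroup M] [Module K M]
  (𝒰 : ℤ → Submodule K U) [DirectSum.Decomposition 𝒰]
  (𝓜 : ℤ → Submodule K M) [DirectSum.Decomposition 𝓜]

theorem coe_decompose_eq_component (x : U) (i : ℤ) :
    (DirectSum.decompose 𝒰 x i : U) = component 𝒰 i x := by
  induction x using DirectSum.Decomposition.inductionOn 𝒰 with
  | zero => simp
  | @homogeneous j a =>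
    by_cases h : j = i
    · subst h
      rw [DirectSum.decompose_of_mem_same 𝒰 a.2, component_of_mem 𝒰 a.2]
    · rw [DirectSum.decompose_of_mem_ne 𝒰 a.2 h, component_of_mem_ne 𝒰 h a.2]
  | add a b ha hb => simp [ha, hb]

/-- The kernel of a homogeneous map is spanned by homogeneous elements. -/
theorem mem_of_ker {e : ℤ} {d : U →ₗ[K] M} (hd : HasDegree 𝒰 𝓜 e d) (N : Submodule K U)
    (h : ∀ i, ∀ z ∈ 𝒰 i, d z = 0 → z ∈ N) {z : U} (hz : d z = 0) : z ∈ N := by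
  classical
  rw [← DirectSum.sum_support_decompose 𝒰 z]
  refine Submodule.sum_mem _ fun i _ => ?_
  rw [coe_decompose_eq_component]
  refine h i _ (component_mem 𝒰 i z) ?_
  rw [← component_comp_of_hasDegree 𝒰 hd, hz, map_zero]

variable {𝒰 𝓜}

/-- A morphism of graded complexes that is injective in cohomology has a left inverse in
cohomology, which may be taken to vanish on boundaries and to have values in the cycles. -/
theorem exists_retraction {d : U →ₗ[K] U} {δ : M →ₗ[K] M} {j : U →ₗ[K] M}
    (hd : HasDegree 𝒰 𝒰 1 d) (hδ : HasDegree 𝓜 𝓜 1 δ) (hj : HasDegree 𝒰 𝓜 0 j)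
    (hinj : ∀ z, d z = 0 → j z ∈ LinearMap.range δ → z ∈ LinearMap.range d) :
    ∃ t : M →ₗ[K] U, HasDegree 𝓜 𝒰 0 t ∧ d ∘ₗ t = 0 ∧ t ∘ₗ δ = 0 ∧
      ∀ z, d z = 0 → t (j z) - z ∈ LinearMap.range d := by
  let φ : LinearMap.ker d →ₗ[K] M ⧸ LinearMap.range δ :=
    (LinearMap.range δ).mkQ ∘ₗ j ∘ₗ (LinearMap.ker d).subtype
  obtain ⟨ψ, hψ⟩ := exists_comp_comp_eq φ
  let t₀ : M →ₗ[K] U := (LinearMap.ker d).subtype ∘ₗ ψ ∘ₗ (LinearMap.range δ).mkQ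
  have h1 : ∀ x, d (t₀ x) = 0 := fun x => (ψ ((LinearMap.range δ).mkQ x)).2
  have h2 : ∀ x, t₀ (δ x) = 0 := by
    intro x
    have : (LinearMap.range δ).mkQ (δ x) = 0 := by
      rw [Submodule.mkQ_apply, Submodule.Quotient.mk_eq_zero]
      exact LinearMap.mem_range_self _ _
    simp [t₀, this]
  have h3 : ∀ z, d z = 0 → t₀ (j z) - z ∈ LinearMap.range d := by
    intro z hz
    apply hinj
    · rw [map_sub, h1, hz, sub_zero]
    · have : φ (ψ (φ ⟨z, hz⟩) - ⟨z, hz⟩) = 0 := by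
        rw [map_sub, sub_eq_zero]
        exact LinearMap.congr_fun hψ _
      rw [← Submodule.Quotient.mk_eq_zero, ← Submodule.mkQ_apply]
      exact this
  clear_value t₀
  refine ⟨degreePart 𝓜 𝒰 0 t₀, hasDegree_degreePart _ _ _ _, ?_, ?_, ?_⟩
  · apply Sym.linearMap_ext_homogeneous 𝓜
    intro i a ha
    rw [LinearMap.comp_apply, degreePart_apply 𝓜 𝒰 0 t₀ ha, ← component_comp_of_hasDegree 𝒰 hd, h1,
      map_zero, LinearMap.zero_apply]
  · apply Sym.linearMap_ext_homogeneous 𝓜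
    intro i a ha
    rw [LinearMap.comp_apply, degreePart_apply 𝓜 𝒰 0 t₀ (hδ _ _ ha), h2, map_zero,
      LinearMap.zero_apply]
  · intro z hz
    refine mem_of_ker 𝒰 𝒰 hd
      ((LinearMap.range d).comap (degreePart 𝓜 𝒰 0 t₀ ∘ₗ j - LinearMap.id)) ?_ hz
    intro i z hi hz
    obtain ⟨y, hy⟩ := h3 z hz
    refine ⟨component 𝒰 (i - 1) y, ?_⟩
    rw [← component_comp_of_hasDegree 𝒰 hd, hy, sub_add_cancel, map_sub, component_of_mem 𝒰 hi,
      LinearMap.sub_apply, LinearMap.comp_apply, degreePart_apply 𝓜 𝒰 0 t₀ (hj.mem hi), add_zero,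
      LinearMap.id_apply]

/-- A projector `e` that vanishes on boundaries, has values in the cycles, and induces the identity
in cohomology is homotopic to the identity. -/
theorem exists_homotopy {d e : U →ₗ[K] U} (hd : HasDegree 𝒰 𝒰 1 d) (hdd : d ∘ₗ d = 0)
    (he : HasDegree 𝒰 𝒰 0 e) (hde : d ∘ₗ e = 0) (hed : e ∘ₗ d = 0) (hee : e ∘ₗ e = e)
    (hz : ∀ z, d z = 0 → e z - z ∈ LinearMap.range d) :
    ∃ h : U →ₗ[K] U, HasDegree 𝒰 𝒰 (-1) h ∧ d ∘ₗ h + h ∘ₗ d = LinearMap.id - e := by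
  obtain ⟨s₀, hs₀⟩ := exists_comp_comp_eq d
  have hs₀' : ∀ x, d (s₀ (d x)) = d x := LinearMap.congr_fun hs₀
  let s₁ := degreePart 𝒰 𝒰 (-1) s₀
  have hs₁ : HasDegree 𝒰 𝒰 (-1) s₁ := hasDegree_degreePart _ _ _ _
  have hs₁' : d ∘ₗ s₁ ∘ₗ d = d := by
    apply Sym.linearMap_ext_homogeneous 𝒰
    intro i a ha
    rw [LinearMap.comp_apply, LinearMap.comp_apply, degreePart_apply 𝒰 𝒰 (-1) s₀ (hd _ _ ha),
      ← component_comp_of_hasDegree 𝒰 hd, hs₀', neg_add_cancel_right, component_of_mem 𝒰 (hd _ _ ha)]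
  let s := s₁ - e ∘ₗ s₁
  have hs : HasDegree 𝒰 𝒰 (-1) s := hs₁.sub (he.comp hs₁ (by norm_num))
  have hde' : ∀ x, d (e x) = 0 := LinearMap.congr_fun hde
  have hed' : ∀ x, e (d x) = 0 := LinearMap.congr_fun hed
  have hee' : ∀ x, e (e x) = e x := LinearMap.congr_fun hee
  have hdd' : ∀ x, d (d x) = 0 := LinearMap.congr_fun hdd
  have hdsd : ∀ x, d (s (d x)) = d x := by
    intro x
    have := LinearMap.congr_fun hs₁' x
    simp only [LinearMap.comp_apply] at this
    simp [s, this, hde']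
  have hes : ∀ x, e (s x) = 0 := by
    intro x
    simp [s, hee']
  have hdeg : HasDegree 𝒰 𝒰 0 (LinearMap.id - s ∘ₗ d) :=
    HasDegree.id.sub (hs.comp hd (by norm_num))
  refine ⟨s ∘ₗ (LinearMap.id - e) ∘ₗ (LinearMap.id - s ∘ₗ d),
    hs.comp ((HasDegree.id.sub he).comp hdeg (add_zero 0)) (by norm_num), ?_⟩
  ext v
  obtain ⟨y, hy⟩ := hz (v - s (d v)) (by rw [map_sub, hdsd, sub_self])
  have h1 : d (s (v - s (d v) - e (v - s (d v)))) = v - s (d v) - e (v - s (d v)) := by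
    rw [← neg_sub, ← hy, ← map_neg, hdsd]
  simp only [LinearMap.add_apply, LinearMap.comp_apply, LinearMap.sub_apply, LinearMap.id_apply]
  rw [h1]
  simp only [hdd', map_zero, sub_zero, hed', map_sub, hes]
  abel

/-- A quasi-isomorphism of graded complexes has an inverse up to homotopy, of a special form. -/
theorem exists_homotopyInverse {d : U →ₗ[K] U} {δ : M →ₗ[K] M} {j : U →ₗ[K] M}
    (hd : HasDegree 𝒰 𝒰 1 d) (hdd : d ∘ₗ d = 0) (hδ : HasDegree 𝓜 𝓜 1 δ) (hδδ : δ ∘ₗ δ = 0)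
    (hj : HasDegree 𝒰 𝓜 0 j) (hjd : j ∘ₗ d = δ ∘ₗ j)
    (hinj : ∀ z, d z = 0 → j z ∈ LinearMap.range δ → z ∈ LinearMap.range d)
    (hsurj : ∀ y, δ y = 0 → ∃ z, d z = 0 ∧ y - j z ∈ LinearMap.range δ) :
    ∃ t : M →ₗ[K] U, ∃ h : U →ₗ[K] U, ∃ k : M →ₗ[K] M, HasDegree 𝓜 𝒰 0 t ∧
      HasDegree 𝒰 𝒰 (-1) h ∧ HasDegree 𝓜 𝓜 (-1) k ∧ d ∘ₗ t = 0 ∧ t ∘ₗ δ = 0 ∧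
      (t ∘ₗ j) ∘ₗ (t ∘ₗ j) = t ∘ₗ j ∧ (j ∘ₗ t) ∘ₗ (j ∘ₗ t) = j ∘ₗ t ∧
      d ∘ₗ h + h ∘ₗ d = LinearMap.id - t ∘ₗ j ∧ δ ∘ₗ k + k ∘ₗ δ = LinearMap.id - j ∘ₗ t := by
  obtain ⟨t, ht, hdt, htδ, hz⟩ := exists_retraction hd hδ hj hinj
  have hjd' : ∀ x, j (d x) = δ (j x) := LinearMap.congr_fun hjd
  have hdt' : ∀ x, d (t x) = 0 := LinearMap.congr_fun hdt
  have htδ' : ∀ x, t (δ x) = 0 := LinearMap.congr_fun htδ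
  have hstab : ∀ z, d z = 0 → t (j (t (j z))) = t (j z) := by
    intro z hdz
    obtain ⟨y, hy⟩ := hz z hdz
    rw [← sub_eq_zero, ← map_sub, ← map_sub, ← hy, hjd', htδ']
  -- The composite `t j` need not be a projector, but `t j t j` is one by `hstab`.
  let T := t ∘ₗ j ∘ₗ t
  have hT : ∀ x, T x = t (j (t x)) := fun _ => rfl
  have hTdeg : HasDegree 𝓜 𝒰 0 T := ht.comp (hj.comp ht (add_zero 0)) (add_zero 0)
  have hdT : d ∘ₗ T = 0 := by ext x; simp [hT, hdt']
  have hTδ : T ∘ₗ δ = 0 := by ext x; simp [hT, htδ']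
  clear_value T
  have e1 : (T ∘ₗ j) ∘ₗ (T ∘ₗ j) = T ∘ₗ j := by
    ext x
    simp only [LinearMap.comp_apply, hT]
    rw [hstab _ (hdt' _), hstab _ (hdt' _)]
  have e2 : (j ∘ₗ T) ∘ₗ (j ∘ₗ T) = j ∘ₗ T := by
    ext x
    simp only [LinearMap.comp_apply, hT]
    rw [hstab _ (hdt' _), hstab _ (hdt' _)]
  have z1 : ∀ z, d z = 0 → T (j z) - z ∈ LinearMap.range d := by
    intro z hdz
    rw [hT, hstab z hdz]
    exact hz z hdz
  obtain ⟨h, hh, hh'⟩ := exists_homotopy hd hdd (hTdeg.comp hj (add_zero 0))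
    (by rw [← LinearMap.comp_assoc, hdT, LinearMap.zero_comp])
    (by rw [LinearMap.comp_assoc, hjd, ← LinearMap.comp_assoc, hTδ, LinearMap.zero_comp]) e1 z1
  obtain ⟨k, hk, hk'⟩ := exists_homotopy hδ hδδ (hj.comp hTdeg (add_zero 0))
    (by rw [← LinearMap.comp_assoc, ← hjd, LinearMap.comp_assoc, hdT, LinearMap.comp_zero])
    (by rw [LinearMap.comp_assoc, hTδ, LinearMap.comp_zero]) e2 (by
      intro y hy
      obtain ⟨z, hdz, x, hx⟩ := hsurj y hy
      obtain ⟨v, hv⟩ := z1 z hdz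
      have hy' : y = δ x + j z := by rw [hx, sub_add_cancel]
      have hTx : T (δ x) = 0 := LinearMap.congr_fun hTδ x
      refine ⟨j v - x, ?_⟩
      rw [map_sub, ← hjd', hv, hy']
      simp only [LinearMap.comp_apply, map_sub, map_add, hTx, map_zero]
      abel)
  exact ⟨T, h, k, hTdeg, hh, hk, hdT, hTδ, e1, e2, hh', hk'⟩

end Complex

namespace Sym

variable {K : Type w} [Field K] {U : Type u} [AddCommGroup U] [Module K U]
  (𝒰 : ℤ → Submodule K U)

/-! ### The cohomology of the symmetric algebra of a complex -/

section Weight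

/-- The span of the words with `n` letters, i.e. the symmetric power `⨀ⁿ U`. -/
def ofLength (n : ℕ) : Submodule K (Sym 𝒰) := Submodule.span K {x | ∃ d, IsWord 𝒰 n d x}

variable {𝒰} in
theorem IsWord.mem_ofLength {n : ℕ} {d : ℤ} {x : Sym 𝒰} (hx : IsWord 𝒰 n d x) :
    x ∈ ofLength 𝒰 n := Submodule.subset_span ⟨d, hx⟩

theorem map_mem_of_ofLength {M : Type*} [AddCommGroup M] [Module K M] (f : Sym 𝒰 →ₗ[K] M)
    (N : Submodule K M) {n : ℕ} (h : ∀ d x, IsWord 𝒰 n d x → f x ∈ N) {x : Sym 𝒰}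
    (hx : x ∈ ofLength 𝒰 n) : f x ∈ N := by
  rw [← Submodule.mem_comap]
  refine Submodule.span_le.2 ?_ hx
  rintro y ⟨d, hy⟩
  exact h d y hy

theorem map_mem_ofLength {U' : Type u} [AddCommGroup U'] [Module K U'] {𝒰' : ℤ → Submodule K U'}
    {f : U →ₗ[K] U'} (hf : HasDegree 𝒰 𝒰' 0 f) {n : ℕ} {x : Sym 𝒰} (hx : x ∈ ofLength 𝒰 n) :
    map 𝒰 𝒰' f hf x ∈ ofLength 𝒰' n :=
  map_mem_of_ofLength 𝒰 (map 𝒰 𝒰' f hf).toLinearMap _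
    (fun _ _ hx => (map_isWord 𝒰 𝒰' hf hx).mem_ofLength) hx

/-- The span of the eigenvectors of `D` for the natural numbers `≥ k`. -/
def weightGE (D : Sym 𝒰 →ₗ[K] Sym 𝒰) (k : ℕ) : Submodule K (Sym 𝒰) :=
  Submodule.span K {z | ∃ n : ℕ, k ≤ n ∧ D z = (n : K) • z}

theorem exists_aeval_eq_zero [CharZero K] {D : Module.End K (Sym 𝒰)} {z : Sym 𝒰}
    (hz : z ∈ weightGE 𝒰 D 1) :
    ∃ c : Polynomial K, c.coeff 0 ≠ 0 ∧ Polynomial.aeval D c z = 0 := by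
  induction hz using Submodule.span_induction with
  | mem z hz =>
    obtain ⟨n, hn, hz⟩ := hz
    refine ⟨Polynomial.X - Polynomial.C (n : K), ?_, ?_⟩
    · simp only [Polynomial.coeff_sub, Polynomial.coeff_X_zero, Polynomial.coeff_C_zero, zero_sub,
        neg_ne_zero, Nat.cast_ne_zero]
      omega
    · rw [map_sub, Polynomial.aeval_X, Polynomial.aeval_C, LinearMap.sub_apply,
        Module.algebraMap_end_apply, hz, sub_self]
  | zero => exact ⟨1, by simp, by simp⟩
  | add x y _ _ hx hy =>
    obtain ⟨c, hc, hcx⟩ := hx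
    obtain ⟨c', hc', hcy⟩ := hy
    refine ⟨c * c', by simp [Polynomial.mul_coeff_zero, hc, hc'], ?_⟩
    have h1 : Polynomial.aeval D (c * c') x = 0 := by
      rw [mul_comm, map_mul, Module.End.mul_apply, hcx, map_zero]
    have h2 : Polynomial.aeval D (c * c') y = 0 := by
      rw [map_mul, Module.End.mul_apply, hcy, map_zero]
    rw [map_add, h1, h2, add_zero]
  | smul r x _ hx =>
    obtain ⟨c, hc, hcx⟩ := hx
    exact ⟨c, hc, by rw [map_smul, hcx, smul_zero]⟩

variable [DirectSum.Decomposition 𝒰]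

theorem ι_mul_mem_ofLength (a : U) {n : ℕ} {x : Sym 𝒰} (hx : x ∈ ofLength 𝒰 n) :
    ι 𝒰 a * x ∈ ofLength 𝒰 (n + 1) := by
  refine map_mem_of_ofLength 𝒰 (LinearMap.mulLeft K (ι 𝒰 a)) _ ?_ hx
  intro d x hx
  rw [LinearMap.mulLeft_apply]
  induction a using DirectSum.Decomposition.inductionOn 𝒰 with
  | zero => simp
  | homogeneous a => exact (hx.ι_mul a.2).mem_ofLength
  | add a b ha hb => rw [map_add, add_mul]; exact add_mem ha hb

theorem der_mem_ofLength (f : U →ₗ[K] U) {n : ℕ} {x : Sym 𝒰} (hx : x ∈ ofLength 𝒰 n) :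
    der 𝒰 f x ∈ ofLength 𝒰 n := by
  refine map_mem_of_ofLength 𝒰 (der 𝒰 f) _ ?_ hx
  intro d x hx
  refine map_comul_mem 𝒰 (LinearMap.mul' K (Sym 𝒰) ∘ₗ
    TensorProduct.map (ι 𝒰 ∘ₗ f ∘ₗ proj 𝒰) LinearMap.id) _ hx ?_
  intro n₁ n₂ d₁ d₂ a b hn hd ha hb
  simp only [LinearMap.comp_apply, TensorProduct.map_tmul, LinearMap.mul'_apply,
    LinearMap.id_apply]
  by_cases h : n₁ = 1
  · have := ι_mul_mem_ofLength 𝒰 (f (proj 𝒰 a)) hb.mem_ofLength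
    rwa [show n₂ + 1 = n by omega] at this
  · simp [ha.proj_eq_zero h]

/-- If `e` is a projector, then the derivation extending `1 - e` counts the letters in the kernel
of `e`. Accordingly, `Sym e` is the projection onto its eigenspace for the eigenvalue zero, along
the sum of the other ones. -/
theorem sub_map_mem_weightGE {e : U →ₗ[K] U} (he : HasDegree 𝒰 𝒰 0 e) (hee : e ∘ₗ e = e)
    (x : Sym 𝒰) : x - map 𝒰 𝒰 e he x ∈ weightGE 𝒰 (der 𝒰 (LinearMap.id - e)) 1 := by
  set D := der 𝒰 (LinearMap.id - e) with hD
  have hp : HasDegree 𝒰 𝒰 0 (LinearMap.id - e) := HasDegree.id.sub he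
  have hee' : ∀ a, e (e a) = e a := LinearMap.congr_fun hee
  have h1 : ∀ k i, ∀ a ∈ 𝒰 i, ∀ z ∈ weightGE 𝒰 D k, ι 𝒰 (e a) * z ∈ weightGE 𝒰 D k := by
    intro k i a ha z hz
    induction hz using Submodule.span_induction with
    | mem z hz =>
      obtain ⟨n, hn, hz⟩ := hz
      refine Submodule.subset_span ⟨n, hn, ?_⟩
      rw [hD, der_ι_mul 𝒰 hp (he.mem ha), ← hD, hz]
      simp [hee']
    | zero => simp
    | add x y _ _ hx hy => rw [mul_add]; exact add_mem hx hy
    | smul r x _ hx => rw [mul_smul_comm]; exact Submodule.smul_mem _ _ hx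
  have h2 : ∀ k i, ∀ a ∈ 𝒰 i, ∀ z ∈ weightGE 𝒰 D k,
      ι 𝒰 (a - e a) * z ∈ weightGE 𝒰 D (k + 1) := by
    intro k i a ha z hz
    induction hz using Submodule.span_induction with
    | mem z hz =>
      obtain ⟨n, hn, hz⟩ := hz
      refine Submodule.subset_span ⟨n + 1, by omega, ?_⟩
      rw [hD, der_ι_mul 𝒰 hp (sub_mem ha (he.mem ha)), ← hD, hz]
      simp [hee', add_smul, add_comm]
    | zero => simp
    | add x y _ _ hx hy => rw [mul_add]; exact add_mem hx hy
    | smul r x _ hx => rw [mul_smul_comm]; exact Submodule.smul_mem _ _ hx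
  have hmono : weightGE 𝒰 D 1 ≤ weightGE 𝒰 D 0 :=
    Submodule.span_mono fun z ⟨n, _, hz⟩ => ⟨n, Nat.zero_le n, hz⟩
  have h3 : ∀ x, x ∈ weightGE 𝒰 D 0 := by
    intro x
    induction x using induction_left with
    | h1 => exact Submodule.subset_span ⟨0, le_rfl, by simp [hD, der_one]⟩
    | h0 => exact Submodule.zero_mem _
    | ha x y hx hy => exact add_mem hx hy
    | hs r x hx => exact Submodule.smul_mem _ _ hx
    | hm i a ha x hx =>
      have := add_mem (h1 0 i a ha x hx) (hmono (h2 0 i a ha x hx))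
      rwa [← add_mul, ← map_add, add_sub_cancel] at this
  induction x using induction_left with
  | h1 => simp
  | h0 => simp
  | ha x y hx hy =>
    rw [map_add, add_sub_add_comm]
    exact add_mem hx hy
  | hs r x hx =>
    rw [map_smul, ← smul_sub]
    exact Submodule.smul_mem _ _ hx
  | hm i a ha x hx =>
    have := add_mem (h1 1 i a ha _ hx) (h2 0 i a ha x (h3 x))
    rw [mul_sub, map_sub, sub_mul] at this
    rw [map_mul, map_ι]
    convert this using 1
    abel

/-- If a projector `e` of a complex is homotopic to the identity, then a cycle of `Sym U` that
`Sym e` sends to a cycle differs from its image by a boundary. -/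
theorem exists_der_eq_sub_map [CharZero K] {d e h : U →ₗ[K] U} (hd : HasDegree 𝒰 𝒰 1 d)
    (hdd : d ∘ₗ d = 0) (he : HasDegree 𝒰 𝒰 0 e) (hee : e ∘ₗ e = e) (hh : HasDegree 𝒰 𝒰 (-1) h)
    (hdh : d ∘ₗ h + h ∘ₗ d = LinearMap.id - e) {n : ℕ} {x : Sym 𝒰} (hx : x ∈ ofLength 𝒰 n)
    (hdx : der 𝒰 d x = 0) (hdex : der 𝒰 d (map 𝒰 𝒰 e he x) = 0) :
    ∃ y ∈ ofLength 𝒰 n, x - map 𝒰 𝒰 e he x = der 𝒰 d y := by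
  obtain ⟨c, hc0, hc⟩ := exists_aeval_eq_zero 𝒰 (sub_map_mem_weightGE 𝒰 he hee x)
  have hz : x - map 𝒰 𝒰 e he x ∈ ofLength 𝒰 n := sub_mem hx (map_mem_ofLength 𝒰 he hx)
  have hdz : der 𝒰 d (x - map 𝒰 𝒰 e he x) = 0 := by rw [map_sub, hdx, hdex, sub_zero]
  generalize x - map 𝒰 𝒰 e he x = z at hc hz hdz
  let δ : Module.End K (Sym 𝒰) := der 𝒰 d
  let η : Module.End K (Sym 𝒰) := der 𝒰 h
  have hδδ : δ * δ = 0 := der_comp_self 𝒰 hd hdd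
  have hD : der 𝒰 (LinearMap.id - e) = δ * η + η * δ := by
    rw [← hdh]
    exact (der_comp_der_add 𝒰 hd hh).symm
  -- Polynomials in `δη + ηδ` commute with `δ` and preserve the length.
  have hpoly : ∀ p : Polynomial K, Commute δ (Polynomial.aeval (δ * η + η * δ) p) ∧
      ∀ y ∈ ofLength 𝒰 n, Polynomial.aeval (δ * η + η * δ) p y ∈ ofLength 𝒰 n := by
    intro p
    induction p using Polynomial.induction_on with
    | C r =>
      rw [Polynomial.aeval_C]
      refine ⟨(Algebra.commutes r δ).symm, fun y hy => ?_⟩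
      rw [Module.algebraMap_end_apply]
      exact Submodule.smul_mem _ _ hy
    | add p q hp hq =>
      rw [map_add]
      exact ⟨hp.1.add_right hq.1, fun y hy => add_mem (hp.2 y hy) (hq.2 y hy)⟩
    | monomial k r hp =>
      rw [pow_succ, ← mul_assoc, map_mul, Polynomial.aeval_X]
      refine ⟨hp.1.mul_right ?_, fun y hy => hp.2 _ ?_⟩
      · rw [Commute, SemiconjBy, mul_add, add_mul, ← mul_assoc, hδδ, zero_mul, zero_add,
          mul_assoc η, hδδ, mul_zero, add_zero, mul_assoc]
      · exact add_mem (der_mem_ofLength 𝒰 _ (der_mem_ofLength 𝒰 _ hy))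
          (der_mem_ofLength 𝒰 _ (der_mem_ofLength 𝒰 _ hy))
  -- The equation `c(δη + ηδ) z = 0` expresses `z` through `(δη + ηδ) z'`, where `z'` is a cycle, since
  -- `c` has a nonzero constant term.
  rw [hD, ← Polynomial.X_mul_divX_add c, map_add, map_mul, Polynomial.aeval_X, Polynomial.aeval_C,
    LinearMap.add_apply, Module.End.mul_apply, Module.algebraMap_end_apply] at hc
  obtain ⟨hcomm, hlen⟩ := hpoly c.divX
  have hzero : δ (Polynomial.aeval (δ * η + η * δ) c.divX z) = 0 := by
    rw [← Module.End.mul_apply, hcomm.eq, Module.End.mul_apply]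
    exact (congrArg _ hdz).trans (map_zero _)
  rw [LinearMap.add_apply, Module.End.mul_apply, Module.End.mul_apply, hzero, map_zero,
    add_zero] at hc
  refine ⟨-(c.coeff 0)⁻¹ • η (Polynomial.aeval (δ * η + η * δ) c.divX z),
    Submodule.smul_mem _ _ (der_mem_ofLength 𝒰 _ (hlen z hz)), ?_⟩
  change z = δ _
  rw [map_smul, eq_neg_of_add_eq_zero_left hc, neg_smul_neg, smul_smul, inv_mul_cancel₀ hc0,
    one_smul]

variable {U' : Type u} [AddCommGroup U'] [Module K U'] {𝒰' : ℤ → Submodule K U'}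
  [DirectSum.Decomposition 𝒰']

/-- The symmetric powers of a quasi-isomorphism `j` are quasi-isomorphisms. This is stated as the
vanishing of the cohomology of the cone of `Sym j`. -/
theorem exists_der_eq_of_map_eq_der [CharZero K] {d : U →ₗ[K] U} {δ : U' →ₗ[K] U'}
    {j : U →ₗ[K] U'} (hd : HasDegree 𝒰 𝒰 1 d) (hdd : d ∘ₗ d = 0) (hδ : HasDegree 𝒰' 𝒰' 1 δ)
    (hδδ : δ ∘ₗ δ = 0) (hj : HasDegree 𝒰 𝒰' 0 j) (hjd : j ∘ₗ d = δ ∘ₗ j)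
    (hinj : ∀ z, d z = 0 → j z ∈ LinearMap.range δ → z ∈ LinearMap.range d)
    (hsurj : ∀ y, δ y = 0 → ∃ z, d z = 0 ∧ y - j z ∈ LinearMap.range δ) {n : ℕ} {x : Sym 𝒰}
    {y : Sym 𝒰'} (hx : x ∈ ofLength 𝒰 n) (hy : y ∈ ofLength 𝒰' n) (hdx : der 𝒰 d x = 0)
    (hxy : map 𝒰 𝒰' j hj x = der 𝒰' δ y) :
    ∃ x' ∈ ofLength 𝒰 n, ∃ y' ∈ ofLength 𝒰' n,
      x = der 𝒰 d x' ∧ y = map 𝒰 𝒰' j hj x' + der 𝒰' δ y' := by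
  obtain ⟨t, h, k, ht, hh, hk, hdt, htδ, e1, e2, hh', hk'⟩ :=
    exists_homotopyInverse hd hdd hδ hδδ hj hjd hinj hsurj
  have hdT : ∀ z, der 𝒰 d (map 𝒰' 𝒰 t ht z) = 0 := by
    intro z
    rw [← map_comp_der 𝒰' 𝒰 ht HasDegree.zero hd (by rw [hdt, LinearMap.comp_zero]), der_zero,
      LinearMap.zero_apply, map_zero]
  have hTδ : ∀ z, map 𝒰' 𝒰 t ht (der 𝒰' δ z) = 0 := by
    intro z
    rw [map_comp_der 𝒰' 𝒰 ht hδ HasDegree.zero (by rw [htδ, LinearMap.zero_comp]), der_zero,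
      LinearMap.zero_apply]
  have hJ : ∀ z, map 𝒰 𝒰' j hj (der 𝒰 d z) = der 𝒰' δ (map 𝒰 𝒰' j hj z) :=
    map_comp_der 𝒰 𝒰' hj hd hδ hjd
  have c1 : ∀ z, map 𝒰 𝒰 (t ∘ₗ j) (ht.comp hj (add_zero 0)) z =
      map 𝒰' 𝒰 t ht (map 𝒰 𝒰' j hj z) := by
    intro z
    rw [← AlgHom.comp_apply]
    congr 1
    apply algHom_ext
    intro a
    simp
  have c2 : ∀ z, map 𝒰' 𝒰' (j ∘ₗ t) (hj.comp ht (add_zero 0)) z =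
      map 𝒰 𝒰' j hj (map 𝒰' 𝒰 t ht z) := by
    intro z
    rw [← AlgHom.comp_apply]
    congr 1
    apply algHom_ext
    intro a
    simp
  obtain ⟨a, ha, hxa⟩ := exists_der_eq_sub_map 𝒰 hd hdd (ht.comp hj (add_zero 0)) e1 hh hh' hx hdx
    (by rw [c1, hdT])
  rw [c1, hxy, hTδ, sub_zero] at hxa
  obtain ⟨b, hb, hyb⟩ := exists_der_eq_sub_map 𝒰' hδ hδδ (hj.comp ht (add_zero 0)) e2 hk hk'
    (sub_mem hy (map_mem_ofLength 𝒰 hj ha)) (by rw [map_sub, ← hxy, ← hJ, ← hxa, sub_self])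
    (by rw [c2, ← hJ, hdT, map_zero])
  rw [c2] at hyb
  refine ⟨a + map 𝒰' 𝒰 t ht (y - map 𝒰 𝒰' j hj a), add_mem ha (map_mem_ofLength 𝒰' ht
    (sub_mem hy (map_mem_ofLength 𝒰 hj ha))), b, hb, ?_, ?_⟩
  · rw [map_add, hdT, add_zero, hxa]
  · rw [← hyb, map_add]
    abel

end Weight

end Sym

end LInf

end

noncomputable section

namespace LInf

namespace Sym

variable {K : Type w} [Field K] {U : Type u} [AddCommGroup U] [Module K U]
  (𝒰 : ℤ → Submodule K U)

/-! ### The filtration by length -/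

section Filtration

/-- The sum of the symmetric powers `⨀ᵏ U` with `1 ≤ k ≤ n`. -/
def fil (n : ℕ) : Submodule K (Sym 𝒰) :=
  Submodule.span K {x | ∃ k d, 1 ≤ k ∧ k ≤ n ∧ IsWord 𝒰 k d x}

theorem fil_mono {m n : ℕ} (h : m ≤ n) : fil 𝒰 m ≤ fil 𝒰 n :=
  Submodule.span_mono fun _ ⟨k, d, h1, h2, hx⟩ => ⟨k, d, h1, h2.trans h, hx⟩

theorem eq_zero_of_mem_fil_zero {x : Sym 𝒰} (hx : x ∈ fil 𝒰 0) : x = 0 := by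
  induction hx using Submodule.span_induction with
  | mem x hx =>
    obtain ⟨k, d, h1, h2, -⟩ := hx
    omega
  | zero => rfl
  | add x y _ _ hx hy => rw [hx, hy, add_zero]
  | smul r x _ hx => rw [hx, smul_zero]

theorem ofLength_le_fil {k n : ℕ} (h1 : 1 ≤ k) (h2 : k ≤ n) : ofLength 𝒰 k ≤ fil 𝒰 n :=
  Submodule.span_mono fun _ ⟨d, hx⟩ => ⟨k, d, h1, h2, hx⟩

theorem exists_add_of_mem_fil {n : ℕ} {x : Sym 𝒰} (hx : x ∈ fil 𝒰 (n + 1)) :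
    ∃ a ∈ ofLength 𝒰 (n + 1), ∃ b ∈ fil 𝒰 n, x = a + b := by
  have h : fil 𝒰 (n + 1) ≤ ofLength 𝒰 (n + 1) ⊔ fil 𝒰 n := by
    refine Submodule.span_le.2 ?_
    rintro y ⟨k, d, h1, h2, hy⟩
    rcases h2.lt_or_eq with h2 | rfl
    · exact Submodule.mem_sup_right (Submodule.subset_span ⟨k, d, h1, by omega, hy⟩)
    · exact Submodule.mem_sup_left hy.mem_ofLength
  obtain ⟨a, ha, b, hb, hab⟩ := Submodule.mem_sup.1 (h hx)
  exact ⟨a, ha, b, hb, hab.symm⟩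

theorem map_mem_of_fil {M : Type*} [AddCommGroup M] [Module K M] (f : Sym 𝒰 →ₗ[K] M)
    (N : Submodule K M) {n : ℕ} (h : ∀ k d x, 1 ≤ k → k ≤ n → IsWord 𝒰 k d x → f x ∈ N)
    {x : Sym 𝒰} (hx : x ∈ fil 𝒰 n) : f x ∈ N := by
  rw [← Submodule.mem_comap]
  refine Submodule.span_le.2 ?_ hx
  rintro y ⟨k, d, h1, h2, hy⟩
  exact h k d y h1 h2 hy

variable [DirectSum.Decomposition 𝒰]

theorem ι_mem_ofLength (a : U) : ι 𝒰 a ∈ ofLength 𝒰 1 := by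
  have := ι_mul_mem_ofLength 𝒰 a (IsWord.mem_ofLength (𝒰 := 𝒰) .one)
  rwa [mul_one] at this

theorem ι_mem_fil (a : U) {n : ℕ} (hn : 1 ≤ n) : ι 𝒰 a ∈ fil 𝒰 n :=
  ofLength_le_fil 𝒰 le_rfl hn (ι_mem_ofLength 𝒰 a)

theorem ι_mul_mem_fil (a : U) {m n : ℕ} (h : m + 1 ≤ n) {x : Sym 𝒰} (hx : x ∈ fil 𝒰 m) :
    ι 𝒰 a * x ∈ fil 𝒰 n := by
  refine map_mem_of_fil 𝒰 (LinearMap.mulLeft K (ι 𝒰 a)) _ ?_ hx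
  intro k d x h1 h2 hx
  exact ofLength_le_fil 𝒰 (by omega) (by omega) (ι_mul_mem_ofLength 𝒰 a hx.mem_ofLength)

theorem exists_mem_fil {x : Sym 𝒰} (hx : counit 𝒰 x = 0) : ∃ n, x ∈ fil 𝒰 n := by
  have h : ∀ y : Sym 𝒰, ∃ n, (toRed 𝒰 y : Sym 𝒰) ∈ fil 𝒰 n := by
    intro y
    induction y using word_induction with
    | hw n d y hy =>
      refine ⟨n, ?_⟩
      rcases Nat.eq_zero_or_pos n with rfl | hn
      · simp [hy.eq_one]
      · rw [coe_toRed, hy.counit_eq_zero (by omega), map_zero, sub_zero]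
        exact Submodule.subset_span ⟨n, d, hn, le_rfl, hy⟩
    | h0 => exact ⟨0, by simp⟩
    | ha x y hx hy =>
      obtain ⟨m, hm⟩ := hx
      obtain ⟨n, hn⟩ := hy
      refine ⟨m + n, ?_⟩
      rw [map_add]
      exact add_mem (fil_mono 𝒰 (by omega) hm) (fil_mono 𝒰 (by omega) hn)
    | hs r x hx =>
      obtain ⟨n, hn⟩ := hx
      exact ⟨n, by rw [map_smul]; exact Submodule.smul_mem _ _ hn⟩
  obtain ⟨n, hn⟩ := h x
  rw [coe_toRed, hx, map_zero, sub_zero] at hn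
  exact ⟨n, hn⟩

theorem euler_isWord {n : ℕ} {d : ℤ} {x : Sym 𝒰} (hx : IsWord 𝒰 n d x) :
    euler 𝒰 x = (n : K) • x := by
  induction hx with
  | one => simp [euler_one]
  | ι_mul ha _ ih => rw [euler_ι_mul 𝒰 ha, ih]; simp [add_smul, add_comm]

theorem euler_ofLength {n : ℕ} {x : Sym 𝒰} (hx : x ∈ ofLength 𝒰 n) :
    euler 𝒰 x = (n : K) • x := by
  have := map_mem_of_ofLength 𝒰 (euler 𝒰 - (n : K) • LinearMap.id) ⊥
    (fun d x hx => by simp [euler_isWord 𝒰 hx]) hx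
  simpa [sub_eq_zero] using this

theorem euler_mem_fil {n : ℕ} {x : Sym 𝒰} (hx : x ∈ fil 𝒰 n) : euler 𝒰 x ∈ fil 𝒰 n := by
  refine map_mem_of_fil 𝒰 (euler 𝒰) _ ?_ hx
  intro k d x h1 h2 hx
  rw [euler_isWord 𝒰 hx]
  exact Submodule.smul_mem _ _ (Submodule.subset_span ⟨k, d, h1, h2, hx⟩)

theorem mem_fil_of_euler_mem_fil [CharZero K] {n : ℕ} {x : Sym 𝒰} (hx : counit 𝒰 x = 0)
    (h : euler 𝒰 x ∈ fil 𝒰 n) : x ∈ fil 𝒰 n := by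
  obtain ⟨m, hm⟩ := exists_mem_fil 𝒰 hx
  have key : ∀ k, x ∈ fil 𝒰 (n + k) → x ∈ fil 𝒰 n := by
    intro k
    induction k with
    | zero => exact id
    | succ k ih =>
      intro hk
      apply ih
      obtain ⟨a, ha, b, hb, rfl⟩ := exists_add_of_mem_fil 𝒰 hk
      have h1 := sub_mem (fil_mono 𝒰 (Nat.le_add_right n k) h) (euler_mem_fil 𝒰 hb)
      rw [map_add, add_sub_cancel_right, euler_ofLength 𝒰 ha] at h1
      refine add_mem ?_ hb
      rwa [Submodule.smul_mem_iff _ (Nat.cast_ne_zero.2 (by omega))] at h1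
  exact key m (fil_mono 𝒰 (by omega) hm)

theorem eq_zero_of_mem_ofLength_of_mem_fil [CharZero K] {m n : ℕ} (h : m < n) {x : Sym 𝒰}
    (hx : x ∈ ofLength 𝒰 n) (hx' : x ∈ fil 𝒰 m) : x = 0 := by
  induction m with
  | zero => exact eq_zero_of_mem_fil_zero 𝒰 hx'
  | succ m ih =>
    refine ih (by omega) ?_
    obtain ⟨a, ha, b, hb, hab⟩ := exists_add_of_mem_fil 𝒰 hx'
    have h1 : ((n : K) - (m + 1 : ℕ)) • x = euler 𝒰 b - ((m + 1 : ℕ) : K) • b := by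
      rw [sub_smul, ← euler_ofLength 𝒰 hx, hab, map_add, euler_ofLength 𝒰 ha, smul_add]
      abel
    have h2 := sub_mem (euler_mem_fil 𝒰 hb) (Submodule.smul_mem _ ((m + 1 : ℕ) : K) hb)
    rw [← h1] at h2
    rwa [Submodule.smul_mem_iff _ (by rw [sub_ne_zero, Nat.cast_injective.ne_iff]; omega)] at h2

/-! ### Leading terms of coderivations and coalgebra morphisms -/

theorem coderiv_ι {q : Sym 𝒰 →ₗ[K] U} (hq : q 1 = 0) (a : U) :
    coderiv 𝒰 q (ι 𝒰 a) = ι 𝒰 (q (ι 𝒰 a)) := by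
  simp [coderiv, comul_ι, hq]

/-- A coderivation agrees with the derivation extending its linear part, up to terms of smaller
length. -/
theorem coderiv_sub_der_mem_fil {q : Sym 𝒰 →ₗ[K] U} (hq : q 1 = 0) {n : ℕ} {d : ℤ} {x : Sym 𝒰}
    (hx : IsWord 𝒰 n d x) :
    coderiv 𝒰 q x - der 𝒰 (q ∘ₗ ι 𝒰) x ∈ fil 𝒰 (n - 1) := by
  rw [der, ← LinearMap.sub_apply, ← coderiv_sub]
  set q' := q - (q ∘ₗ ι 𝒰) ∘ₗ proj 𝒰 with hq'
  have h0 : q' 1 = 0 := by simp [hq', hq, proj_one]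
  have h1 : ∀ a, q' (ι 𝒰 a) = 0 := by simp [hq']
  refine map_comul_mem 𝒰 (LinearMap.mul' K (Sym 𝒰) ∘ₗ
    TensorProduct.map (ι 𝒰 ∘ₗ q') LinearMap.id) _ hx ?_
  intro n₁ n₂ d₁ d₂ a b hn hd ha hb
  simp only [LinearMap.comp_apply, TensorProduct.map_tmul, LinearMap.mul'_apply,
    LinearMap.id_apply]
  match n₁, ha with
  | 0, ha => simp [ha.eq_one, h0]
  | 1, ha =>
    obtain ⟨u, rfl⟩ := ha.exists_eq_ι
    simp [h1]
  | k + 2, ha =>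
    exact ofLength_le_fil 𝒰 (by omega) (by omega) (ι_mul_mem_ofLength 𝒰 (q' a) hb.mem_ofLength)

theorem coderiv_sub_der_mem_fil_of_mem_fil {q : Sym 𝒰 →ₗ[K] U} (hq : q 1 = 0) {n : ℕ} {x : Sym 𝒰}
    (hx : x ∈ fil 𝒰 (n + 1)) : coderiv 𝒰 q x - der 𝒰 (q ∘ₗ ι 𝒰) x ∈ fil 𝒰 n := by
  refine map_mem_of_fil 𝒰 (coderiv 𝒰 q - der 𝒰 (q ∘ₗ ι 𝒰)) _ ?_ hx
  intro k d x h1 h2 hx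
  exact fil_mono 𝒰 (by omega) (coderiv_sub_der_mem_fil 𝒰 hq hx)

theorem coderiv_mem_fil {q : Sym 𝒰 →ₗ[K] U} (hq : q 1 = 0) {n : ℕ} {x : Sym 𝒰}
    (hx : x ∈ fil 𝒰 n) : coderiv 𝒰 q x ∈ fil 𝒰 n := by
  have h1 := coderiv_sub_der_mem_fil_of_mem_fil 𝒰 hq (fil_mono 𝒰 (Nat.le_succ n) hx)
  have h2 : der 𝒰 (q ∘ₗ ι 𝒰) x ∈ fil 𝒰 n :=
    map_mem_of_fil 𝒰 (der 𝒰 (q ∘ₗ ι 𝒰)) _ (fun k d x h1 h2 hx =>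
      ofLength_le_fil 𝒰 h1 h2 (der_mem_ofLength 𝒰 _ hx.mem_ofLength)) hx
  have := add_mem h1 h2
  rwa [sub_add_cancel] at this

variable {U' : Type u} [AddCommGroup U'] [Module K U'] (𝒰' : ℤ → Submodule K U')

theorem proj_map {f : U →ₗ[K] U'} (hf : HasDegree 𝒰 𝒰' 0 f) (x : Sym 𝒰) :
    proj 𝒰' (map 𝒰 𝒰' f hf x) = f (proj 𝒰 x) := by
  have : proj 𝒰' ∘ₗ (map 𝒰 𝒰' f hf).toLinearMap = f ∘ₗ proj 𝒰 := by
    apply ext_word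
    intro n d x hx
    simp only [LinearMap.comp_apply, AlgHom.toLinearMap_apply]
    by_cases hn : n = 1
    · subst hn
      obtain ⟨a, rfl⟩ := hx.exists_eq_ι
      simp
    · rw [hx.proj_eq_zero hn, (map_isWord 𝒰 𝒰' hf hx).proj_eq_zero hn, map_zero]
  exact LinearMap.congr_fun this x

variable [DirectSum.Decomposition 𝒰']

/-- Morphisms of graded symmetric coalgebras that respect the unit. -/
structure IsCoalgHom (Φ : Sym 𝒰 →ₗ[K] Sym 𝒰') : Prop where
  map_one : Φ 1 = 1
  counit_apply : ∀ x, counit 𝒰' (Φ x) = counit 𝒰 x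
  comul_apply : ∀ x, comul 𝒰' (Φ x) = TensorProduct.map Φ Φ (comul 𝒰 x)

theorem isCoalgHom_map {f : U →ₗ[K] U'} (hf : HasDegree 𝒰 𝒰' 0 f) :
    IsCoalgHom 𝒰 𝒰' (map 𝒰 𝒰' f hf).toLinearMap where
  map_one := by simp
  counit_apply x := by
    have : (counit 𝒰').comp (map 𝒰 𝒰' f hf) = counit 𝒰 := algHom_ext 𝒰 (by simp)
    exact DFunLike.congr_fun this x
  comul_apply x := by
    induction x using induction_left with
    | h1 => simp [comul_one]
    | h0 => simp
    | ha x y hx hy => simp only [map_add, hx, hy]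
    | hs r x hx => simp only [map_smul, hx]
    | hm i a ha x hx =>
      rw [AlgHom.toLinearMap_apply] at hx ⊢
      rw [map_mul, map_ι, comul_ι_mul_eq 𝒰' (hf.mem ha), hx, comul_ι_mul_eq 𝒰 ha, map_add]
      congr 1
      · have : TensorProduct.map (LinearMap.mulLeft K (ι 𝒰' (f a))) LinearMap.id ∘ₗ
            TensorProduct.map (map 𝒰 𝒰' f hf).toLinearMap (map 𝒰 𝒰' f hf).toLinearMap =
            TensorProduct.map (map 𝒰 𝒰' f hf).toLinearMap (map 𝒰 𝒰' f hf).toLinearMap ∘ₗ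
              TensorProduct.map (LinearMap.mulLeft K (ι 𝒰 a)) LinearMap.id := by
          ext b c
          simp
        exact LinearMap.congr_fun this _
      · have : TensorProduct.map (twist (deg 𝒰') i) (LinearMap.mulLeft K (ι 𝒰' (f a))) ∘ₗ
            TensorProduct.map (map 𝒰 𝒰' f hf).toLinearMap (map 𝒰 𝒰' f hf).toLinearMap =
            TensorProduct.map (map 𝒰 𝒰' f hf).toLinearMap (map 𝒰 𝒰' f hf).toLinearMap ∘ₗ
              TensorProduct.map (twist (deg 𝒰) i) (LinearMap.mulLeft K (ι 𝒰 a)) := by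
          have h := twist_comp_of_hasDegree (deg 𝒰) (hasDegree_map 𝒰 𝒰' hf) i
          rw [koszul_zero_right, one_smul] at h
          rw [← TensorProduct.map_comp, ← TensorProduct.map_comp, h]
          congr 1
          ext c
          simp
        exact LinearMap.congr_fun this _

variable {𝒰 𝒰'}

/-- A coalgebra morphism `Φ` is determined by `proj ∘ Φ`, since the Euler operator is invertible
in positive length. -/
theorem IsCoalgHom.euler_apply {Φ : Sym 𝒰 →ₗ[K] Sym 𝒰'} (hΦ : IsCoalgHom 𝒰 𝒰' Φ) (x : Sym 𝒰) :
    euler 𝒰' (Φ x) = LinearMap.mul' K (Sym 𝒰')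
      (TensorProduct.map (ι 𝒰' ∘ₗ proj 𝒰' ∘ₗ Φ) Φ (comul 𝒰 x)) := by
  simp only [euler, LinearMap.comp_apply, hΦ.comul_apply]
  rw [← LinearMap.comp_apply (TensorProduct.map _ _), ← TensorProduct.map_comp]
  rfl

theorem IsCoalgHom.mem_fil [CharZero K] {Φ : Sym 𝒰 →ₗ[K] Sym 𝒰'} (hΦ : IsCoalgHom 𝒰 𝒰' Φ) {n : ℕ}
    {d : ℤ} {x : Sym 𝒰} (hn : 1 ≤ n) (hx : IsWord 𝒰 n d x) : Φ x ∈ fil 𝒰' n := by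
  induction n using Nat.strong_induction_on generalizing d x with
  | _ n ih =>
    refine mem_fil_of_euler_mem_fil 𝒰' ?_ ?_
    · rw [hΦ.counit_apply, hx.counit_eq_zero (by omega)]
    · rw [hΦ.euler_apply]
      refine map_comul_mem 𝒰 (LinearMap.mul' K (Sym 𝒰') ∘ₗ
        TensorProduct.map (ι 𝒰' ∘ₗ proj 𝒰' ∘ₗ Φ) Φ) _ hx ?_
      intro n₁ n₂ d₁ d₂ a b hn' hd ha hb
      simp only [LinearMap.comp_apply, TensorProduct.map_tmul, LinearMap.mul'_apply]
      rcases Nat.eq_zero_or_pos n₁ with rfl | h1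
      · simp [ha.eq_one, hΦ.map_one, proj_one]
      rcases Nat.eq_zero_or_pos n₂ with rfl | h2
      · rw [hb.eq_one, hΦ.map_one, mul_one]
        exact ι_mem_fil 𝒰' _ hn
      · exact ι_mul_mem_fil 𝒰' _ (by omega) (ih n₂ (by omega) h2 hb)

/-- A coalgebra morphism agrees with the algebra morphism extending its linear part, up to terms of
smaller length. -/
theorem IsCoalgHom.sub_map_mem_fil [CharZero K] {Φ : Sym 𝒰 →ₗ[K] Sym 𝒰'}
    (hΦ : IsCoalgHom 𝒰 𝒰' Φ) {f : U →ₗ[K] U'} (hf : HasDegree 𝒰 𝒰' 0 f)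
    (hf' : ∀ a, proj 𝒰' (Φ (ι 𝒰 a)) = f a) {n : ℕ} {d : ℤ} {x : Sym 𝒰} (hx : IsWord 𝒰 n d x) :
    Φ x - map 𝒰 𝒰' f hf x ∈ fil 𝒰' (n - 1) := by
  induction n using Nat.strong_induction_on generalizing d x with
  | _ n ih =>
    rcases Nat.eq_zero_or_pos n with rfl | hn
    · simp [hx.eq_one, hΦ.map_one]
    have hΨ := isCoalgHom_map 𝒰 𝒰' hf
    refine mem_fil_of_euler_mem_fil 𝒰' ?_ ?_
    · have h := hΨ.counit_apply x
      rw [AlgHom.toLinearMap_apply] at h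
      rw [map_sub, hΦ.counit_apply, h, sub_self]
    · have h := hΨ.euler_apply x
      rw [AlgHom.toLinearMap_apply] at h
      rw [map_sub, hΦ.euler_apply, h]
      refine map_comul_mem 𝒰 (LinearMap.mul' K (Sym 𝒰') ∘ₗ
        TensorProduct.map (ι 𝒰' ∘ₗ proj 𝒰' ∘ₗ Φ) Φ - LinearMap.mul' K (Sym 𝒰') ∘ₗ
        TensorProduct.map (ι 𝒰' ∘ₗ proj 𝒰' ∘ₗ (map 𝒰 𝒰' f hf).toLinearMap)
          (map 𝒰 𝒰' f hf).toLinearMap) _ hx ?_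
      intro n₁ n₂ d₁ d₂ a b hn' hd ha hb
      simp only [LinearMap.sub_apply, LinearMap.comp_apply, TensorProduct.map_tmul,
        LinearMap.mul'_apply, AlgHom.toLinearMap_apply, proj_map]
      match n₁, ha with
      | 0, ha => simp [ha.eq_one, hΦ.map_one, proj_one]
      | 1, ha =>
        obtain ⟨u, rfl⟩ := ha.exists_eq_ι
        rw [hf', proj_ι, ← mul_sub]
        rcases Nat.eq_zero_or_pos n₂ with rfl | h2
        · simp [hb.eq_one, hΦ.map_one]
        · exact ι_mul_mem_fil 𝒰' _ (by omega) (ih n₂ (by omega) hb)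
      | k + 2, ha =>
        rw [ha.proj_eq_zero (by omega), map_zero, map_zero, zero_mul, sub_zero]
        rcases Nat.eq_zero_or_pos n₂ with rfl | h2
        · rw [hb.eq_one, hΦ.map_one, mul_one]
          exact ι_mem_fil 𝒰' _ (by omega)
        · exact ι_mul_mem_fil 𝒰' _ (by omega) (hΦ.mem_fil h2 hb)

theorem IsCoalgHom.sub_map_mem_fil_of_mem_fil [CharZero K] {Φ : Sym 𝒰 →ₗ[K] Sym 𝒰'}
    (hΦ : IsCoalgHom 𝒰 𝒰' Φ) {f : U →ₗ[K] U'} (hf : HasDegree 𝒰 𝒰' 0 f)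
    (hf' : ∀ a, proj 𝒰' (Φ (ι 𝒰 a)) = f a) {n : ℕ} {x : Sym 𝒰} (hx : x ∈ fil 𝒰 (n + 1)) :
    Φ x - map 𝒰 𝒰' f hf x ∈ fil 𝒰' n := by
  refine map_mem_of_fil 𝒰 (Φ - (map 𝒰 𝒰' f hf).toLinearMap) _ ?_ hx
  intro k d x h1 h2 hx
  exact fil_mono 𝒰' (by omega) (hΦ.sub_map_mem_fil hf hf' hx)

theorem IsCoalgHom.mem_fil_of_mem_fil [CharZero K] {Φ : Sym 𝒰 →ₗ[K] Sym 𝒰'}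
    (hΦ : IsCoalgHom 𝒰 𝒰' Φ) {n : ℕ} {x : Sym 𝒰} (hx : x ∈ fil 𝒰 n) : Φ x ∈ fil 𝒰' n :=
  map_mem_of_fil 𝒰 Φ _ (fun _ _ _ h1 h2 hx => fil_mono 𝒰' h2 (hΦ.mem_fil h1 hx)) hx

/-- A morphism of differential graded symmetric coalgebras whose linear part is a quasi-isomorphism
is injective in cohomology: the cone of `Φ` is filtered by length, and the cones on the associated
graded pieces are acyclic by `exists_der_eq_of_map_eq_der`. -/
theorem IsCoalgHom.mem_range_coderiv [CharZero K] {Φ : Sym 𝒰 →ₗ[K] Sym 𝒰'}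
    (hΦ : IsCoalgHom 𝒰 𝒰' Φ) {f : U →ₗ[K] U'} (hf : HasDegree 𝒰 𝒰' 0 f)
    (hf' : ∀ a, proj 𝒰' (Φ (ι 𝒰 a)) = f a) {q : Sym 𝒰 →ₗ[K] U} {q' : Sym 𝒰' →ₗ[K] U'}
    (hq : HasDegree (deg 𝒰) 𝒰 1 q) (hq' : HasDegree (deg 𝒰') 𝒰' 1 q') (hq1 : q 1 = 0)
    (hq1' : q' 1 = 0) (hqq : coderiv 𝒰 q ∘ₗ coderiv 𝒰 q = 0)
    (hqq' : coderiv 𝒰' q' ∘ₗ coderiv 𝒰' q' = 0)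
    (hΦq : Φ ∘ₗ coderiv 𝒰 q = coderiv 𝒰' q' ∘ₗ Φ)
    (hfq : f ∘ₗ (q ∘ₗ ι 𝒰) = (q' ∘ₗ ι 𝒰') ∘ₗ f)
    (hinj : ∀ z, (q ∘ₗ ι 𝒰) z = 0 → f z ∈ LinearMap.range (q' ∘ₗ ι 𝒰') →
      z ∈ LinearMap.range (q ∘ₗ ι 𝒰))
    (hsurj : ∀ y, (q' ∘ₗ ι 𝒰') y = 0 →
      ∃ z, (q ∘ₗ ι 𝒰) z = 0 ∧ y - f z ∈ LinearMap.range (q' ∘ₗ ι 𝒰'))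
    {n : ℕ} {x : Sym 𝒰} {y : Sym 𝒰'} (hx : x ∈ fil 𝒰 n) (hy : y ∈ fil 𝒰' n)
    (hqx : coderiv 𝒰 q x = 0) (hxy : Φ x = coderiv 𝒰' q' y) :
    x ∈ LinearMap.range (coderiv 𝒰 q) := by
  have hqq₀ : ∀ x, coderiv 𝒰 q (coderiv 𝒰 q x) = 0 := LinearMap.congr_fun hqq
  have hqq₀' : ∀ x, coderiv 𝒰' q' (coderiv 𝒰' q' x) = 0 := LinearMap.congr_fun hqq'
  have hΦq₀ : ∀ x, Φ (coderiv 𝒰 q x) = coderiv 𝒰' q' (Φ x) := LinearMap.congr_fun hΦq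
  have hd : HasDegree 𝒰 𝒰 1 (q ∘ₗ ι 𝒰) := fun _ _ ha => hq _ _ (ι_mem_deg 𝒰 ha)
  have hd' : HasDegree 𝒰' 𝒰' 1 (q' ∘ₗ ι 𝒰') := fun _ _ ha => hq' _ _ (ι_mem_deg 𝒰' ha)
  have hdd : (q ∘ₗ ι 𝒰) ∘ₗ (q ∘ₗ ι 𝒰) = 0 := by
    ext a
    have := congrArg (proj 𝒰) (hqq₀ (ι 𝒰 a))
    rwa [coderiv_ι 𝒰 hq1, coderiv_ι 𝒰 hq1, proj_ι, map_zero] at this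
  have hdd' : (q' ∘ₗ ι 𝒰') ∘ₗ (q' ∘ₗ ι 𝒰') = 0 := by
    ext a
    have := congrArg (proj 𝒰') (hqq₀' (ι 𝒰' a))
    rwa [coderiv_ι 𝒰' hq1', coderiv_ι 𝒰' hq1', proj_ι, map_zero] at this
  induction n generalizing x y with
  | zero =>
    rw [eq_zero_of_mem_fil_zero 𝒰 hx]
    exact Submodule.zero_mem _
  | succ n ih =>
    obtain ⟨a, ha, x₁, hx₁, rfl⟩ := exists_add_of_mem_fil 𝒰 hx
    obtain ⟨b, hb, y₁, hy₁, rfl⟩ := exists_add_of_mem_fil 𝒰' hy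
    have lead : ∀ z ∈ ofLength 𝒰 (n + 1),
        coderiv 𝒰 q z - der 𝒰 (q ∘ₗ ι 𝒰) z ∈ fil 𝒰 n := fun z hz =>
      coderiv_sub_der_mem_fil_of_mem_fil 𝒰 hq1 (ofLength_le_fil 𝒰 (by omega) le_rfl hz)
    have lead' : ∀ z ∈ ofLength 𝒰' (n + 1),
        coderiv 𝒰' q' z - der 𝒰' (q' ∘ₗ ι 𝒰') z ∈ fil 𝒰' n := fun z hz =>
      coderiv_sub_der_mem_fil_of_mem_fil 𝒰' hq1' (ofLength_le_fil 𝒰' (by omega) le_rfl hz)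
    have leadΦ : ∀ z ∈ ofLength 𝒰 (n + 1), Φ z - map 𝒰 𝒰' f hf z ∈ fil 𝒰' n := fun z hz =>
      hΦ.sub_map_mem_fil_of_mem_fil hf hf' (ofLength_le_fil 𝒰 (by omega) le_rfl hz)
    -- The leading terms `a` and `b` of `x` and `y` form a cycle of the cone on the graded piece, so
    -- a boundary. Subtracting the corresponding boundary of the cone of `Φ` shortens `x` and `y`.
    have hda : der 𝒰 (q ∘ₗ ι 𝒰) a = 0 := by
      refine eq_zero_of_mem_ofLength_of_mem_fil 𝒰 (Nat.lt_succ_self n) (der_mem_ofLength 𝒰 _ ha) ?_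
      have := neg_mem (add_mem (lead a ha) (coderiv_mem_fil 𝒰 hq1 hx₁))
      convert this using 1
      rw [map_add] at hqx
      rw [eq_neg_of_add_eq_zero_right hqx]
      abel
    have hab : map 𝒰 𝒰' f hf a = der 𝒰' (q' ∘ₗ ι 𝒰') b := by
      rw [← sub_eq_zero]
      refine eq_zero_of_mem_ofLength_of_mem_fil 𝒰' (Nat.lt_succ_self n)
        (sub_mem (map_mem_ofLength 𝒰 hf ha) (der_mem_ofLength 𝒰' _ hb)) ?_
      have h1 := sub_mem (lead' b hb) (leadΦ a ha)
      have h2 := sub_mem (coderiv_mem_fil 𝒰' hq1' hy₁) (hΦ.mem_fil_of_mem_fil hx₁)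
      convert add_mem h1 h2 using 1
      rw [map_add, map_add] at hxy
      rw [eq_sub_of_add_eq hxy]
      abel
    obtain ⟨a', ha', b', hb', rfl, rfl⟩ :=
      exists_der_eq_of_map_eq_der 𝒰 hd hdd hd' hdd' hf hfq hinj hsurj ha hb hda hab
    obtain ⟨z, hz⟩ := ih (x := der 𝒰 (q ∘ₗ ι 𝒰) a' + x₁ - coderiv 𝒰 q a')
      (y := map 𝒰 𝒰' f hf a' + der 𝒰' (q' ∘ₗ ι 𝒰') b' + y₁ - Φ a' - coderiv 𝒰' q' b')
      (by
        convert sub_mem hx₁ (lead a' ha') using 1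
        abel)
      (by
        convert sub_mem (sub_mem hy₁ (leadΦ a' ha')) (lead' b' hb') using 1
        abel)
      (by rw [map_sub, hqx, hqq₀, sub_zero])
      (by rw [map_sub, map_sub _ _ (coderiv 𝒰' q' b'), map_sub _ _ (Φ a'), ← hxy, hqq₀', hΦq₀,
        sub_zero])
    exact ⟨z + a', by rw [map_add, hz, sub_add_cancel]⟩

end Filtration

end Sym

/-! ### Unital extensions of `L∞`-morphisms -/

section Unital

variable {K : Type w} [Field K]

namespace Sym

variable {U : Type u} [AddCommGroup U] [Module K U] (𝒰 : ℤ → Submodule K U)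
  [DirectSum.Decomposition 𝒰]

/-- The coproduct is the sum of the reduced coproduct and of trivial terms. -/
theorem comul_eq_add_map_toRed (x : Sym 𝒰) :
    comul 𝒰 x = x ⊗ₜ 1 + 1 ⊗ₜ x - counit 𝒰 x • 1 ⊗ₜ 1 +
      TensorProduct.map ((Red 𝒰).subtype ∘ₗ toRed 𝒰) ((Red 𝒰).subtype ∘ₗ toRed 𝒰)
        (comul 𝒰 x) := by
  let η : Sym 𝒰 →ₗ[K] Sym 𝒰 := Algebra.linearMap K (Sym 𝒰) ∘ₗ (counit 𝒰).toLinearMap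
  let μ := LinearMap.mul' K (Sym 𝒰)
  let l : Sym 𝒰 →ₗ[K] Sym 𝒰 ⊗[K] Sym 𝒰 := (TensorProduct.mk K _ _).flip 1
  let r : Sym 𝒰 →ₗ[K] Sym 𝒰 ⊗[K] Sym 𝒰 := TensorProduct.mk K _ _ 1
  have h : LinearMap.id = l ∘ₗ μ ∘ₗ TensorProduct.map LinearMap.id η +
      r ∘ₗ μ ∘ₗ TensorProduct.map η LinearMap.id -
      (l ∘ₗ Algebra.linearMap K (Sym 𝒰)) ∘ₗ (counit 𝒰).toLinearMap ∘ₗ μ ∘ₗ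
        TensorProduct.map LinearMap.id η +
      TensorProduct.map ((Red 𝒰).subtype ∘ₗ toRed 𝒰) ((Red 𝒰).subtype ∘ₗ toRed 𝒰) := by
    ext a b
    simp [l, r, μ, η, coe_toRed, Algebra.algebraMap_eq_smul_one, TensorProduct.sub_tmul,
      TensorProduct.tmul_sub, TensorProduct.smul_tmul', TensorProduct.tmul_smul]
    simp only [← TensorProduct.smul_tmul']
    module
  have h' := LinearMap.congr_fun h (comul 𝒰 x)
  simp only [LinearMap.add_apply, LinearMap.sub_apply, LinearMap.comp_apply, LinearMap.id_apply,
    μ, η, comul_counit, counit_comul] at h'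
  refine h'.trans ?_
  congr 2
  simp [l, Algebra.algebraMap_eq_smul_one, TensorProduct.smul_tmul']

end Sym

variable {V W : LInftyAlgebra.{w, u} K} (φ : LInftyHom V W)

/-- The Taylor coefficients of an `L∞`-algebra, extended by zero to the scalars `⨀⁰ V[1]`. -/
def LInftyAlgebra.taylor (V : LInftyAlgebra.{w, u} K) : Sym V.grading₁ →ₗ[K] V.carrier :=
  V.q ∘ₗ Sym.toRed V.grading₁

/-- The codifferential, extended by zero to the scalars `⨀⁰ V[1]`. -/
def LInftyAlgebra.codiff (V : LInftyAlgebra.{w, u} K) :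
    Sym V.grading₁ →ₗ[K] Sym V.grading₁ :=
  Sym.coderiv V.grading₁ V.taylor

namespace LInftyAlgebra

variable (V : LInftyAlgebra.{w, u} K)

theorem taylor_one : V.taylor 1 = 0 := by simp [taylor]

theorem taylor_comp_ι : V.taylor ∘ₗ Sym.ι V.grading₁ = V.q₁ := by
  ext a
  have h : Sym.toRed V.grading₁ (Sym.ι V.grading₁ a) = Sym.ιRed V.grading₁ a :=
    Sym.toRed_coe V.grading₁ (Sym.ιRed V.grading₁ a)
  simp [taylor, q₁, h]

theorem hasDegree_taylor : HasDegree (Sym.deg V.grading₁) V.grading₁ 1 V.taylor := by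
  apply Sym.hasDegree_of_isWord
  intro n d x hx
  rcases Nat.eq_zero_or_pos n with rfl | hn
  · simp [hx.eq_one, taylor_one]
  · refine V.q_mem d _ ?_
    rw [Sym.coe_toRed, hx.counit_eq_zero (by omega), map_zero, sub_zero]
    exact hx.mem_deg

theorem codiff_one : V.codiff 1 = 0 := by
  simp [codiff, Sym.coderiv_one, taylor_one]

theorem codiff_eq (x : Sym V.grading₁) :
    V.codiff x = (V.Q (Sym.toRed V.grading₁ x) : Sym V.grading₁) := by
  rw [Q, Sym.coe_coder_eq, Sym.coe_toRed, map_sub]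
  change _ = V.codiff x - V.codiff _
  rw [Algebra.algebraMap_eq_smul_one, map_smul, codiff_one, smul_zero, sub_zero]

theorem toRed_codiff (x : Sym V.grading₁) :
    Sym.toRed V.grading₁ (V.codiff x) = V.Q (Sym.toRed V.grading₁ x) := by
  rw [codiff_eq, Sym.toRed_coe]

theorem codiff_comp_codiff : V.codiff ∘ₗ V.codiff = 0 := by
  ext x
  have h := LinearMap.congr_fun V.Q_comp_Q (Sym.toRed V.grading₁ x)
  rw [LinearMap.comp_apply, codiff_eq, toRed_codiff]
  exact congrArg Subtype.val h

end LInftyAlgebra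

namespace LInftyHom

/-- The extension of an `L∞`-morphism to a morphism of the unreduced symmetric coalgebras. -/
def unital : Sym V.grading₁ →ₗ[K] Sym W.grading₁ :=
  Algebra.linearMap K (Sym W.grading₁) ∘ₗ (Sym.counit V.grading₁).toLinearMap +
    (Sym.Red W.grading₁).subtype ∘ₗ φ.F ∘ₗ Sym.toRed V.grading₁

theorem unital_apply (x : Sym V.grading₁) :
    φ.unital x = Sym.counit V.grading₁ x • 1 + (φ.F (Sym.toRed V.grading₁ x) : Sym W.grading₁) := by
  rw [← Algebra.algebraMap_eq_smul_one]
  rfl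

theorem toRed_unital (x : Sym V.grading₁) :
    Sym.toRed W.grading₁ (φ.unital x) = φ.F (Sym.toRed V.grading₁ x) := by
  rw [unital_apply, map_add, map_smul, Sym.toRed_one, smul_zero, zero_add, Sym.toRed_coe]

theorem unital_comp_codiff : φ.unital ∘ₗ V.codiff = W.codiff ∘ₗ φ.unital := by
  ext x
  have h := LinearMap.congr_fun φ.F_comp_Q (Sym.toRed V.grading₁ x)
  have h0 : Sym.counit V.grading₁ (V.codiff x) = 0 := Sym.counit_coderiv _ _ _
  rw [LinearMap.comp_apply, LinearMap.comp_apply, unital_apply, V.toRed_codiff, W.codiff_eq,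
    toRed_unital, h0, zero_smul, zero_add]
  exact congrArg Subtype.val h

theorem isCoalgHom_unital : Sym.IsCoalgHom V.grading₁ W.grading₁ φ.unital where
  map_one := by simp [unital_apply]
  counit_apply x := by
    have h : Sym.counit W.grading₁ (φ.F (Sym.toRed V.grading₁ x) : Sym W.grading₁) = 0 :=
      (φ.F (Sym.toRed V.grading₁ x)).2
    simp [unital_apply, h]
  comul_apply x := by
    have h1 : φ.unital 1 = 1 := by simp [unital_apply]
    have hc : Sym.counit W.grading₁ (φ.unital x) = Sym.counit V.grading₁ x := by
      have h : Sym.counit W.grading₁ (φ.F (Sym.toRed V.grading₁ x) : Sym W.grading₁) = 0 :=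
        (φ.F (Sym.toRed V.grading₁ x)).2
      simp [unital_apply, h]
    have hr : ∀ y : V.Coalg, φ.unital (y : Sym V.grading₁) = (φ.F y : Sym W.grading₁) := by
      intro y
      have h : Sym.counit V.grading₁ (y : Sym V.grading₁) = 0 := y.2
      rw [unital_apply, h, zero_smul, zero_add, Sym.toRed_coe]
    -- The reduced coproduct only depends on the reduced part of an element.
    have hred : ∀ (U : LInftyAlgebra.{w, u} K) (y : Sym U.grading₁),
        TensorProduct.map (Sym.toRed U.grading₁) (Sym.toRed U.grading₁)
          (Sym.comul U.grading₁ y) = Sym.comulRed U.grading₁ (Sym.toRed U.grading₁ y) := by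
      intro U y
      simp only [Sym.comulRed, LinearMap.comp_apply, Submodule.subtype_apply, Sym.coe_toRed,
        map_sub, Algebra.algebraMap_eq_smul_one, map_smul, Sym.comul_one, TensorProduct.map_tmul,
        Sym.toRed_one, TensorProduct.tmul_zero, smul_zero]
      exact (sub_zero (G := Sym.Red U.grading₁ ⊗[K] Sym.Red U.grading₁) _).symm
    rw [Sym.comul_eq_add_map_toRed W.grading₁, Sym.comul_eq_add_map_toRed V.grading₁ x, hc]
    simp only [map_add, map_sub, map_smul, TensorProduct.map_tmul, h1]
    congr 1
    rw [TensorProduct.map_comp, LinearMap.comp_apply, hred, toRed_unital,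
      TensorProduct.map_comp (Sym.Red V.grading₁).subtype, LinearMap.comp_apply, hred]
    have h := LinearMap.congr_fun φ.F_comul (Sym.toRed V.grading₁ x)
    rw [LinearMap.comp_apply, LinearMap.comp_apply] at h
    rw [h]
    generalize Sym.comulRed V.grading₁ (Sym.toRed V.grading₁ x) = z
    rw [← LinearMap.comp_apply, ← TensorProduct.map_comp, ← LinearMap.comp_apply (TensorProduct.map
      φ.unital φ.unital), ← TensorProduct.map_comp]
    have h2 : φ.unital ∘ₗ (Sym.Red V.grading₁).subtype = (Sym.Red W.grading₁).subtype ∘ₗ φ.F :=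
      LinearMap.ext hr
    rw [h2]

theorem proj_unital_ι (a : V.carrier) :
    Sym.proj W.grading₁ (φ.unital (Sym.ι V.grading₁ a)) = φ.f₁ a := by
  have h : Sym.toRed V.grading₁ (Sym.ι V.grading₁ a) = Sym.ιRed V.grading₁ a :=
    Sym.toRed_coe V.grading₁ (Sym.ιRed V.grading₁ a)
  rw [unital_apply, Sym.counit_ι, zero_smul, zero_add, h]
  rfl

theorem hasDegree_f₁ : HasDegree V.grading₁ W.grading₁ 0 φ.f₁ := by
  intro d a ha
  rw [add_zero]
  exact Sym.proj_mem W.grading₁ (φ.F_mem d (Sym.ιRed V.grading₁ a) (Sym.ι_mem_deg V.grading₁ ha))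

end LInftyHom

end Unital

end LInf

end

noncomputable section

namespace LInf

/-! ### The convolution algebra -/

section DividedPower

variable {K : Type w} [Field K] {R : Type*} [Ring R] [Algebra K R]

variable (K) in
/-- The divided power `x ^ k / k!`. -/
def divPow (k : ℕ) (x : R) : R := (k.factorial : K)⁻¹ • x ^ k

@[simp]
theorem divPow_zero (x : R) : divPow K 0 x = 1 := by simp [divPow]

theorem divPow_succ_zero (k : ℕ) : divPow K (k + 1) (0 : R) = 0 := by simp [divPow]

theorem divPow_one (x : R) : divPow K 1 x = x := by simp [divPow]

theorem divPow_add [CharZero K] {x y : R} (h : Commute x y) (k : ℕ) :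
    divPow K k (x + y) =
      ∑ p ∈ Finset.HasAntidiagonal.antidiagonal k, divPow K p.1 x * divPow K p.2 y := by
  rw [divPow, h.add_pow', Finset.smul_sum]
  refine Finset.sum_congr rfl fun p hp => ?_
  obtain rfl := Finset.HasAntidiagonal.mem_antidiagonal.1 hp
  rw [divPow, divPow, smul_mul_smul_comm, ← Nat.cast_smul_eq_nsmul K, smul_smul]
  congr 1
  have h1 : ((p.1.factorial : ℕ) : K) ≠ 0 := Nat.cast_ne_zero.2 p.1.factorial_ne_zero
  have h2 : ((p.2.factorial : ℕ) : K) ≠ 0 := Nat.cast_ne_zero.2 p.2.factorial_ne_zero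
  rw [← Nat.add_choose_mul_factorial_mul_factorial p.1 p.2, Nat.choose_symm_add]
  have h3 : (((p.1 + p.2).choose p.2 : ℕ) : K) ≠ 0 :=
    Nat.cast_ne_zero.2 (Nat.choose_pos (Nat.le_add_left _ _)).ne'
  push_cast
  field_simp

end DividedPower

namespace Sym

variable {K : Type w} [Field K] {U : Type u} [AddCommGroup U] [Module K U]

section Coalgebra

variable (𝒰 : ℤ → Submodule K U) [DirectSum.Decomposition 𝒰]

theorem comul_twist (i : ℤ) (x : Sym 𝒰) :
    comul 𝒰 (twist (deg 𝒰) i x) =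
      TensorProduct.map (twist (deg 𝒰) i) (twist (deg 𝒰) i) (comul 𝒰 x) := by
  induction x using word_induction with
  | h0 => simp
  | ha x y hx hy => simp only [map_add, hx, hy]
  | hs r x hx => simp only [map_smul, hx]
  | hw n d x hx =>
    rw [twist_apply _ i hx.mem_deg, map_smul]
    refine map_comul_congr 𝒰 (T := koszul K i d • LinearMap.id) hx ?_
    intro n₁ n₂ d₁ d₂ a b hn hd ha hb
    rw [← hd]
    simp only [LinearMap.smul_apply, LinearMap.id_apply, TensorProduct.map_tmul,
      twist_apply _ i ha.mem_deg, twist_apply _ i hb.mem_deg, TensorProduct.smul_tmul_smul,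
      koszul_add_right]

theorem comul_coassoc (x : Sym 𝒰) :
    TensorProduct.assoc K (Sym 𝒰) (Sym 𝒰) (Sym 𝒰)
      ((comul 𝒰).rTensor (Sym 𝒰) (comul 𝒰 x)) = (comul 𝒰).lTensor (Sym 𝒰) (comul 𝒰 x) := by
  induction x using induction_left with
  | h1 => simp [comul_one]
  | h0 => simp
  | ha x y hx hy => simp only [map_add, hx, hy]
  | hs r x hx => simp only [map_smul, hx]
  | hm i u hu x hx =>
    -- Both sides intertwine the multiplication by `u` with the same operator.
    let L := LinearMap.mulLeft K (ι 𝒰 u)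
    let τ := twist (deg 𝒰) i
    let Λ : Sym 𝒰 ⊗[K] Sym 𝒰 →ₗ[K] Sym 𝒰 ⊗[K] Sym 𝒰 :=
      TensorProduct.map L LinearMap.id + TensorProduct.map τ L
    let Θ : Sym 𝒰 ⊗[K] (Sym 𝒰 ⊗[K] Sym 𝒰) →ₗ[K] Sym 𝒰 ⊗[K] (Sym 𝒰 ⊗[K] Sym 𝒰) :=
      TensorProduct.map L LinearMap.id + TensorProduct.map τ Λ
    have hΛ : ∀ y, comul 𝒰 (ι 𝒰 u * y) = Λ (comul 𝒰 y) := comul_ι_mul_eq 𝒰 hu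
    have h1 : ∀ z, (comul 𝒰).lTensor (Sym 𝒰) (Λ z) = Θ ((comul 𝒰).lTensor (Sym 𝒰) z) := by
      intro z
      induction z using TensorProduct.induction_on with
      | zero => simp
      | add y z hy hz => simp only [map_add, hy, hz]
      | tmul a b => simp [Λ, Θ, L, hΛ]
    have h2 : ∀ z, TensorProduct.assoc K (Sym 𝒰) (Sym 𝒰) (Sym 𝒰)
        ((comul 𝒰).rTensor (Sym 𝒰) (Λ z)) =
        Θ (TensorProduct.assoc K (Sym 𝒰) (Sym 𝒰) (Sym 𝒰) ((comul 𝒰).rTensor (Sym 𝒰) z)) := by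
      intro z
      induction z using TensorProduct.induction_on with
      | zero => simp
      | add y z hy hz => simp only [map_add, hy, hz]
      | tmul a b =>
        have h3 : Λ (a ⊗ₜ b) = (ι 𝒰 u * a) ⊗ₜ b + τ a ⊗ₜ (ι 𝒰 u * b) := by simp [Λ, L]
        rw [h3, map_add, LinearMap.rTensor_tmul, LinearMap.rTensor_tmul, LinearMap.rTensor_tmul, hΛ,
          comul_twist]
        generalize comul 𝒰 a = y
        induction y using TensorProduct.induction_on with
        | zero => simp
        | tmul c d => simp [Λ, Θ, L, τ, TensorProduct.add_tmul, TensorProduct.tmul_add, add_assoc]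
        | add y z hy hz =>
          simp only [map_add, TensorProduct.add_tmul] at hy hz ⊢
          rw [← hy, ← hz]
          abel
    rw [hΛ, h1, h2, hx]

instance : Coalgebra K (Sym 𝒰) where
  comul := comul 𝒰
  counit := (counit 𝒰).toLinearMap
  coassoc := LinearMap.ext (comul_coassoc 𝒰)
  rTensor_counit_comp_comul := by
    ext x
    apply (TensorProduct.lid K (Sym 𝒰)).injective
    have h : (TensorProduct.lid K (Sym 𝒰)).toLinearMap ∘ₗ
        (counit 𝒰).toLinearMap.rTensor (Sym 𝒰) = LinearMap.mul' K (Sym 𝒰) ∘ₗ TensorProduct.map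
          (Algebra.linearMap K (Sym 𝒰) ∘ₗ (counit 𝒰).toLinearMap) LinearMap.id := by
      ext a b
      simp [Algebra.smul_def]
    have h' := LinearMap.congr_fun h (comul 𝒰 x)
    simp only [LinearMap.comp_apply, counit_comul] at h'
    simpa using h'
  lTensor_counit_comp_comul := by
    ext x
    apply (TensorProduct.rid K (Sym 𝒰)).injective
    have h : (TensorProduct.rid K (Sym 𝒰)).toLinearMap ∘ₗ
        (counit 𝒰).toLinearMap.lTensor (Sym 𝒰) = LinearMap.mul' K (Sym 𝒰) ∘ₗ TensorProduct.map
          LinearMap.id (Algebra.linearMap K (Sym 𝒰) ∘ₗ (counit 𝒰).toLinearMap) := by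
      ext a b
      simp [Algebra.smul_def, Algebra.commutes]
    have h' := LinearMap.congr_fun h (comul 𝒰 x)
    simp only [LinearMap.comp_apply, comul_counit] at h'
    simpa using h'

/-- The co-Leibniz rule for `coderiv q`. -/
theorem comul_coderiv {e : ℤ} {q : Sym 𝒰 →ₗ[K] U} (hq : HasDegree (deg 𝒰) 𝒰 e q) (x : Sym 𝒰) :
    comul 𝒰 (coderiv 𝒰 q x) =
      TensorProduct.map (coderiv 𝒰 q) LinearMap.id (comul 𝒰 x) +
      TensorProduct.map (twist (deg 𝒰) e) (coderiv 𝒰 q) (comul 𝒰 x) := by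
  induction x using induction_left generalizing e q with
  | h1 =>
    have h : twist (deg 𝒰) e (1 : Sym 𝒰) = 1 := by
      rw [twist_apply _ e (IsWord.one (𝒰 := 𝒰)).mem_deg, koszul_zero_right, one_smul]
    simp [coderiv_one, comul_ι, comul_one, h]
  | h0 => simp
  | ha x y hx hy => simp only [map_add, hx hq, hy hq]; abel
  | hs r x hx => simp only [map_smul, hx hq, smul_add]
  | hm i u hu x hx =>
    have hq' : HasDegree (deg 𝒰) 𝒰 (i + e) (q ∘ₗ LinearMap.mulLeft K (ι 𝒰 u)) := by
      intro d a ha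
      have := hq _ _ (SetLike.GradedMul.mul_mem (ι_mem_deg 𝒰 hu) ha)
      rwa [show i + d + e = d + (i + e) by ring] at this
    rw [coderiv_ι_mul 𝒰 hq hu, map_add, map_smul, hx hq', comul_ι_mul_eq 𝒰 hu, hx hq,
      comul_ι_mul_eq 𝒰 hu]
    -- The identity now holds for every tensor in place of `comul x`.
    generalize comul 𝒰 x = z
    induction z using TensorProduct.induction_on with
    | zero => simp
    | add y z hy hz =>
      simp only [map_add, smul_add] at hy hz ⊢
      linear_combination (norm := module) hy + hz
    | tmul a b =>
      have h1 : ∀ c, twist (deg 𝒰) i (twist (deg 𝒰) e c) = twist (deg 𝒰) (i + e) c :=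
        fun c => LinearMap.congr_fun (twist_comp_twist (deg 𝒰) i e) c
      have h1' : ∀ c, twist (deg 𝒰) e (twist (deg 𝒰) i c) = twist (deg 𝒰) (i + e) c := by
        intro c
        rw [add_comm]
        exact LinearMap.congr_fun (twist_comp_twist (deg 𝒰) e i) c
      have h2 : twist (deg 𝒰) i (coderiv 𝒰 q a) =
          koszul K e i • coderiv 𝒰 q (twist (deg 𝒰) i a) := by
        have := LinearMap.congr_fun (twist_comp_of_hasDegree (deg 𝒰) (hasDegree_coderiv 𝒰 hq) i) a
        rw [koszul_comm]
        exact this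
      have h3 : twist (deg 𝒰) e (ι 𝒰 u * a) = koszul K e i • (ι 𝒰 u * twist (deg 𝒰) e a) := by
        have hL : HasDegree (deg 𝒰) (deg 𝒰) i (LinearMap.mulLeft K (ι 𝒰 u)) := by
          intro d a ha
          have := SetLike.GradedMul.mul_mem (ι_mem_deg 𝒰 hu) ha
          rwa [add_comm d i]
        exact LinearMap.congr_fun (twist_comp_of_hasDegree (deg 𝒰) hL e) a
      simp only [TensorProduct.map_tmul, map_add, LinearMap.mulLeft_apply, LinearMap.id_apply,
        coderiv_ι_mul 𝒰 hq hu, h1, h1', h2, h3, TensorProduct.add_tmul, TensorProduct.tmul_add,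
        ← TensorProduct.smul_tmul', TensorProduct.tmul_smul, smul_add, smul_smul, koszul_mul_self,
        one_smul]
      abel

end Coalgebra

/-! ### The exponential -/

section Exp

open WithConv

variable (𝒰 : ℤ → Submodule K U) [DirectSum.Decomposition 𝒰]
  {U' : Type u} [AddCommGroup U'] [Module K U'] (𝒰' : ℤ → Submodule K U')

/-- The value at `x`, as a linear function on the convolution algebra. -/
def evalAt {A : Type*} [Ring A] [Algebra K A] (x : Sym 𝒰) : WithConv (Sym 𝒰 →ₗ[K] A) →ₗ[K] A where
  toFun f := f.ofConv x
  map_add' _ _ := rfl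
  map_smul' _ _ := rfl

/-- The map `a ⊗ b ↦ f a * g b`. -/
def mulMap {A : Type*} [Ring A] [Algebra K A] (f g : Sym 𝒰 →ₗ[K] A) :
    Sym 𝒰 ⊗[K] Sym 𝒰 →ₗ[K] A :=
  LinearMap.mul' K A ∘ₗ TensorProduct.map f g

theorem conv_mul_apply {A : Type*} [Ring A] [Algebra K A] (f g : WithConv (Sym 𝒰 →ₗ[K] A))
    (x : Sym 𝒰) : (f * g).ofConv x =
      LinearMap.mul' K A (TensorProduct.map f.ofConv g.ofConv (comul 𝒰 x)) := rfl

theorem conv_one_apply {A : Type*} [Ring A] [Algebra K A] (x : Sym 𝒰) :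
    (1 : WithConv (Sym 𝒰 →ₗ[K] A)).ofConv x = algebraMap K A (counit 𝒰 x) := rfl

theorem coalgebra_counit_apply (x : Sym 𝒰) :
    CoalgebraStruct.counit (R := K) x = counit 𝒰 x := rfl

theorem toConv_comp_pow {A B : Type*} [Ring A] [Algebra K A] [Ring B] [Algebra K B] (h : A →ₐ[K] B)
    (f : WithConv (Sym 𝒰 →ₗ[K] A)) (k : ℕ) :
    toConv (h.toLinearMap ∘ₗ (f ^ k).ofConv) = toConv (h.toLinearMap ∘ₗ f.ofConv) ^ k := by
  induction k with
  | zero =>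
    apply WithConv.ext
    ext x
    simp
  | succ k ih =>
    rw [pow_succ, pow_succ, ← ih]
    apply WithConv.ext
    exact LinearMap.algHom_comp_convMul_distrib h (f ^ k) f

theorem comp_divPow {A B : Type*} [Ring A] [Algebra K A] [Ring B] [Algebra K B] (h : A →ₐ[K] B)
    (f : WithConv (Sym 𝒰 →ₗ[K] A)) (k : ℕ) :
    h.toLinearMap ∘ₗ (divPow K k f).ofConv =
      (divPow K k (toConv (h.toLinearMap ∘ₗ f.ofConv))).ofConv := by
  rw [divPow, divPow, ← toConv_comp_pow, ofConv_smul, LinearMap.comp_smul]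
  rfl

/-- A linear map `g : Sym U → U'`, as an element of the convolution algebra. -/
def convι (g : Sym 𝒰 →ₗ[K] U') : WithConv (Sym 𝒰 →ₗ[K] Sym 𝒰') := toConv (ι 𝒰' ∘ₗ g)

variable {g : Sym 𝒰 →ₗ[K] U'}

theorem convι_pow_apply_eq_zero (hg : g 1 = 0) {n k : ℕ} (h : n < k) {d : ℤ} {x : Sym 𝒰}
    (hx : IsWord 𝒰 n d x) : (convι 𝒰 𝒰' g ^ k).ofConv x = 0 := by
  induction k generalizing n d x with
  | zero => omega
  | succ k ih =>
    rw [pow_succ', conv_mul_apply, ← LinearMap.comp_apply]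
    refine map_comul_congr 𝒰 (T' := 0) hx ?_
    intro n₁ n₂ d₁ d₂ a b hn hd ha hb
    rcases Nat.eq_zero_or_pos n₁ with rfl | h1
    · simp [convι, ha.eq_one, hg]
    · simp [ih (by omega) hb]

theorem divPow_convι_apply_eq_zero (hg : g 1 = 0) {n k : ℕ} (h : n < k) {d : ℤ} {x : Sym 𝒰}
    (hx : IsWord 𝒰 n d x) : (divPow K k (convι 𝒰 𝒰' g)).ofConv x = 0 := by
  rw [divPow, ofConv_smul, LinearMap.smul_apply, convι_pow_apply_eq_zero 𝒰 𝒰' hg h hx, smul_zero]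

theorem hasFiniteSupport_divPow (hg : g 1 = 0) (x : Sym 𝒰) :
    Function.HasFiniteSupport fun k => (divPow K k (convι 𝒰 𝒰' g)).ofConv x := by
  induction x using word_induction with
  | hw n d x hx =>
    refine (Set.finite_Iic n).subset fun k hk => ?_
    by_contra h
    exact hk (divPow_convι_apply_eq_zero 𝒰 𝒰' hg (not_le.1 h) hx)
  | h0 => simp [Function.HasFiniteSupport]
  | ha x y hx hy =>
    refine (Set.Finite.union hx hy).subset fun k hk => ?_
    by_contra h
    simp only [Set.mem_union, Function.mem_support, not_or, not_not] at h
    exact hk (by simp [h.1, h.2])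
  | hs r x hx =>
    refine Set.Finite.subset hx fun k hk h => hk ?_
    simp only at h ⊢
    rw [map_smul, h, smul_zero]

/-- The exponential `∑ₖ gᵏ / k!` of `g : Sym U → U'` in the convolution algebra: the coalgebra
morphism with `proj ∘ exp g = g`. It requires `g 1 = 0`, so that the sum is finite on every
element. -/
def exp (hg : g 1 = 0) : Sym 𝒰 →ₗ[K] Sym 𝒰' where
  toFun x := ∑ᶠ k, (divPow K k (convι 𝒰 𝒰' g)).ofConv x
  map_add' x y := by
    simp only [map_add]
    exact finsum_add_distrib (hasFiniteSupport_divPow 𝒰 𝒰' hg x)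
      (hasFiniteSupport_divPow 𝒰 𝒰' hg y)
  map_smul' r x := by
    simp only [map_smul, RingHom.id_apply]
    exact (smul_finsum' r (hasFiniteSupport_divPow 𝒰 𝒰' hg x)).symm

theorem exp_isWord (hg : g 1 = 0) {n N : ℕ} (h : n < N) {d : ℤ} {x : Sym 𝒰}
    (hx : IsWord 𝒰 n d x) :
    exp 𝒰 𝒰' hg x = ∑ k ∈ Finset.range N, (divPow K k (convι 𝒰 𝒰' g)).ofConv x := by
  refine finsum_eq_sum_of_support_subset _ fun k hk => ?_
  rw [Finset.coe_range, Set.mem_Iio]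
  by_contra h'
  exact hk (divPow_convι_apply_eq_zero 𝒰 𝒰' hg (by omega) hx)

/-- The value of `exp g` at `x` lies in every subspace that contains the values of the divided
convolution powers of `g`. -/
theorem map_exp_mem (hg : g 1 = 0) (N : Submodule K (Sym 𝒰')) (x : Sym 𝒰)
    (h : ∀ k, (divPow K k (convι 𝒰 𝒰' g)).ofConv x ∈ N) : exp 𝒰 𝒰' hg x ∈ N := by
  change ∑ᶠ k, (divPow K k (convι 𝒰 𝒰' g)).ofConv x ∈ N
  exact finsum_induction (· ∈ N) (Submodule.zero_mem N) (fun _ _ => Submodule.add_mem N) h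

theorem counit_divPow_succ (k : ℕ) (x : Sym 𝒰) :
    counit 𝒰' ((divPow K (k + 1) (convι 𝒰 𝒰' g)).ofConv x) = 0 := by
  have h := LinearMap.congr_fun (comp_divPow 𝒰 (counit 𝒰') (convι 𝒰 𝒰' g) (k + 1)) x
  have h0 : (counit 𝒰').toLinearMap ∘ₗ (convι 𝒰 𝒰' g).ofConv = 0 := by
    ext y
    simp [convι]
  rw [h0, toConv_zero, divPow_succ_zero] at h
  exact h

theorem proj_divPow_add_two (k : ℕ) (x : Sym 𝒰) :
    proj 𝒰' ((divPow K (k + 2) (convι 𝒰 𝒰' g)).ofConv x) = 0 := by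
  have hpow : ∀ y, counit 𝒰' ((convι 𝒰 𝒰' g ^ (k + 1)).ofConv y) = 0 := by
    intro y
    have h := LinearMap.congr_fun (congrArg ofConv
      (toConv_comp_pow 𝒰 (counit 𝒰') (convι 𝒰 𝒰' g) (k + 1))) y
    have h0 : (counit 𝒰').toLinearMap ∘ₗ (convι 𝒰 𝒰' g).ofConv = 0 := by
      ext y
      simp [convι]
    rw [h0, toConv_zero, zero_pow (Nat.succ_ne_zero k)] at h
    exact h
  have h : proj 𝒰' ∘ₗ LinearMap.mul' K (Sym 𝒰') ∘ₗ TensorProduct.map (convι 𝒰 𝒰' g).ofConv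
      (convι 𝒰 𝒰' g ^ (k + 1)).ofConv = 0 := by
    have hι : ∀ a, (convι 𝒰 𝒰' g).ofConv a = ι 𝒰' (g a) := fun _ => rfl
    ext a b
    simp [proj_mul, hpow, hι]
  have h' := LinearMap.congr_fun h (comul 𝒰 x)
  rw [divPow, ofConv_smul, LinearMap.smul_apply, map_smul, pow_succ', conv_mul_apply]
  exact (congrArg _ h').trans (smul_zero _)

theorem exp_one (hg : g 1 = 0) : exp 𝒰 𝒰' hg 1 = 1 := by
  rw [exp_isWord 𝒰 𝒰' hg Nat.zero_lt_one .one]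
  simp [coalgebra_counit_apply]

theorem counit_exp (hg : g 1 = 0) (x : Sym 𝒰) : counit 𝒰' (exp 𝒰 𝒰' hg x) = counit 𝒰 x := by
  have h : (counit 𝒰').toLinearMap ∘ₗ exp 𝒰 𝒰' hg = (counit 𝒰).toLinearMap := by
    apply ext_word
    intro n d x hx
    change counit 𝒰' (exp 𝒰 𝒰' hg x) = counit 𝒰 x
    rw [exp_isWord 𝒰 𝒰' hg (Nat.lt_succ_self n) hx, map_sum, Finset.sum_range_succ', Finset.sum_eq_zero (fun k _ => counit_divPow_succ 𝒰 𝒰' k x)]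
    simp [coalgebra_counit_apply]
  exact LinearMap.congr_fun h x

theorem proj_exp (hg : g 1 = 0) (x : Sym 𝒰) : proj 𝒰' (exp 𝒰 𝒰' hg x) = g x := by
  have h : proj 𝒰' ∘ₗ exp 𝒰 𝒰' hg = g := by
    apply ext_word
    intro n d x hx
    rw [LinearMap.comp_apply, exp_isWord 𝒰 𝒰' hg (show n < n + 2 by omega) hx, map_sum,
      Finset.sum_range_succ', Finset.sum_range_succ',
      Finset.sum_eq_zero (fun k _ => proj_divPow_add_two 𝒰 𝒰' k x)]
    simp [divPow_one, convι, proj_algebraMap]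
  exact LinearMap.congr_fun h x

theorem hasDegree_exp (hg : g 1 = 0) (hgd : HasDegree (deg 𝒰) 𝒰' 0 g) :
    HasDegree (deg 𝒰) (deg 𝒰') 0 (exp 𝒰 𝒰' hg) := by
  have h : ∀ k, HasDegree (deg 𝒰) (deg 𝒰') 0 (convι 𝒰 𝒰' g ^ k).ofConv := by
    intro k
    induction k with
    | zero =>
      apply hasDegree_of_isWord
      intro n d x hx
      rw [pow_zero, conv_one_apply, add_zero]
      by_cases hd : d = 0
      · rw [hd, Algebra.algebraMap_eq_smul_one]
        exact Submodule.smul_mem _ _ (IsWord.one (𝒰 := 𝒰')).mem_deg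
      · rw [counit_eq_zero 𝒰 hd hx.mem_deg, map_zero]
        exact Submodule.zero_mem _
    | succ k ih =>
      apply hasDegree_of_isWord
      intro n d x hx
      rw [pow_succ', conv_mul_apply, ← LinearMap.comp_apply]
      refine map_comul_mem 𝒰 _ _ hx ?_
      intro n₁ n₂ d₁ d₂ a b hn hd ha hb
      have := SetLike.GradedMul.mul_mem (ι_mem_deg 𝒰' (hgd.mem ha.mem_deg)) (ih.mem hb.mem_deg)
      rw [hd] at this
      rwa [add_zero]
  intro d x hx
  refine map_exp_mem 𝒰 𝒰' hg _ x fun k => ?_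
  rw [divPow, ofConv_smul]
  exact Submodule.smul_mem _ _ (h k d x hx)

/-- If `g` vanishes on the image of a coderivation, then so does `exp g`. -/
theorem exp_coderiv (hg : g 1 = 0) {e : ℤ} {q : Sym 𝒰 →ₗ[K] U} (hq : HasDegree (deg 𝒰) 𝒰 e q)
    (hgq : g ∘ₗ coderiv 𝒰 q = 0) (x : Sym 𝒰) : exp 𝒰 𝒰' hg (coderiv 𝒰 q x) = 0 := by
  have h : ∀ k, (convι 𝒰 𝒰' g ^ k).ofConv ∘ₗ coderiv 𝒰 q = 0 := by
    intro k
    induction k with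
    | zero =>
      ext x
      rw [LinearMap.comp_apply, pow_zero, conv_one_apply, counit_coderiv]
      simp
    | succ k ih =>
      ext x
      rw [LinearMap.comp_apply, pow_succ', conv_mul_apply, comul_coderiv 𝒰 hq, map_add,
        ← LinearMap.comp_apply (TensorProduct.map _ _),
        ← LinearMap.comp_apply (TensorProduct.map _ _), ← TensorProduct.map_comp,
        ← TensorProduct.map_comp, ih, convι, LinearMap.comp_assoc, hgq]
      simp
  rw [← Submodule.mem_bot K]
  refine map_exp_mem 𝒰 𝒰' hg _ _ fun k => ?_
  rw [divPow, ofConv_smul, LinearMap.smul_apply]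
  exact Submodule.smul_mem _ _ (LinearMap.congr_fun (h k) x)

variable [DirectSum.Decomposition 𝒰']

/-- The graded symmetric coalgebra is graded cocommutative. -/
theorem comm_comulAlgHom (x : Sym 𝒰) :
    GradedTensorProduct.comm (deg 𝒰) (deg 𝒰) (comulAlgHom 𝒰 x) = comulAlgHom 𝒰 x := by
  have h : ((GradedTensorProduct.comm (deg 𝒰) (deg 𝒰)).toAlgHom.comp
      (comulAlgHom 𝒰)).toLinearMap ∘ₗ ι 𝒰 = (comulAlgHom 𝒰).toLinearMap ∘ₗ ι 𝒰 := by
    apply linearMap_ext_homogeneous 𝒰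
    intro i a ha
    have h1 := GradedTensorProduct.comm_coe_tmul_coe (R := K) (deg 𝒰) (deg 𝒰)
      (⟨ι 𝒰 a, ι_mem_deg 𝒰 ha⟩ : deg 𝒰 i) (⟨1, SetLike.GradedOne.one_mem⟩ : deg 𝒰 0)
    have h2 := GradedTensorProduct.comm_coe_tmul_coe (R := K) (deg 𝒰) (deg 𝒰)
      (⟨1, SetLike.GradedOne.one_mem⟩ : deg 𝒰 0) (⟨ι 𝒰 a, ι_mem_deg 𝒰 ha⟩ : deg 𝒰 i)
    simp only [zero_mul, mul_zero, zpow_zero, one_smul] at h1 h2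
    have h3 : comulAlgHom 𝒰 (ι 𝒰 a) = GradedTensorProduct.includeLeft (deg 𝒰) (deg 𝒰) (ι 𝒰 a) +
        GradedTensorProduct.includeRight (deg 𝒰) (deg 𝒰) (ι 𝒰 a) := by
      simp [comulAlgHom]
    change GradedTensorProduct.comm (deg 𝒰) (deg 𝒰) (comulAlgHom 𝒰 (ι 𝒰 a)) =
      comulAlgHom 𝒰 (ι 𝒰 a)
    rw [h3, map_add, GradedTensorProduct.includeLeft_apply, GradedTensorProduct.includeRight_apply,
      h1, h2, add_comm]
  have h' : (GradedTensorProduct.comm (deg 𝒰) (deg 𝒰)).toAlgHom.comp (comulAlgHom 𝒰) =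
      comulAlgHom 𝒰 := algHom_ext 𝒰 (fun a => LinearMap.congr_fun h a)
  exact DFunLike.congr_fun h' x

/-- The convolution of two maps with values in the two factors of a graded tensor product. -/
theorem includeLeft_conv_includeRight (f f' : WithConv (Sym 𝒰 →ₗ[K] Sym 𝒰')) (x : Sym 𝒰) :
    (toConv ((GradedTensorProduct.includeLeft (deg 𝒰') (deg 𝒰')).toLinearMap ∘ₗ f.ofConv) *
      toConv ((GradedTensorProduct.includeRight (deg 𝒰') (deg 𝒰')).toLinearMap ∘ₗ
        f'.ofConv)).ofConv x =
      GradedTensorProduct.of K (deg 𝒰') (deg 𝒰')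
        (TensorProduct.map f.ofConv f'.ofConv (comul 𝒰 x)) := by
  rw [conv_mul_apply]
  generalize comul 𝒰 x = z
  induction z using TensorProduct.induction_on with
  | zero => simp
  | add y z hy hz => simp only [map_add, hy, hz]
  | tmul a b =>
    simp only [TensorProduct.map_tmul, LinearMap.comp_apply, LinearMap.mul'_apply,
      AlgHom.toLinearMap_apply, GradedTensorProduct.includeLeft_apply,
      GradedTensorProduct.includeRight_apply]
    exact GradedTensorProduct.tmul_one_mul_one_tmul (R := K) (deg 𝒰') (deg 𝒰') _ _

/-- By graded cocommutativity, the two extensions of `g` to the graded tensor product commute. -/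
theorem commute_include_convι (hgd : HasDegree (deg 𝒰) 𝒰' 0 g) :
    Commute
      (toConv ((GradedTensorProduct.includeLeft (deg 𝒰') (deg 𝒰')).toLinearMap ∘ₗ
        (convι 𝒰 𝒰' g).ofConv))
      (toConv ((GradedTensorProduct.includeRight (deg 𝒰') (deg 𝒰')).toLinearMap ∘ₗ
        (convι 𝒰 𝒰' g).ofConv)) := by
  apply WithConv.ext
  ext x
  rw [conv_mul_apply, conv_mul_apply]
  set γ₁ := (GradedTensorProduct.includeLeft (deg 𝒰') (deg 𝒰')).toLinearMap ∘ₗ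
    (convι 𝒰 𝒰' g).ofConv with hγ₁
  set γ₂ := (GradedTensorProduct.includeRight (deg 𝒰') (deg 𝒰')).toLinearMap ∘ₗ
    (convι 𝒰 𝒰' g).ofConv with hγ₂
  let T := mulMap 𝒰 γ₁ γ₂
  let T' := mulMap 𝒰 γ₂ γ₁
  have key : T ∘ₗ (GradedTensorProduct.of K (deg 𝒰) (deg 𝒰)).symm.toLinearMap ∘ₗ
      (GradedTensorProduct.comm (deg 𝒰) (deg 𝒰)).toLinearMap ∘ₗ
      (GradedTensorProduct.of K (deg 𝒰) (deg 𝒰)).toLinearMap = T' := by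
    apply tensor_ext_homogeneous (deg 𝒰)
    intro i a ha b
    induction b using DirectSum.Decomposition.inductionOn (deg 𝒰) with
    | zero => simp
    | add b c hb hc => rw [TensorProduct.tmul_add, map_add, map_add, hb, hc]
    | @homogeneous j b =>
      have h1 := GradedTensorProduct.comm_coe_tmul_coe (R := K) (deg 𝒰) (deg 𝒰)
        (⟨a, ha⟩ : deg 𝒰 i) b
      have h1' : (GradedTensorProduct.of K (deg 𝒰) (deg 𝒰)).symm
          (GradedTensorProduct.comm (deg 𝒰) (deg 𝒰)
            (GradedTensorProduct.of K (deg 𝒰) (deg 𝒰) (a ⊗ₜ (b : Sym 𝒰)))) =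
          koszul K i j • ((b : Sym 𝒰) ⊗ₜ a) := by
        refine (congrArg (GradedTensorProduct.of K (deg 𝒰) (deg 𝒰)).symm h1).trans ?_
        rw [units_smul_eq_koszul (K := K), map_smul, koszul_comm]
        rfl
      have h2 := right_mul_left 𝒰' (hgd.mem ha) (hgd.mem b.2)
      simp only [LinearMap.comp_apply, LinearEquiv.coe_coe, AlgEquiv.toLinearMap_apply]
      rw [units_smul_eq_koszul (K := K)] at h2
      rw [h1', map_smul]
      exact h2.symm
  have h := LinearMap.congr_fun key (comul 𝒰 x)
  have hc : GradedTensorProduct.of K (deg 𝒰) (deg 𝒰) (comul 𝒰 x) = comulAlgHom 𝒰 x := by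
    simp [comul]
  simp only [LinearMap.comp_apply, LinearEquiv.coe_coe, AlgEquiv.toLinearMap_apply] at h
  rw [hc, comm_comulAlgHom, ← hc, LinearEquiv.symm_apply_apply] at h
  exact h

/-- The exponential is a morphism of coalgebras. The coproduct being a morphism of algebras, this
is the formula `exp (γ₁ + γ₂) = exp γ₁ * exp γ₂` for the two extensions of `g` to the graded tensor
product. -/
theorem isCoalgHom_exp [CharZero K] (hg : g 1 = 0) (hgd : HasDegree (deg 𝒰) 𝒰' 0 g) :
    IsCoalgHom 𝒰 𝒰' (exp 𝒰 𝒰' hg) where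
  map_one := exp_one 𝒰 𝒰' hg
  counit_apply := counit_exp 𝒰 𝒰' hg
  comul_apply x := by
    suffices h : comul 𝒰' ∘ₗ exp 𝒰 𝒰' hg =
        TensorProduct.map (exp 𝒰 𝒰' hg) (exp 𝒰 𝒰' hg) ∘ₗ comul 𝒰 from LinearMap.congr_fun h x
    apply ext_word
    intro n d x hx
    let f : ℕ → Sym 𝒰 →ₗ[K] Sym 𝒰' := fun k => (divPow K k (convι 𝒰 𝒰' g)).ofConv
    have hL : ∀ k, comul 𝒰' (f k x) = ∑ p ∈ Finset.HasAntidiagonal.antidiagonal k,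
        TensorProduct.map (f p.1) (f p.2) (comul 𝒰 x) := by
      intro k
      apply (GradedTensorProduct.of K (deg 𝒰') (deg 𝒰')).injective
      have h1 := LinearMap.congr_fun (comp_divPow 𝒰 (comulAlgHom 𝒰') (convι 𝒰 𝒰' g) k) x
      have h2 : toConv ((comulAlgHom 𝒰').toLinearMap ∘ₗ (convι 𝒰 𝒰' g).ofConv) =
          toConv ((GradedTensorProduct.includeLeft (deg 𝒰') (deg 𝒰')).toLinearMap ∘ₗ
            (convι 𝒰 𝒰' g).ofConv) +
          toConv ((GradedTensorProduct.includeRight (deg 𝒰') (deg 𝒰')).toLinearMap ∘ₗ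
            (convι 𝒰 𝒰' g).ofConv) := by
        apply WithConv.ext
        ext y
        simp [convι, comulAlgHom]
      rw [h2, divPow_add (commute_include_convι 𝒰 𝒰' hgd)] at h1
      have h3 : GradedTensorProduct.of K (deg 𝒰') (deg 𝒰') (comul 𝒰' (f k x)) =
          comulAlgHom 𝒰' (f k x) := by
        simp [comul]
      rw [h3, map_sum]
      refine h1.trans ?_
      change evalAt 𝒰 x (∑ p ∈ Finset.HasAntidiagonal.antidiagonal k, _) = _
      rw [map_sum]
      refine Finset.sum_congr rfl fun p _ => ?_
      rw [← includeLeft_conv_includeRight, comp_divPow, comp_divPow]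
      rfl
    have hR : TensorProduct.map (exp 𝒰 𝒰' hg) (exp 𝒰 𝒰' hg) (comul 𝒰 x) =
        (∑ i ∈ Finset.range (n + 1), ∑ j ∈ Finset.range (n + 1),
          TensorProduct.map (f i) (f j)) (comul 𝒰 x) := by
      refine map_comul_congr 𝒰 hx ?_
      intro n₁ n₂ d₁ d₂ a b hn hd ha hb
      rw [TensorProduct.map_tmul, exp_isWord 𝒰 𝒰' hg (show n₁ < n + 1 by omega) ha,
        exp_isWord 𝒰 𝒰' hg (show n₂ < n + 1 by omega) hb, TensorProduct.sum_tmul]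
      simp only [LinearMap.sum_apply, TensorProduct.map_tmul, TensorProduct.tmul_sum, f]
    -- On a word of length `n`, the terms with `i + j > n` vanish.
    have h0 : ∀ i j, n < i + j → TensorProduct.map (f i) (f j) (comul 𝒰 x) = 0 := by
      intro i j hij
      refine map_comul_congr 𝒰 (T' := 0) hx ?_
      intro n₁ n₂ d₁ d₂ a b hn hd ha hb
      rw [TensorProduct.map_tmul, LinearMap.zero_apply]
      by_cases hi : n₁ < i
      · have : f i a = 0 := divPow_convι_apply_eq_zero 𝒰 𝒰' hg hi ha
        rw [this, TensorProduct.zero_tmul]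
      · have : f j b = 0 := divPow_convι_apply_eq_zero 𝒰 𝒰' hg (by omega) hb
        rw [this, TensorProduct.tmul_zero]
    rw [LinearMap.comp_apply, LinearMap.comp_apply, hR,
      exp_isWord 𝒰 𝒰' hg (Nat.lt_succ_self n) hx, map_sum]
    change ∑ k ∈ Finset.range (n + 1), comul 𝒰' (f k x) = _
    simp only [hL, LinearMap.sum_apply]
    simp only [Finset.Nat.sum_antidiagonal_eq_sum_range_succ
      (fun i j => TensorProduct.map (f i) (f j) (comul 𝒰 x))]
    rw [Finset.sum_range_diag_flip (n + 1)
      (fun i j => TensorProduct.map (f i) (f j) (comul 𝒰 x))]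
    refine Finset.sum_congr rfl fun i hi => ?_
    rw [Finset.mem_range] at hi
    refine Finset.sum_subset (Finset.range_mono (by omega)) fun j hj hj' => h0 i j ?_
    rw [Finset.mem_range] at hj hj'
    omega

end Exp

end Sym

end LInf

end

noncomputable section

namespace LInf

/-! ### Cohomological injectivity of the inclusion of linear elements -/

section Cohomology

variable {K : Type w} [Field K] {U U' : Type u} [AddCommGroup U] [Module K U]
  [AddCommGroup U'] [Module K U'] {d : U →ₗ[K] U} {d' : U' →ₗ[K] U'} {f : U →ₗ[K] U'}
  (h : f ∘ₗ d = d' ∘ₗ f)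

theorem Cohomology.injective_map_iff :
    Function.Injective (Cohomology.map d d' f h) ↔
      ∀ z, d z = 0 → f z ∈ LinearMap.range d' → z ∈ LinearMap.range d := by
  have h0 := fun x => Submodule.Quotient.mk_eq_zero (x := x)
    ((LinearMap.range d).submoduleOf (LinearMap.ker d))
  have h0' := fun x => Submodule.Quotient.mk_eq_zero (x := x)
    ((LinearMap.range d').submoduleOf (LinearMap.ker d'))
  rw [injective_iff_map_eq_zero]
  constructor
  · intro H z hz hfz
    exact (h0 _).1 (H (Submodule.Quotient.mk ⟨z, hz⟩) ((h0' _).2 hfz))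
  · intro H c hc
    obtain ⟨⟨z, hz⟩, rfl⟩ := Submodule.Quotient.mk_surjective _ c
    exact (h0 _).2 (H z hz ((h0' _).1 hc))

theorem Cohomology.surjective_map_iff :
    Function.Surjective (Cohomology.map d d' f h) ↔
      ∀ y, d' y = 0 → ∃ z, d z = 0 ∧ y - f z ∈ LinearMap.range d' := by
  have h0 := @Submodule.Quotient.eq _ _ _ _ _
    ((LinearMap.range d').submoduleOf (LinearMap.ker d'))
  constructor
  · intro H y hy
    obtain ⟨c, hc⟩ := H (Submodule.Quotient.mk ⟨y, hy⟩)
    obtain ⟨⟨z, hz⟩, rfl⟩ := Submodule.Quotient.mk_surjective _ c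
    exact ⟨z, hz, h0.1 hc.symm⟩
  · intro H c
    obtain ⟨⟨y, hy⟩, rfl⟩ := Submodule.Quotient.mk_surjective _ c
    obtain ⟨z, hz, hyz⟩ := H y hy
    exact ⟨Submodule.Quotient.mk ⟨z, hz⟩, (h0.2 hyz).symm⟩

end Cohomology

section Criterion

variable {K : Type w} [Field K]

namespace LInftyAlgebra

/-- The inclusion of the complex `(V[1], q₁)` into the symmetric coalgebra with its codifferential
is injective in cohomology. This characterizes the quasi-abelian `L∞`-algebras. -/
def InclusionInjective (V : LInftyAlgebra.{w, u} K) : Prop :=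
  ∀ v, V.q₁ v = 0 → Sym.ι V.grading₁ v ∈ LinearMap.range V.codiff → v ∈ LinearMap.range V.q₁

variable (V : LInftyAlgebra.{w, u} K)

theorem codiff_ι (v : V.carrier) :
    V.codiff (Sym.ι V.grading₁ v) = Sym.ι V.grading₁ (V.q₁ v) := by
  rw [codiff, Sym.coderiv_ι _ V.taylor_one, ← LinearMap.comp_apply V.taylor, taylor_comp_ι]

theorem q₁_comp_q₁ : V.q₁ ∘ₗ V.q₁ = 0 := by
  ext v
  have h := congrArg (Sym.proj V.grading₁)
    (LinearMap.congr_fun V.codiff_comp_codiff (Sym.ι V.grading₁ v))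
  rwa [LinearMap.comp_apply, codiff_ι, codiff_ι, Sym.proj_ι, LinearMap.zero_apply, map_zero] at h

theorem hasDegree_q₁ : HasDegree V.grading₁ V.grading₁ 1 V.q₁ :=
  fun _ _ ha => V.q_mem _ _ (Sym.ι_mem_deg V.grading₁ ha)

variable {V} in
theorem IsAbelian.taylor_eq (hV : V.IsAbelian) : V.taylor = V.q₁ ∘ₗ Sym.proj V.grading₁ := by
  apply Sym.ext_word
  intro n d x hx
  match n, hx with
  | 0, hx => simp [hx.eq_one, taylor_one, Sym.proj_one]
  | 1, hx =>
    obtain ⟨v, rfl⟩ := hx.exists_eq_ι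
    rw [← LinearMap.comp_apply, taylor_comp_ι, LinearMap.comp_apply, Sym.proj_ι]
  | n + 2, hx =>
    rw [LinearMap.comp_apply, hx.proj_eq_zero (by omega), map_zero]
    refine hV (n + 2) (by omega) _ ?_
    rw [Sym.coe_toRed, hx.counit_eq_zero (by omega), map_zero, sub_zero]
    exact hx.mem_power

theorem IsAbelian.inclusionInjective {V : LInftyAlgebra.{w, u} K} (hV : V.IsAbelian) :
    V.InclusionInjective := by
  rintro v - ⟨x, hx⟩
  have h := congrArg (Sym.proj V.grading₁) hx
  rw [codiff, Sym.proj_coderiv, hV.taylor_eq, Sym.proj_ι] at h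
  exact ⟨_, h⟩

end LInftyAlgebra

variable [CharZero K] {V W : LInftyAlgebra.{w, u} K} (φ : LInftyHom V W)

theorem LInftyHom.unital_ι (v : V.carrier) :
    φ.unital (Sym.ι V.grading₁ v) = Sym.ι W.grading₁ (φ.f₁ v) := by
  have h : Sym.toRed V.grading₁ (Sym.ι V.grading₁ v) = Sym.ιRed V.grading₁ v :=
    Sym.toRed_coe V.grading₁ (Sym.ιRed V.grading₁ v)
  rw [unital_apply, Sym.counit_ι, zero_smul, zero_add, h, F_ιRed, Sym.coe_ιRed]

theorem LInftyAlgebra.InclusionInjective.of_injective (hW : W.InclusionInjective)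
    (hφ : Function.Injective φ.cohomologyMap) : V.InclusionInjective := by
  rintro v hv ⟨x, hx⟩
  refine (Cohomology.injective_map_iff φ.f₁_comp_q₁).1 hφ v hv (hW _ ?_ ⟨φ.unital x, ?_⟩)
  · rw [← LinearMap.comp_apply, ← φ.f₁_comp_q₁, LinearMap.comp_apply, hv, map_zero]
  · rw [← LinearMap.comp_apply, ← φ.unital_comp_codiff, LinearMap.comp_apply, hx, φ.unital_ι]

theorem LInftyAlgebra.InclusionInjective.of_isQuasiIso (hV : V.InclusionInjective)
    (hφ : φ.IsQuasiIso) : W.InclusionInjective := by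
  have hinj := (Cohomology.injective_map_iff φ.f₁_comp_q₁).1 hφ.1
  have hsurj := (Cohomology.surjective_map_iff φ.f₁_comp_q₁).1 hφ.2
  rintro w hw ⟨y, hy⟩
  obtain ⟨v, hv, w', hw'⟩ := hsurj w hw
  -- The element `ι (f₁ v)` differs from `ι w` by the boundary of `ι w'`; scalars are cycles and
  -- can be removed from `y`.
  let y' : Sym W.grading₁ := Sym.toRed W.grading₁ (y - Sym.ι W.grading₁ w')
  have hy' : φ.unital (Sym.ι V.grading₁ v) = W.codiff y' := by
    simp only [y', Sym.coe_toRed, Algebra.algebraMap_eq_smul_one, map_sub, map_smul,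
      W.codiff_one, W.codiff_ι, hy, hw', φ.unital_ι]
    simp
  obtain ⟨n, hn⟩ : ∃ n, y' ∈ Sym.fil W.grading₁ n :=
    Sym.exists_mem_fil W.grading₁ (Sym.toRed W.grading₁ (y - Sym.ι W.grading₁ w')).2
  have hmem : Sym.ι V.grading₁ v ∈ LinearMap.range V.codiff := by
    refine φ.isCoalgHom_unital.mem_range_coderiv φ.hasDegree_f₁ φ.proj_unital_ι V.hasDegree_taylor
      W.hasDegree_taylor V.taylor_one W.taylor_one V.codiff_comp_codiff W.codiff_comp_codiff
      φ.unital_comp_codiff ?_ ?_ ?_ (n := n + 1) (Sym.ι_mem_fil _ _ (by omega))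
      (Sym.fil_mono _ (Nat.le_succ n) hn) ?_ hy'
    · rw [V.taylor_comp_ι, W.taylor_comp_ι]
      exact φ.f₁_comp_q₁
    · rw [V.taylor_comp_ι, W.taylor_comp_ι]
      exact hinj
    · rw [V.taylor_comp_ι, W.taylor_comp_ι]
      exact hsurj
    · exact (V.codiff_ι v).trans (by rw [hv, map_zero])
  obtain ⟨u, rfl⟩ := hV v hv hmem
  refine ⟨w' + φ.f₁ u, ?_⟩
  rw [map_add, hw', ← LinearMap.comp_apply W.q₁, ← φ.f₁_comp_q₁, LinearMap.comp_apply,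
    sub_add_cancel]

theorem QuasiIsomorphic.inclusionInjective_iff (h : QuasiIsomorphic V W) :
    V.InclusionInjective ↔ W.InclusionInjective := by
  induction h with
  | rel V W h =>
    obtain ⟨φ, hφ⟩ := h
    exact ⟨fun hV => hV.of_isQuasiIso φ hφ, fun hW => hW.of_injective φ hφ.1⟩
  | refl V => rfl
  | symm V W _ ih => exact ih.symm
  | trans V W X _ _ ih ih' => exact ih.trans ih'

end Criterion

/-! ### The quasi-isomorphism to the linear part -/

section Linearization

variable {K : Type w} [Field K]

namespace Sym

variable {U U' : Type u} [AddCommGroup U] [Module K U] [AddCommGroup U'] [Module K U']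
  {𝒰 : ℤ → Submodule K U} {𝒰' : ℤ → Submodule K U'} [DirectSum.Decomposition 𝒰]
  [DirectSum.Decomposition 𝒰']

theorem IsCoalgHom.coderiv_comp_eq_zero {Φ : Sym 𝒰 →ₗ[K] Sym 𝒰'} (hΦ : IsCoalgHom 𝒰 𝒰' Φ)
    {q : Sym 𝒰' →ₗ[K] U'} (h : q ∘ₗ Φ = 0) : coderiv 𝒰' q ∘ₗ Φ = 0 := by
  ext x
  rw [coderiv, LinearMap.comp_apply, LinearMap.comp_apply, LinearMap.comp_apply, hΦ.comul_apply,
    ← LinearMap.comp_apply (TensorProduct.map _ _), ← TensorProduct.map_comp, LinearMap.comp_assoc,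
    h, LinearMap.comp_zero, TensorProduct.map_zero_left, LinearMap.zero_apply, map_zero,
    LinearMap.zero_apply]

end Sym

/-- A morphism of unreduced symmetric coalgebras that commutes with the codifferentials restricts
to an `L∞`-morphism. -/
def LInftyHom.ofUnital {V W : LInftyAlgebra.{w, u} K} {Φ : Sym V.grading₁ →ₗ[K] Sym W.grading₁}
    (hΦ : Sym.IsCoalgHom V.grading₁ W.grading₁ Φ)
    (hdeg : HasDegree (Sym.deg V.grading₁) (Sym.deg W.grading₁) 0 Φ)
    (hQ : Φ ∘ₗ V.codiff = W.codiff ∘ₗ Φ) : LInftyHom V W where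
  F := Sym.toRed W.grading₁ ∘ₗ Φ ∘ₗ (Sym.Red V.grading₁).subtype
  F_mem d x hx := by
    have hx0 : Sym.counit V.grading₁ x = 0 := x.2
    rw [LinearMap.comp_apply, Sym.coe_toRed, LinearMap.comp_apply, hΦ.counit_apply]
    simpa [hx0] using hdeg.mem hx
  F_comul := by
    have h : Sym.toRed W.grading₁ ∘ₗ Φ =
        (Sym.toRed W.grading₁ ∘ₗ Φ ∘ₗ (Sym.Red V.grading₁).subtype) ∘ₗ Sym.toRed V.grading₁ := by
      apply LinearMap.ext
      intro x
      simp [Sym.coe_toRed, Algebra.algebraMap_eq_smul_one, hΦ.map_one]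
    apply LinearMap.ext
    intro x
    have hx0 : Sym.counit V.grading₁ x = 0 := x.2
    have hx : ((Sym.toRed W.grading₁ (Φ x) : W.Coalg) : Sym W.grading₁) = Φ x := by
      rw [Sym.coe_toRed, hΦ.counit_apply, hx0, map_zero, sub_zero]
    simp only [Sym.comulRed, LinearMap.comp_apply, Submodule.subtype_apply, hx, hΦ.comul_apply]
    rw [← LinearMap.comp_apply, ← LinearMap.comp_apply (TensorProduct.map _ _) (TensorProduct.map
      (Sym.toRed V.grading₁) _), ← TensorProduct.map_comp, ← TensorProduct.map_comp, ← h]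
  F_comp_Q := by
    ext x
    have h := LinearMap.congr_fun hQ (x : Sym V.grading₁)
    rw [LinearMap.comp_apply, LinearMap.comp_apply, V.codiff_eq, Sym.toRed_coe] at h
    simp only [LinearMap.comp_apply, Submodule.subtype_apply, h, W.toRed_codiff]

theorem LInftyHom.ofUnital_f₁ {V W : LInftyAlgebra.{w, u} K}
    {Φ : Sym V.grading₁ →ₗ[K] Sym W.grading₁} (hΦ : Sym.IsCoalgHom V.grading₁ W.grading₁ Φ)
    (hdeg : HasDegree (Sym.deg V.grading₁) (Sym.deg W.grading₁) 0 Φ)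
    (hQ : Φ ∘ₗ V.codiff = W.codiff ∘ₗ Φ) (v : V.carrier) :
    (ofUnital hΦ hdeg hQ).f₁ v = Sym.proj W.grading₁ (Φ (Sym.ι V.grading₁ v)) := by
  change Sym.proj W.grading₁ (Sym.toRed W.grading₁ (Φ (Sym.ι V.grading₁ v))) = _
  rw [Sym.coe_toRed, map_sub, Sym.proj_algebraMap, sub_zero]

namespace LInftyAlgebra

variable (V : LInftyAlgebra.{w, u} K)

/-- The abelian `L∞`-algebra with the same underlying complex as `V`. -/
def linearization : LInftyAlgebra.{w, u} K where
  carrier := V.carrier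
  grading := V.grading
  q := V.q₁ ∘ₗ Sym.projRed V.grading₁
  q_mem _ _ hx := V.hasDegree_q₁ _ _ (Sym.proj_mem V.grading₁ hx)
  Q_comp_Q := by
    have hq : (V.q₁ ∘ₗ Sym.projRed V.grading₁) ∘ₗ Sym.toRed V.grading₁ =
        V.q₁ ∘ₗ Sym.proj V.grading₁ := by
      ext x
      simp [Sym.projRed, Sym.coe_toRed, Sym.proj_algebraMap]
    ext x
    have h := LinearMap.congr_fun (Sym.der_comp_self V.grading₁ V.hasDegree_q₁ V.q₁_comp_q₁)
      (x : Sym V.grading₁)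
    rw [LinearMap.comp_apply, Sym.coe_coder_eq, Sym.coe_coder_eq, hq]
    exact h

theorem linearization_taylor : V.linearization.taylor = V.q₁ ∘ₗ Sym.proj V.grading₁ := by
  apply LinearMap.ext
  intro x
  change V.q₁ (Sym.proj V.linearization.grading₁ (Sym.toRed V.linearization.grading₁ x)) = _
  rw [Sym.coe_toRed, map_sub, Sym.proj_algebraMap, sub_zero]
  rfl

theorem linearization_q₁ : V.linearization.q₁ = V.q₁ := by
  rw [← taylor_comp_ι, linearization_taylor]
  apply LinearMap.ext
  intro v
  exact congrArg V.q₁ (Sym.proj_ι V.grading₁ v)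

theorem linearization_isAbelian : V.linearization.IsAbelian := by
  intro i hi x hx
  obtain ⟨x, hx0⟩ := x
  change Sym V.grading₁ at x
  change x ∈ Sym.power V.grading₁ i at hx
  change V.q₁ (Sym.proj V.grading₁ x) = 0
  clear hx0
  suffices h : Sym.proj V.grading₁ x = 0 by rw [h, map_zero]
  obtain ⟨k, rfl⟩ := Nat.exists_eq_add_of_le' hi
  have hc : ∀ y ∈ Sym.power V.grading₁ (k + 1), Sym.counit V.grading₁ y = 0 := by
    intro y hy
    rw [Sym.power, pow_succ] at hy
    induction hy using Submodule.mul_induction_on' with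
    | mem_mul_mem a _ b hb =>
      obtain ⟨v, rfl⟩ := hb
      simp
    | add a _ b _ ha hb => rw [map_add, ha, hb, add_zero]
  rw [Sym.power, pow_succ] at hx
  induction hx using Submodule.mul_induction_on' with
  | mem_mul_mem a ha b hb =>
    obtain ⟨v, rfl⟩ := hb
    simp [Sym.proj_mul, hc a ha]
  | add a _ b _ ha hb => rw [map_add, ha, hb, add_zero]

variable {V}

/-- A retraction `g` of the inclusion of `(V[1], q₁)` into the symmetric coalgebra up to homotopy
lifts to the quasi-isomorphism `exp g` from `V` to its linearization. -/
theorem InclusionInjective.exists_isQuasiIso [CharZero K] (hV : V.InclusionInjective) :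
    ∃ φ : LInftyHom V V.linearization, φ.IsQuasiIso := by
  obtain ⟨t, ht, hqt, htQ, htι⟩ := exists_retraction V.hasDegree_q₁
    (Sym.hasDegree_coderiv V.grading₁ V.hasDegree_taylor)
    (fun d a ha => by simpa using Sym.ι_mem_deg V.grading₁ ha) hV
  -- The exponential requires a map that vanishes on the scalars.
  let g : Sym V.grading₁ →ₗ[K] V.carrier :=
    t ∘ₗ (Sym.Red V.grading₁).subtype ∘ₗ Sym.toRed V.grading₁
  have hg_of : ∀ x, Sym.counit V.grading₁ x = 0 → g x = t x := by
    intro x hx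
    simp [g, Sym.coe_toRed, hx]
  have hg1 : g 1 = 0 := by simp [g]
  have hg : HasDegree (Sym.deg V.grading₁) V.grading₁ 0 g := by
    apply Sym.hasDegree_of_isWord
    intro n d x hx
    rcases Nat.eq_zero_or_pos n with rfl | hn
    · simp [hx.eq_one, hg1]
    · rw [hg_of x (hx.counit_eq_zero (by omega))]
      exact ht d x hx.mem_deg
  have hqg : V.q₁ ∘ₗ g = 0 := by
    ext x
    exact LinearMap.congr_fun hqt _
  have hgQ : g ∘ₗ Sym.coderiv V.grading₁ V.taylor = 0 := by
    ext x
    rw [LinearMap.comp_apply, hg_of _ (Sym.counit_coderiv _ _ _)]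
    exact LinearMap.congr_fun htQ x
  let Φ : Sym V.grading₁ →ₗ[K] Sym V.linearization.grading₁ :=
    Sym.exp V.grading₁ V.linearization.grading₁ (g := g) hg1
  have hproj : ∀ x, Sym.proj V.linearization.grading₁ (Φ x) = g x :=
    Sym.proj_exp V.grading₁ V.linearization.grading₁ hg1
  have hΦ : Sym.IsCoalgHom V.grading₁ V.linearization.grading₁ Φ :=
    Sym.isCoalgHom_exp V.grading₁ V.linearization.grading₁ hg1 hg
  have h0 : V.linearization.codiff ∘ₗ Φ = 0 := by
    refine hΦ.coderiv_comp_eq_zero ?_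
    rw [linearization_taylor]
    apply LinearMap.ext
    intro x
    exact (congrArg V.q₁ (hproj x)).trans (LinearMap.congr_fun hqg x)
  have hQ : Φ ∘ₗ V.codiff = V.linearization.codiff ∘ₗ Φ := by
    rw [h0]
    apply LinearMap.ext
    exact Sym.exp_coderiv V.grading₁ V.linearization.grading₁ hg1 V.hasDegree_taylor hgQ
  have hdeg := Sym.hasDegree_exp V.grading₁ V.linearization.grading₁ hg1 hg
  let φ : LInftyHom V V.linearization := .ofUnital hΦ hdeg hQ
  have hφ : ∀ v, φ.f₁ v = t (Sym.ι V.grading₁ v) := fun v =>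
    (LInftyHom.ofUnital_f₁ hΦ hdeg hQ v).trans ((hproj _).trans (hg_of _ (Sym.counit_ι _ v)))
  have htι' : ∀ z, V.q₁ z = 0 → z - t (Sym.ι V.grading₁ z) ∈ LinearMap.range V.q₁ := by
    intro z hz
    rw [← neg_sub]
    exact neg_mem (htι z hz)
  refine ⟨φ, (Cohomology.injective_map_iff φ.f₁_comp_q₁).2 ?_,
    (Cohomology.surjective_map_iff φ.f₁_comp_q₁).2 ?_⟩
  · rw [linearization_q₁]
    intro z hz hfz
    rw [hφ] at hfz
    exact (Submodule.sub_mem_iff_right _ hfz).1 (htι z hz)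
  · rw [linearization_q₁]
    intro (y : V.carrier) hy
    exact ⟨y, hy, (congrArg (fun z : V.carrier => y - z ∈ LinearMap.range V.q₁) (hφ y)).mpr
      (htι' y hy)⟩

theorem InclusionInjective.isQuasiAbelian [CharZero K] (hV : V.InclusionInjective) :
    V.IsQuasiAbelian :=
  ⟨V.linearization, V.linearization_isAbelian, .rel _ _ hV.exists_isQuasiIso⟩

theorem IsQuasiAbelian.inclusionInjective [CharZero K] (hV : V.IsQuasiAbelian) :
    V.InclusionInjective := by
  obtain ⟨A, hA, hVA⟩ := hV
  exact hVA.inclusionInjective_iff.2 hA.inclusionInjective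

end LInftyAlgebra

end Linearization

end LInf

end

theorem lemma1p10 {K : Type w} [Field K] [IsAlgClosed K] [CharZero K]
    (V W : LInf.LInftyAlgebra.{w, u} K) (hW : W.IsQuasiAbelian)
    (f : LInf.LInftyHom V W) (hf : Function.Injective f.cohomologyMap) :
    V.IsQuasiAbelian :=
  (hW.inclusionInjective.of_injective f hf).isQuasiAbelian
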